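/- **Theorem 2.2.** Let $\mathcal R\subseteq\mathcal S$ be integral domains. Assume that every element of $\mathcal R$ is encoded by its own string over some finite alphabet, in such a way that there are polynomial-time Turing machines that compute, from the codes of two elements of $\mathcal R$, the codes of their sum and of their product; nothing of this kind is assumed about $\mathcal S$. Consider the following two decision problems. 1. (Tensor rank.) Given a tensor $T\in\mathcal R^{l\times m\times n}$ (that is, $l,m,n\in\mathbb N$ and the list of all entries $T(i|j|k)\in\mathcal R$) and a number $r\in\mathbb N$, decide whether $\operatorname{rank}_{\mathcal S}T\le r$. Here $\operatorname{rank}_{\mathcal S}T$ is the smallest number of tensors of the form $a\otimes b\otimes c=(a_ib_jc_k)_{i,j,k}$ with $a\in\mathcal S^l$, $b\in\mathcal S^m$, $c\in\mathcal S^n$ whose sum is $T$. 2. (Polynomial systems.) Given a finite list of polynomials $f_1,\dots,f_t$ with coefficients in $\mathcal R$, in finitely many of the variables $x_0,x_1,x_2,\dots$, each stored as a sum of monomials and each monomial stored as a scalar of $\mathcal R$ together with a list of single variables to be multiplied, decide whether the equations $f_1=0,\dots,f_t=0$ have a simultaneous solution with all coordinates in $\mathcal S$. Instances are written as strings in the evident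 way, with elements of $\mathcal R$ written by their codes and natural numbers (the dimensions, $r$, and the indices of the variables) in binary. Then the two problems are polynomial-time equivalent: there is a polynomial-time many-one reduction from each of them to the other. (A polynomial-time many-one reduction from $\Pi_1$ to $\Pi_2$ is a map from instances of $\Pi_1$ to instances of $\Pi_2$ that takes yes-instances to yes-instances and no-instances to no-instances and is computed, on encodings of instances, by a Turing machine in time polynomial in the length of its input.) -/

import Mathlib

universe u v

namespace TensorComplexity

/-! ### Polynomial-time computation and reductions (Turing model) -/

/-- `f` is computed by a (multi-stack) Turing machine whose running time, on the input string
`ea a`, is at most a fixed polynomial in the length of `ea a`.  Nothing is required on strings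
that do not encode an element of `α`. -/
def PolyTimeComputable {α : Type u} {β : Type v} {Γ₀ Γ₁ : Type}
    (ea : α → List Γ₀) (eb : β → List Γ₁) (f : α → β) : Prop :=
  ∃ (M : Turing.TM2ComputableAux Γ₀ Γ₁) (time : Polynomial ℕ), ∀ a : α,
    Nonempty (Turing.TM2OutputsInTime M.tm
      ((ea a).map M.inputAlphabet.symm)
      (some ((eb (f a)).map M.outputAlphabet.symm))
      (time.eval (ea a).length))

/-- A decision problem: a type of instances, their encoding by strings over the alphabet `Γ`,
and the set of yes-instances. -/
structure DecisionProblem (Γ : Type) where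
  /-- the instances -/
  Inst : Type u
  /-- the string that presents an instance to a machine -/
  encode : Inst → List Γ
  /-- the instances with answer "yes" -/
  Yes : Inst → Prop

/-- Polynomial-time many-one reducibility of `P` to `Q`. -/
def PolyTimeReduces {Γ₀ Γ₁ : Type} (P : DecisionProblem.{u} Γ₀) (Q : DecisionProblem.{v} Γ₁) :
    Prop :=
  ∃ f : P.Inst → Q.Inst, PolyTimeComputable P.encode Q.encode f ∧ ∀ x, P.Yes x ↔ Q.Yes (f x)

/-- Polynomial-time many-one equivalence. -/
def PolyTimeEquivalent {Γ₀ Γ₁ : Type} (P : DecisionProblem.{u} Γ₀) (Q : DecisionProblem.{v} Γ₁) :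
    Prop :=
  PolyTimeReduces P Q ∧ PolyTimeReduces Q P

/-! ### Strings for ring elements, numbers, polynomial systems and tensors -/

/-- The alphabet used for instances: the letters of the alphabet `Γ` in which ring elements are
written, binary digits, and four terminators. -/
inductive Letter (Γ : Type) : Type where
  | ofElt (g : Γ)
  | bit (b : Bool)
  | endElt
  | endNum
  | endMonomial
  | endPoly

/-- A ring element: its code, followed by a terminator. -/
def encodeElt {R : Type u} {Γ : Type} (enc : R → List Γ) (a : R) : List (Letter Γ) :=
  (enc a).map Letter.ofElt ++ [Letter.endElt]

/-- A pair of ring elements. -/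
def encodePair {R : Type u} {Γ : Type} (enc : R → List Γ) (x : R × R) : List (Letter Γ) :=
  encodeElt enc x.1 ++ encodeElt enc x.2

/-- A natural number: its binary digits, followed by a terminator. -/
def encodeNum {Γ : Type} (n : ℕ) : List (Letter Γ) :=
  n.bits.map Letter.bit ++ [Letter.endNum]

/-- `enc` assigns to every element of `R` its own string over `Γ`, in such a way that addition and
multiplication of `R` can be performed in polynomial time. -/
structure IsPolyTimeEncoding {R : Type u} [CommRing R] {Γ : Type} (enc : R → List Γ) : Prop where
  injective : Function.Injective enc
  add : PolyTimeComputable (encodePair enc) (encodeElt enc) (fun x : R × R => x.1 + x.2)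
  mul : PolyTimeComputable (encodePair enc) (encodeElt enc) (fun x : R × R => x.1 * x.2)

/-! ### Systems of polynomial equations -/

/-- A monomial as it is stored: a scalar and a list of (indices of) variables, standing for the
scalar times the product of these variables. -/
structure StoredMonomial (R : Type u) : Type u where
  coeff : R
  vars : List ℕ

/-- A polynomial as it is stored: a list of monomials, standing for their sum. -/
abbrev StoredPoly (R : Type u) : Type u := List (StoredMonomial R)

/-- A finite system of polynomial equations `f₁ = 0, …, fₜ = 0`. -/
abbrev PolySystem (R : Type u) : Type u := List (StoredPoly R)

/-- The monomial `coeff * x_{i₁} * ⋯ * x_{iₖ}`. -/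
noncomputable def StoredMonomial.toMvPolynomial {R : Type u} [CommRing R] (p : StoredMonomial R) :
    MvPolynomial ℕ R :=
  MvPolynomial.C p.coeff * (p.vars.map MvPolynomial.X).prod

/-- The polynomial that a list of monomials stands for. -/
noncomputable def StoredPoly.toMvPolynomial {R : Type u} [CommRing R] (f : StoredPoly R) :
    MvPolynomial ℕ R :=
  (f.map StoredMonomial.toMvPolynomial).sum

/-- The equations of the system have a simultaneous solution with coordinates in `S`. -/
def PolySystem.HasSolution {R : Type u} [CommRing R] (S : Type v) [CommRing S] [Algebra R S]
    (F : PolySystem R) : Prop :=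
  ∃ x : ℕ → S, ∀ f ∈ F, MvPolynomial.aeval x (StoredPoly.toMvPolynomial f) = 0

def encodeMonomial {R : Type u} {Γ : Type} (enc : R → List Γ) (p : StoredMonomial R) :
    List (Letter Γ) :=
  encodeElt enc p.coeff ++ p.vars.flatMap encodeNum ++ [Letter.endMonomial]

def encodePoly {R : Type u} {Γ : Type} (enc : R → List Γ) (f : StoredPoly R) : List (Letter Γ) :=
  f.flatMap (encodeMonomial enc) ++ [Letter.endPoly]

def encodeSystem {R : Type u} {Γ : Type} (enc : R → List Γ) (F : PolySystem R) :
    List (Letter Γ) :=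
  F.flatMap (encodePoly enc)

/-- Given a system of polynomial equations with coefficients in `R`, does it have a solution
in `S`? -/
def polySystemProblem {R : Type u} [CommRing R] (S : Type v) [CommRing S] [Algebra R S]
    {Γ : Type} (enc : R → List Γ) : DecisionProblem.{u} (Letter Γ) where
  Inst := PolySystem R
  encode := encodeSystem enc
  Yes F := F.HasSolution S

/-! ### Tensor rank -/

/-- Order-three tensors of size `l × m × n` over `R`. -/
abbrev Tensor (R : Type u) (l m n : ℕ) : Type u := Fin l → Fin m → Fin n → R

/-- A simple tensor `a ⊗ b ⊗ c`. -/
def Tensor.IsSimple {S : Type v} [CommRing S] {l m n : ℕ} (T : Tensor S l m n) : Prop :=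
  ∃ (a : Fin l → S) (b : Fin m → S) (c : Fin n → S), T = fun i j k => a i * b j * c k

/-- `T` is a sum of `r` simple tensors over `S`. -/
def Tensor.IsSumOfSimple {S : Type v} [CommRing S] {l m n : ℕ} (T : Tensor S l m n) (r : ℕ) :
    Prop :=
  ∃ U : Fin r → Tensor S l m n, (∀ q, (U q).IsSimple) ∧ T = ∑ q, U q

/-- The rank of `T`: the smallest number of simple tensors over `S` whose sum is `T`. -/
noncomputable def Tensor.rank {S : Type v} [CommRing S] {l m n : ℕ} (T : Tensor S l m n) : ℕ :=
  sInf {r : ℕ | T.IsSumOfSimple r}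

/-- Every tensor is a sum of simple ones, so that the infimum in `Tensor.rank` is a minimum. -/
theorem Tensor.exists_isSumOfSimple {S : Type v} [CommRing S] {l m n : ℕ} (T : Tensor S l m n) :
    ∃ r : ℕ, T.IsSumOfSimple r := by
  let e := Fintype.equivFin (Fin l × Fin m × Fin n)
  let V : Fin l × Fin m × Fin n → Tensor S l m n := fun p i j k =>
    (if i = p.1 then T p.1 p.2.1 p.2.2 else 0) * (if j = p.2.1 then 1 else 0) *
      (if k = p.2.2 then 1 else 0)
  refine ⟨Fintype.card (Fin l × Fin m × Fin n), fun q => V (e.symm q),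
    fun q => ⟨_, _, _, rfl⟩, ?_⟩
  rw [e.symm.sum_comp V]
  funext i j k
  simp only [Finset.sum_apply, V]
  simp [Fintype.sum_prod_type]

/-- The rank with respect to `S` of a tensor with entries in `R`. -/
noncomputable def Tensor.rankOver {R : Type u} [CommRing R] (S : Type v) [CommRing S]
    [Algebra R S] {l m n : ℕ} (T : Tensor R l m n) : ℕ :=
  Tensor.rank (fun i j k => algebraMap R S (T i j k))

/-- An instance of the rank problem: a tensor over `R` and a bound `r`. -/
structure RankInstance (R : Type u) : Type u where
  (l m n : ℕ)
  tensor : Tensor R l m n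
  bound : ℕ

/-- The three dimensions, all entries in lexicographic order of their positions, and the bound. -/
def encodeRankInstance {R : Type u} {Γ : Type} (enc : R → List Γ) (I : RankInstance R) :
    List (Letter Γ) :=
  encodeNum I.l ++ encodeNum I.m ++ encodeNum I.n ++
    ((List.finRange I.l).flatMap fun i => (List.finRange I.m).flatMap fun j =>
      (List.finRange I.n).flatMap fun k => encodeElt enc (I.tensor i j k)) ++
    encodeNum I.bound

/-- Given a tensor `T` with entries in `R` and a number `r`, is the rank of `T` with respect to `S`
at most `r`? -/
def tensorRankProblem {R : Type u} [CommRing R] (S : Type v) [CommRing S] [Algebra R S]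
    {Γ : Type} (enc : R → List Γ) : DecisionProblem.{u} (Letter Γ) where
  Inst := RankInstance R
  encode := encodeRankInstance enc
  Yes I := I.tensor.rankOver S ≤ I.bound

end TensorComplexity

set_option linter.unusedSectionVars false
set_option linter.unusedSimpArgs false

namespace TensorComplexity

open Function

/-! ### A structured language for stack machines -/

/-! From rank to equations: `rank T ≤ r` says that every entry of `T` is a sum of `r` products of
coordinates, which is a polynomial system in these coordinates. The only danger is length. The bound
`r` is written in binary, but the rank never exceeds the number `l * (m * n)` of entries, so `r` may
be capped slightly above it.

From equations to rank there are two steps. First, a system becomes the question whether an affine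
family of matrices `A + ∑ xᵢ uᵢ ⊗ vᵢ` has a member with vanishing two-by-two minors. Besides the
columns `one` and `zero` there is a column for each initial segment of a monomial. Normalising the
entry at `unit 0`, `one` to 1 makes such a member the product of its column `one` and its row `unit
0`. The rows `pre` and `var` of a variable occurrence share a parameter `link`, which forces the
value of the longer segment to be the variable times the value of the shorter one. A row `sum` has
in the column `zero` the value of a polynomial, and the minors force it to vanish. This is
`value_assignment` and `assignment_of_minorsVanishOn`.

Second, a family with `k` parameters becomes a tensor with `k + 1` slices: one is block diagonal
with blocks `A` and the identity, and the others are the rank-one matrices `(uᵢ, 0) ⊗ (vᵢ, eᵢ)`. A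
member of rank at most one gives a decomposition into `2k + 1` simple tensors
(`completionTensor_eq_sum`). Conversely, over a field, the slice `none` plus `xᵢ` times the `i`th
slices has rank `k` plus the rank of the completion. The linear parts of the third factors span, so
some `x` annihilates `k` of the summands; the remaining `k + 1` leave rank at most one for the
completion.

Over a domain `S` this takes place in the fraction field, and the parameters must be brought back to
`S`. For this every row has three copies, so that two different solutions differ by row factors
spanning at least three dimensions (`exists_three_params`). An exchange argument then shows that the
other `k + 1` summands have third factors without linear part, and the parameters become polynomials
in the entries of the decomposition (`exists_minorsVanish`, `rankOver_tensor_le_iff`).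

For the complexity part, a structured language is compiled to stack machines (`code_correct`). Its
polynomial-time functions are closed under composition, pairing, case distinction and folds with
polynomially bounded states, from which both reductions are assembled. Ring elements are only
copied, compared by their codes, or printed as constants. -/

/-- Structured programs acting on stacks indexed by natural numbers. -/
inductive Prog (A : Type) : Type
  | skip
  | push (k : ℕ) (a : A)
  | seq (p q : Prog A)
  /-- pop stack `k` and branch on the result -/
  | case (k : ℕ) (f : Option A → Prog A)
  /-- while stack `k` is nonempty, pop it and run the branch of the letter obtained -/
  | loop (k : ℕ) (f : A → Prog A)

namespace Prog

variable {A : Type}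

/-- `Exec p s s' n`: the program `p` started in `s` stops in `s'` after `n` steps. -/
inductive Exec : Prog A → (ℕ → List A) → (ℕ → List A) → ℕ → Prop
  | skip (s) : Exec skip s s 1
  | push (k a s) : Exec (push k a) s (update s k (a :: s k)) 1
  | seq {p q s s' s'' n m} : Exec p s s' n → Exec q s' s'' m → Exec (seq p q) s s'' (n + m)
  | case {k f s s' n} : Exec (f (s k).head?) (update s k (s k).tail) s' n →
      Exec (case k f) s s' (n + 1)
  | loop_nil {k f s} : s k = [] → Exec (loop k f) s s 1
  | loop_cons {k f s s' s'' a t n m} : s k = a :: t → Exec (f a) (update s k t) s' n →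
      Exec (loop k f) s' s'' m → Exec (loop k f) s s'' (n + m + 1)

/-- Program points. -/
def Pos : Prog A → Type
  | skip => Unit
  | push _ _ => Unit
  | seq p q => Pos p ⊕ Pos q
  | case _ f => Option (Σ o, Pos (f o))
  | loop _ f => Option (Σ a, Pos (f a))

/-- The first program point. -/
def entry : (p : Prog A) → Pos p
  | skip => ()
  | push _ _ => ()
  | seq p _ => Sum.inl (entry p)
  | case _ _ => none
  | loop _ _ => none

theorem finite_pos [Finite A] : (p : Prog A) → Finite (Pos p)
  | skip => inferInstanceAs (Finite Unit)
  | push _ _ => inferInstanceAs (Finite Unit)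
  | seq p q =>
    have := finite_pos p
    have := finite_pos q
    inferInstanceAs (Finite (Pos p ⊕ Pos q))
  | case _ f =>
    have := fun o => finite_pos (f o)
    inferInstanceAs (Finite (Option (Σ o, Pos (f o))))
  | loop _ f =>
    have := fun o => finite_pos (f o)
    inferInstanceAs (Finite (Option (Σ o, Pos (f o))))

/-- All stacks used have an index below `N`. -/
def Uses (N : ℕ) : Prog A → Prop
  | skip => True
  | push k _ => k < N
  | seq p q => Uses N p ∧ Uses N q
  | case k f => k < N ∧ ∀ o, Uses N (f o)
  | loop k f => k < N ∧ ∀ a, Uses N (f a)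

theorem Uses.mono {N M : ℕ} (h : N ≤ M) : {p : Prog A} → Uses N p → Uses M p
  | skip, _ => trivial
  | push _ _, hp => lt_of_lt_of_le hp h
  | seq _ _, hp => ⟨hp.1.mono h, hp.2.mono h⟩
  | case _ _, hp => ⟨lt_of_lt_of_le hp.1 h, fun o => (hp.2 o).mono h⟩
  | loop _ _, hp => ⟨lt_of_lt_of_le hp.1 h, fun o => (hp.2 o).mono h⟩

/-- Over a finite alphabet a program has finitely many branches, so a maximum over them exists; the
machine needs a finite set of stacks. -/
theorem exists_uses [Finite A] (p : Prog A) : ∃ N, Uses N p := by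
  have key : ∀ {ι : Type} [Finite ι] (k : ℕ) (f : ι → Prog A), (∀ i, ∃ N, Uses N (f i)) →
      ∃ N, k < N ∧ ∀ i, Uses N (f i) := by
    intro ι _ k f h
    choose g hg using h
    obtain ⟨M, hM⟩ := Set.Finite.bddAbove (Set.finite_range g)
    exact ⟨max M (k + 1), by omega, fun i => (hg i).mono ((hM ⟨i, rfl⟩).trans (le_max_left _ _))⟩
  induction p with
  | skip => exact ⟨0, trivial⟩
  | push k a => exact ⟨k + 1, Nat.lt_succ_self k⟩
  | seq p q hp hq =>
    obtain ⟨N, hN⟩ := hp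
    obtain ⟨M, hM⟩ := hq
    exact ⟨max N M, hN.mono (le_max_left _ _), hM.mono (le_max_right _ _)⟩
  | case k f h => exact key k f h
  | loop k f h => exact key k f h

/-- The machine code of a program, relative to the placement `e` of its points among the labels
and to the label `x` at which execution continues. -/
def code (N : ℕ) [NeZero N] {Λ : Type} : (p : Prog A) → (Pos p → Λ) → Λ → Pos p →
    Turing.TM2.Stmt (fun _ : Fin N => A) Λ (Option A)
  | skip, _, x, _ => .goto fun _ => x
  | push k a, _, x, _ => .push (Fin.ofNat N k) (fun _ => a) (.goto fun _ => x)
  | seq p q, e, _, Sum.inl a => code N p (fun y => e (Sum.inl y)) (e (Sum.inr (entry q))) a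
  | seq _ q, e, x, Sum.inr b => code N q (fun y => e (Sum.inr y)) x b
  | case k f, e, _, none =>
      .pop (Fin.ofNat N k) (fun _ o => o) (.goto fun o => e (some ⟨o, entry (f o)⟩))
  | case _ f, e, x, some y => code N (f y.1) (fun z => e (some ⟨y.1, z⟩)) x y.2
  | loop k f, e, x, none =>
      .pop (Fin.ofNat N k) (fun _ o => o) (.goto fun o => match o with
        | none => x
        | some a => e (some ⟨a, entry (f a)⟩))
  | loop _ f, e, _, some y => code N (f y.1) (fun z => e (some ⟨y.1, z⟩)) (e none) y.2

theorem restrict_update {N : ℕ} [NeZero N] (s : ℕ → List A) {k : ℕ} (hk : k < N) (l : List A) :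
    update (fun i : Fin N => s i) (Fin.ofNat N k) l = fun i : Fin N => update s k l i := by
  funext i
  have : (i = Fin.ofNat N k) ↔ ((i : ℕ) = k) := by
    rw [Fin.ext_iff, Fin.val_ofNat, Nat.mod_eq_of_lt hk]
  by_cases h : (i : ℕ) = k
  · rw [this.2 h, Fin.val_ofNat, Nat.mod_eq_of_lt hk, update_self, update_self]
  · rw [update_of_ne (fun h' => h (this.1 h')), update_of_ne h]

theorem restrict_apply {N : ℕ} [NeZero N] (s : ℕ → List A) {k : ℕ} (hk : k < N) :
    s ((Fin.ofNat N k : Fin N) : ℕ) = s k := by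
  rw [Fin.val_ofNat, Nat.mod_eq_of_lt hk]

/-- Induction on the execution. The ambient machine `M`, the placement `e` and the exit `x` vary, so
that the statement applies to a subprogram sitting inside a larger program. `Exec` charges one step
per visited label, whence the exact count. The internal state only holds the last popped letter and
is irrelevant between labels. -/
theorem code_correct {N : ℕ} [NeZero N] {p : Prog A} {s s' : ℕ → List A} {n : ℕ}
    (h : Exec p s s' n) : ∀ {Λ : Type} (M : Λ → Turing.TM2.Stmt (fun _ : Fin N => A) Λ (Option A))
    (e : Pos p → Λ) (x : Λ), Uses N p → (∀ y, M (e y) = code N p e x y) → ∀ v : Option A,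
    ∃ v', (flip bind (Turing.TM2.step M))^[n]
      (some ⟨some (e (entry p)), v, fun i : Fin N => s i⟩) =
      some ⟨some x, v', fun i : Fin N => s' i⟩ := by
  have pop_step : ∀ {Λ : Type} (M : Λ → Turing.TM2.Stmt (fun _ : Fin N => A) Λ (Option A))
      (l : Λ) (k : ℕ) (g : Option A → Λ) (s : ℕ → List A) (v : Option A), k < N →
      M l = .pop (Fin.ofNat N k) (fun _ o => o) (.goto g) →
      (flip bind (Turing.TM2.step M)) (some ⟨some l, v, fun i : Fin N => s i⟩) =
      some ⟨some (g (s k).head?), (s k).head?, fun i : Fin N => update s k (s k).tail i⟩ := by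
    intro Λ M l k g s v hk hM
    simp only [flip, Option.bind_eq_bind, Option.bind_some, Turing.TM2.step, hM,
      Turing.TM2.stepAux, restrict_apply s hk, restrict_update s hk]
  induction h with
  | skip s =>
    intro Λ M e x _ hM v
    exact ⟨v, by simp [flip, Turing.TM2.step, hM, code]⟩
  | push k a s =>
    intro Λ M e x hu hM v
    have hk : k < N := hu
    refine ⟨v, ?_⟩
    simp only [iterate_one, flip, Option.bind_eq_bind, Option.bind_some, Turing.TM2.step, hM, code,
      Turing.TM2.stepAux, restrict_apply s hk, restrict_update s hk]
  | @seq p q s s' s'' n m hp hq ihp ihq =>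
    intro Λ M e x hu hM v
    obtain ⟨v1, h1⟩ := ihp M (fun y => e (Sum.inl y)) (e (Sum.inr (entry q))) hu.1
      (fun y => hM (Sum.inl y)) v
    obtain ⟨v2, h2⟩ := ihq M (fun y => e (Sum.inr y)) x hu.2 (fun y => hM (Sum.inr y)) v1
    refine ⟨v2, ?_⟩
    rw [Nat.add_comm, iterate_add_apply]
    exact (congrArg _ h1).trans h2
  | @case k f s s' n hf ih =>
    intro Λ M e x hu hM v
    obtain ⟨v1, h1⟩ := ih M (fun z => e (some ⟨_, z⟩)) x (hu.2 _)
      (fun y => hM (some ⟨_, y⟩)) (s k).head?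
    refine ⟨v1, ?_⟩
    rw [iterate_add_apply, iterate_one]
    exact (congrArg _ (pop_step M _ k _ s v hu.1 (hM none))).trans h1
  | @loop_nil k f s hs =>
    intro Λ M e x hu hM v
    refine ⟨none, ?_⟩
    rw [iterate_one]
    refine (pop_step M _ k _ s v hu.1 (hM none)).trans ?_
    have : update s k (s k).tail = s := by
      rw [hs]; conv_rhs => rw [← update_eq_self k s, hs]
      rfl
    rw [this, hs]
    rfl
  | @loop_cons k f s s' s'' a t n m hs hf hl ihf ihl =>
    intro Λ M e x hu hM v
    -- The body exits to the test label `e none`, where the remaining iterations start.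
    obtain ⟨v1, h1⟩ := ihf M (fun z => e (some ⟨_, z⟩)) (e none) (hu.2 _)
      (fun y => hM (some ⟨_, y⟩)) (some a)
    obtain ⟨v2, h2⟩ := ihl M e x hu hM v1
    refine ⟨v2, ?_⟩
    rw [iterate_add_apply, iterate_one]
    refine (congrArg _ (pop_step M _ k _ s v hu.1 (hM none))).trans ?_
    rw [Nat.add_comm, iterate_add_apply, hs]
    exact (congrArg _ h1).trans h2

/-- The machine that runs a program and then halts in its initial state. -/
noncomputable def machine [Finite A] (p : Prog A) (N : ℕ) [NeZero N] : Turing.FinTM2 :=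
  haveI := finite_pos p
  { K := Fin N
    k₀ := 0
    k₁ := 0
    Γ := fun _ => A
    Λ := Option (Pos p)
    main := some (entry p)
    ΛFin := Fintype.ofFinite _
    σ := Option A
    initialState := none
    σFin := Fintype.ofFinite _
    Γk₀Fin := Fintype.ofFinite _
    m := fun l => match l with
      | none => .load (fun _ => none) .halt
      | some y => code N p some none y }

/-- The additional step is taken at the label `none`, which resets the internal state to its initial
value, as `haltList` demands. -/
theorem machine_outputs [Finite A] {p : Prog A} {N : ℕ} [NeZero N] (hu : Uses N p) {n : ℕ}
    {x y : List A} (h : Exec p (update (fun _ => []) 0 x) (update (fun _ => []) 0 y) n) {m : ℕ}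
    (hm : n + 1 ≤ m) : Nonempty (Turing.TM2OutputsInTime (machine p N) x (some y) m) := by
  obtain ⟨v, hv⟩ := code_correct h (machine p N).m some none hu (fun y => rfl) none
  refine ⟨⟨⟨n + 1, ?_⟩, hm⟩⟩
  have h0 : ∀ z : List A, (fun i : Fin N => (update (fun _ : ℕ => ([] : List A)) 0 z) i) =
      fun k => @dite (List A) (k = 0) _ (fun h => z) fun _ => [] := by
    intro z
    funext i
    by_cases hi : i = 0
    · subst hi; simp
    · have : (i : ℕ) ≠ 0 := fun h' => hi (Fin.ext (by simpa using h'))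
      simp [hi, this]
  have hi : Turing.initList (machine p N) x =
      ⟨some (some (entry p)), none, fun i : Fin N => (update (fun _ : ℕ => ([] : List A)) 0 x) i⟩ :=
    by
    rw [h0]; rfl
  have ho : Turing.haltList (machine p N) y =
      ⟨none, none, fun i : Fin N => (update (fun _ : ℕ => ([] : List A)) 0 y) i⟩ := by
    rw [h0]; rfl
  refine (congrArg _ (congrArg some hi)).trans (Eq.trans ?_ (congrArg some ho).symm)
  rw [Nat.add_comm, iterate_add_apply]
  exact congrArg _ hv

end Prog

end TensorComplexity


/-! ### Running times and elementary stack programs -/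

namespace TensorComplexity

open Function

namespace Prog

variable {A : Type}

/-- `p` leads from `s` to `s'` in at most `t` steps. -/
def Runs (p : Prog A) (s s' : ℕ → List A) (t : ℕ) : Prop := ∃ n ≤ t, Exec p s s' n

theorem Runs.mono {p : Prog A} {s s' : ℕ → List A} {t t' : ℕ} (h : Runs p s s' t) (ht : t ≤ t') :
    Runs p s s' t' :=
  let ⟨n, hn, he⟩ := h
  ⟨n, hn.trans ht, he⟩

theorem Runs.of_eq {p : Prog A} {s s' s'' : ℕ → List A} {t t' : ℕ} (h : Runs p s s' t)
    (hs : s' = s'') (ht : t ≤ t') : Runs p s s'' t' := hs ▸ h.mono ht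

theorem Runs.seq {p q : Prog A} {s s' s'' : ℕ → List A} {t t' : ℕ} (h : Runs p s s' t)
    (h' : Runs q s' s'' t') : Runs (.seq p q) s s'' (t + t') :=
  let ⟨n, hn, he⟩ := h
  let ⟨n', hn', he'⟩ := h'
  ⟨n + n', add_le_add hn hn', .seq he he'⟩

theorem runs_skip (s : ℕ → List A) : Runs .skip s s 1 := ⟨1, le_rfl, .skip s⟩

theorem runs_push (k : ℕ) (a : A) (s : ℕ → List A) :
    Runs (.push k a) s (update s k (a :: s k)) 1 := ⟨1, le_rfl, .push k a s⟩

theorem Runs.case {k : ℕ} {f : Option A → Prog A} {s s' : ℕ → List A} {t : ℕ}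
    (h : Runs (f (s k).head?) (update s k (s k).tail) s' t) : Runs (.case k f) s s' (t + 1) :=
  let ⟨n, hn, he⟩ := h
  ⟨n + 1, Nat.succ_le_succ hn, .case he⟩

theorem runs_loop_nil {k : ℕ} {f : A → Prog A} {s : ℕ → List A} (h : s k = []) :
    Runs (.loop k f) s s 1 := ⟨1, le_rfl, .loop_nil h⟩

theorem Runs.loop_cons {k : ℕ} {f : A → Prog A} {s s' s'' : ℕ → List A} {a : A} {l : List A}
    {t t' : ℕ} (h : s k = a :: l) (hf : Runs (f a) (update s k l) s' t)
    (hl : Runs (.loop k f) s' s'' t') : Runs (.loop k f) s s'' (t + t' + 1) :=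
  let ⟨n, hn, he⟩ := hf
  let ⟨n', hn', he'⟩ := hl
  ⟨n + n' + 1, Nat.succ_le_succ (add_le_add hn hn'), .loop_cons h he he'⟩

/-- A step pushes at most one letter. Thus a time bound is also a bound for the length of the
output, which keeps compositions polynomial. -/
theorem Exec.length_le {p : Prog A} {s s' : ℕ → List A} {n : ℕ} (h : Exec p s s' n) (j : ℕ) :
    (s' j).length ≤ (s j).length + n := by
  induction h with
  | skip s => omega
  | push k a s =>
    by_cases hj : j = k
    · subst hj; simp
    · simp [hj]
  | seq _ _ h1 h2 => omega
  | @case k f s s' n _ h1 =>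
    by_cases hj : j = k
    · subst hj; simp at h1; omega
    · simp [hj] at h1; omega
  | loop_nil _ => omega
  | @loop_cons k f s s' s'' a t n m hs _ _ h1 h2 =>
    by_cases hj : j = k
    · subst hj; rw [hs]; simp at h1 ⊢; omega
    · simp [hj] at h1; omega

/-- Push the letters of a word, the first one last. -/
def pushes (k : ℕ) : List A → Prog A
  | [] => skip
  | a :: l => seq (pushes k l) (push k a)

theorem runs_pushes (k : ℕ) (l : List A) (s : ℕ → List A) :
    Runs (pushes k l) s (update s k (l ++ s k)) (l.length + 1) := by
  induction l with
  | nil => exact (runs_skip s).of_eq (by simp) le_rfl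
  | cons a l ih => exact (ih.seq (runs_push k a _)).of_eq (by simp) le_rfl

/-- Move stack `k` to stack `k₁`, replacing letters by words; the order of the letters is
reversed. -/
def mvMap (k k₁ : ℕ) (w : A → List A) : Prog A := loop k fun a => pushes k₁ (w a)

/-- Each letter costs one pop and at most `C + 1` steps of `pushes`. -/
theorem runs_mvMap {k k₁ : ℕ} (hk : k ≠ k₁) {w : A → List A} {C : ℕ} (hw : ∀ a, (w a).length ≤ C)
    (s : ℕ → List A) : Runs (mvMap k k₁ w) s
      (update (update s k []) k₁ ((s k).reverse.flatMap w ++ s k₁))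
      ((C + 2) * (s k).length + 1) := by
  generalize hl : s k = l
  induction l generalizing s with
  | nil =>
    have : update (update s k []) k₁ (s k₁) = s := by
      rw [← hl, update_eq_self, update_eq_self]
    exact (runs_loop_nil hl).of_eq (by simp [this]) (by omega)
  | cons a l ih =>
    have h1 := runs_pushes k₁ (w a) (update s k l)
    have h2 := ih (update (update s k l) k₁ (w a ++ update s k l k₁)) (by simp [hk])
    refine (Runs.loop_cons (f := fun a => pushes k₁ (w a)) hl h1 h2).of_eq ?_ ?_
    · rw [update_comm hk.symm]
      simp [hk.symm]
    · have := hw a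
      simp only [List.length_cons]
      nlinarith

/-- Move stack `k` to stack `k₁`, reversing the order of the letters. -/
def mv (k k₁ : ℕ) : Prog A := mvMap k k₁ fun a => [a]

theorem runs_mv {k k₁ : ℕ} (hk : k ≠ k₁) (s : ℕ → List A) : Runs (mv k k₁) s
      (update (update s k []) k₁ ((s k).reverse ++ s k₁)) (3 * (s k).length + 1) :=
  (runs_mvMap (w := fun a : A => [a]) (C := 1) hk (by simp) s).of_eq (by simp) le_rfl

/-- Move stack `k` to both stacks `k₁` and `k₂`, reversing the order of the letters. -/
def mvTwo (k k₁ k₂ : ℕ) : Prog A := loop k fun a => seq (push k₁ a) (push k₂ a)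

theorem runs_mvTwo {k k₁ k₂ : ℕ} (h₁ : k ≠ k₁) (h₂ : k ≠ k₂) (h₁₂ : k₁ ≠ k₂) (s : ℕ → List A) :
    Runs (mvTwo k k₁ k₂) s (update (update (update s k []) k₁ ((s k).reverse ++ s k₁)) k₂
      ((s k).reverse ++ s k₂)) (3 * (s k).length + 1) := by
  generalize hl : s k = l
  induction l generalizing s with
  | nil =>
    have : update (update (update s k []) k₁ (s k₁)) k₂ (s k₂) = s := by
      rw [← hl, update_eq_self, update_eq_self, update_eq_self]
    exact (runs_loop_nil hl).of_eq (by simp [this]) (by omega)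
  | cons a l ih =>
    have h1 := (runs_push k₁ a (update s k l)).seq (runs_push k₂ a _)
    have h2 := ih _ (show (update (update (update s k l) k₁ (a :: update s k l k₁)) k₂
      (a :: update (update s k l) k₁ (a :: update s k l k₁) k₂)) k = l by simp [h₁, h₂])
    refine (Runs.loop_cons (f := fun a => seq (push k₁ a) (push k₂ a)) hl h1 h2).of_eq ?_
      (by simp only [List.length_cons]; omega)
    funext j
    simp only [update_apply]
    split_ifs <;> simp_all

/-- Empty stack `k`. -/
def clear (k : ℕ) : Prog A := loop k fun _ => skip

theorem runs_clear (k : ℕ) (s : ℕ → List A) :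
    Runs (clear k) s (update s k []) (2 * (s k).length + 1) := by
  generalize hl : s k = l
  induction l generalizing s with
  | nil =>
    have : update s k [] = s := by rw [← hl, update_eq_self]
    exact (runs_loop_nil hl).of_eq this.symm (by omega)
  | cons a l ih =>
    have h2 := ih (update s k l) (by simp)
    exact (Runs.loop_cons (f := fun _ => skip) hl (runs_skip _) h2).of_eq (by simp)
      (by simp only [List.length_cons]; omega)

end Prog

/-! ### Self-delimiting words -/

variable {Γ : Type}

/-- A word in which every letter is preceded by a marker. -/
def stuff (w : List (Letter Γ)) : List (Letter Γ) := w.flatMap fun c => [.bit true, c]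

@[simp] theorem stuff_nil : stuff ([] : List (Letter Γ)) = [] := rfl

@[simp] theorem stuff_cons (c : Letter Γ) (w : List (Letter Γ)) :
    stuff (c :: w) = .bit true :: c :: stuff w := rfl

@[simp] theorem length_stuff (w : List (Letter Γ)) : (stuff w).length = 2 * w.length := by
  induction w with
  | nil => rfl
  | cons c w ih => simp [ih]; ring

/-- The code of a pair of words. -/
def pairUp (x y : List (Letter Γ)) : List (Letter Γ) := stuff x ++ .bit false :: y

@[simp] theorem length_pairUp (x y : List (Letter Γ)) :
    (pairUp x y).length = 2 * x.length + y.length + 1 := by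
  simp [pairUp]; ring

/-- Reading from the left, the marker tells whether another letter of the first word follows, so the
boundary is determined. -/
theorem stuff_injective_aux (x x' y y' : List (Letter Γ)) (h : pairUp x y = pairUp x' y') :
    x = x' ∧ y = y' := by
  induction x generalizing x' with
  | nil =>
    cases x' with
    | nil => simpa [pairUp] using h
    | cons c x' => simp [pairUp] at h
  | cons c x ih =>
    cases x' with
    | nil => simp [pairUp] at h
    | cons c' x' =>
      have h' : c = c' ∧ pairUp x y = pairUp x' y' := by simpa [pairUp] using h
      obtain ⟨h1, h2⟩ := ih x' h'.2
      exact ⟨by rw [h'.1, h1], h2⟩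

namespace Prog

/-- Move the word in front of the first terminator of stack `k` to stack `k₁`, reversed, using the
stack `kf` as a flag. -/
def unstuff (k k₁ kf : ℕ) : Prog (Letter Γ) :=
  seq (push kf (.bit true)) (loop kf fun _ => case k fun o => match o with
    | some (.bit true) => case k fun o => match o with
      | some a => seq (push k₁ a) (push kf (.bit true))
      | none => skip
    | _ => skip)

/-- The stack `kf` turns the loop into a while loop: the flag is pushed again after each marked
letter, and is left empty once the terminator has been popped. -/
theorem runs_unstuff {k k₁ kf : ℕ} (h₁ : k ≠ k₁) (h₂ : k ≠ kf) (h₁₂ : k₁ ≠ kf)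
    (s : ℕ → List (Letter Γ)) (x y : List (Letter Γ)) (hs : s k = pairUp x y) (hf : s kf = []) :
    Runs (unstuff k k₁ kf) s (update (update s k y) k₁ (x.reverse ++ s k₁))
      (5 * x.length + 5) := by
  refine ((runs_push kf (.bit true) s).seq (t' := 5 * x.length + 4) ?_).mono (by omega)
  rw [hf]
  induction x generalizing s with
  | nil =>
    refine (Runs.loop_cons (a := .bit true) (l := []) (t := 2) (t' := 1) (by simp)
      (s' := update s k y) ?_ ?_).mono (by simp)
    · refine Runs.case ?_
      have e1 : update (update s kf [Letter.bit true]) kf [] = s := by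
        rw [update_idem, ← hf, update_eq_self]
      have e2 : s k = .bit false :: y := by simpa [pairUp] using hs
      rw [e1, e2]
      exact runs_skip _
    · have : update (update s k y) k₁ (s k₁) = update s k y := by
        rw [update_comm h₁, update_eq_self]
      simpa [this] using runs_loop_nil (k := kf) (s := update s k y) (by simp [h₂.symm, hf])
  | cons a x ih =>
    have hi := ih (update (update s k (pairUp x y)) k₁ (a :: s k₁))
      (by simp [h₁]) (by simp [h₂.symm, h₁₂.symm, hf])
    refine (Runs.loop_cons (a := .bit true) (l := []) (t := 4)
      (s' := update (update (update s k (pairUp x y)) k₁ (a :: s k₁)) kf [Letter.bit true])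
      (by simp) ?_ hi).of_eq ?_ ?_
    rotate_left
    · funext j
      simp only [update_apply]
      split_ifs <;> simp_all
    · simp only [List.length_cons]; omega
    · refine Runs.case ?_
      have e1 : update (update s kf [Letter.bit true]) kf [] = s := by
        rw [update_idem, ← hf, update_eq_self]
      have e2 : s k = .bit true :: a :: pairUp x y := by simpa [pairUp] using hs
      rw [e1, e2]
      refine Runs.case ?_
      simp only [List.head?_cons, List.tail_cons, update_self, update_idem]
      have h3 := (runs_push k₁ a (update s k (pairUp x y))).seq (runs_push kf (.bit true) _)
      simpa [h₁.symm, h₂.symm, h₁₂.symm, hf] using h3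

/-- Concatenate the words of a list. -/
def joinAll (k k₁ : ℕ) : Prog (Letter Γ) := loop k fun a => match a with
  | .bit true => case k fun o => match o with
    | some c => push k₁ c
    | none => skip
  | _ => skip

theorem runs_joinAll {k k₁ : ℕ} (h₁ : k ≠ k₁) (s : ℕ → List (Letter Γ))
    (l : List (List (Letter Γ))) (hs : s k = l.flatMap fun x => stuff x ++ [.bit false]) :
    Runs (joinAll k k₁) s (update (update s k []) k₁ (l.flatten.reverse ++ s k₁))
      (3 * (s k).length + 1) := by
  induction l generalizing s with
  | nil =>
    have : update (update s k []) k₁ (s k₁) = s := by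
      rw [show ([] : List (Letter Γ)) = s k from hs.symm, update_eq_self, update_eq_self]
    exact (runs_loop_nil (k := k) hs).of_eq (by simp [this]) (by omega)
  | cons x l ih =>
    induction x generalizing s with
    | nil =>
      have hs' : s k = .bit false :: l.flatMap fun x => stuff x ++ [.bit false] := by simpa using hs
      have h2 := ih (update s k (l.flatMap fun x => stuff x ++ [.bit false])) (by simp)
      have h3 := Runs.loop_cons hs' (runs_skip _) h2
      exact h3.of_eq (by simp [h₁.symm]) (by rw [hs']; simp only [update_self, List.length_cons]; omega)
    | cons c x ihx =>
      have hs' : s k = .bit true :: c :: ((x :: l).flatMap fun x => stuff x ++ [.bit false]) := by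
        simpa using hs
      set r := (x :: l).flatMap fun x => stuff x ++ [.bit false] with hr
      have h2 := ihx (update (update s k r) k₁ (c :: s k₁)) (by simp [h₁])
      have h1 : Runs (case k fun o => match o with
          | some c => push k₁ c
          | none => skip) (update s k (c :: r)) (update (update s k r) k₁ (c :: s k₁)) 2 := by
        refine Runs.case ?_
        simpa [h₁.symm] using runs_push k₁ c (update s k r)
      have h3 := Runs.loop_cons hs' h1 h2
      refine h3.of_eq ?_ ?_
      · funext j
        simp only [update_apply]
        split_ifs <;> simp_all
      · rw [hs']
        simp only [update_of_ne h₁, update_self, List.length_cons]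
        omega

/-- Four consecutive work stacks on top of an untouched part. -/
def St {A : Type} (s : ℕ → List A) (i : ℕ) (w x y z : List A) : ℕ → List A := fun k =>
  if k < i then s k else if k = i then w else if k = i + 1 then x else if k = i + 2 then y
  else if k = i + 3 then z else []

section St

variable {A : Type} (s : ℕ → List A) (i : ℕ) (w x y z v : List A)

@[simp] theorem St_zero : St s i w x y z i = w := by simp [St]
@[simp] theorem St_one : St s i w x y z (i + 1) = x := by simp [St]
@[simp] theorem St_two : St s i w x y z (i + 2) = y := by simp [St]
@[simp] theorem St_three : St s i w x y z (i + 3) = z := by simp [St]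

@[simp] theorem update_St_zero : update (St s i w x y z) i v = St s i v x y z := by
  funext k
  by_cases h : k = i
  · subst h; simp
  · simp [h, St]

@[simp] theorem update_St_one : update (St s i w x y z) (i + 1) v = St s i w v y z := by
  funext k
  by_cases h : k = i + 1
  · subst h; simp
  · simp [h, St]

@[simp] theorem update_St_two : update (St s i w x y z) (i + 2) v = St s i w x v z := by
  funext k
  by_cases h : k = i + 2
  · subst h; simp
  · simp [h, St]

@[simp] theorem update_St_three : update (St s i w x y z) (i + 3) v = St s i w x y v := by
  funext k
  by_cases h : k = i + 3
  · subst h; simp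
  · simp [h, St]

end St

end Prog

end TensorComplexity


/-! ### Polynomial-time functions between encoded types -/

namespace TensorComplexity

open Function Prog

theorem eval_mono (p : Polynomial ℕ) {m n : ℕ} (h : m ≤ n) : p.eval m ≤ p.eval n := by
  rw [Polynomial.eval_eq_sum_range, Polynomial.eval_eq_sum_range]
  gcongr

namespace Prog

section St

variable {A : Type} (s : ℕ → List A) (i : ℕ) (w x y z v : List A)

theorem St_shift_one : St (St s i w x y z) (i + 1) v [] [] [] = St s i w v [] [] := by
  funext k
  unfold St
  split_ifs <;> first | rfl | omega

theorem St_shift_two : St (St s i w x y z) (i + 2) v [] [] [] = St s i w x v [] := by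
  funext k
  unfold St
  split_ifs <;> first | rfl | omega

/-- Correctness holds over every untouched part `s`, so data waiting on stack `i` can be absorbed
into it while a program works on stack `i + 1`. -/
theorem Runs.shift_one {p : Prog A} {t : ℕ} {v v' : List A}
    (h : ∀ s, Runs p (St s (i + 1) v [] [] []) (St s (i + 1) v' [] [] []) t) :
    Runs p (St s i w v [] []) (St s i w v' [] []) t := by
  have := h (St s i w [] [] [])
  rwa [St_shift_one, St_shift_one] at this

theorem Runs.shift_two {p : Prog A} {t : ℕ} {v v' : List A}
    (h : ∀ s, Runs p (St s (i + 2) v [] [] []) (St s (i + 2) v' [] [] []) t) :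
    Runs p (St s i w x v []) (St s i w x v' []) t := by
  have := h (St s i w x [] [])
  rwa [St_shift_two, St_shift_two] at this

end St

end Prog

variable {Γ : Type} {α β γ σ : Type*}

/-- `f` is computed in polynomial time, with respect to the encodings `ea` and `eb`, by structured
programs that work in place on any stack and use the stacks above it as work space. -/
def PolyTime (ea : α → List (Letter Γ)) (eb : β → List (Letter Γ)) (f : α → β) : Prop :=
  ∃ (P : ℕ → Prog (Letter Γ)) (t : Polynomial ℕ), ∀ a i s,
    Runs (P i) (St s i (ea a) [] [] []) (St s i (eb (f a)) [] [] []) (t.eval (ea a).length)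

instance [Finite Γ] : Finite (Letter Γ) :=
  Finite.of_injective (β := Γ ⊕ Bool ⊕ Fin 4) (fun
    | .ofElt g => .inl g
    | .bit b => .inr (.inl b)
    | .endElt => .inr (.inr 0)
    | .endNum => .inr (.inr 1)
    | .endMonomial => .inr (.inr 2)
    | .endPoly => .inr (.inr 3)) (by
    intro a b h
    cases a <;> cases b <;> simp_all)

theorem PolyTime.polyTimeComputable [Finite Γ] {ea : α → List (Letter Γ)}
    {eb : β → List (Letter Γ)} {f : α → β} (h : PolyTime ea eb f) :
    PolyTimeComputable ea eb f := by
  obtain ⟨P, t, hP⟩ := h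
  obtain ⟨N, hN⟩ := exists_uses (P 0)
  -- The bound is raised to `N + 1` only to have at least one stack.
  refine ⟨⟨machine (P 0) (N + 1), Equiv.refl _, Equiv.refl _⟩, t + 1, fun a => ?_⟩
  obtain ⟨n, hn, he⟩ := hP a 0 fun _ => []
  have hSt : ∀ w, St (fun _ : ℕ => ([] : List (Letter Γ))) 0 w [] [] [] =
      update (fun _ => []) 0 w := by
    intro w
    funext k
    by_cases hk : k = 0
    · subst hk; simp [St]
    · simp [hk, St]
  rw [hSt, hSt] at he
  have := machine_outputs (hN.mono (Nat.le_succ N)) he (Nat.succ_le_succ hn)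
  have hid : ∀ l : List (Letter Γ), l.map (Equiv.refl (Letter Γ)).symm = l := fun l => by simp
  rw [Polynomial.eval_add, Polynomial.eval_one]
  erw [hid, hid]
  exact this

/-- The output is at most as long as the input and the running time together; the summand `X`
accounts for the input. -/
theorem PolyTime.exists_bounds {ea : α → List (Letter Γ)} {eb : β → List (Letter Γ)} {f : α → β}
    (h : PolyTime ea eb f) : ∃ (P : ℕ → Prog (Letter Γ)) (t : Polynomial ℕ),
    (∀ a i s, Runs (P i) (St s i (ea a) [] [] []) (St s i (eb (f a)) [] [] [])
      (t.eval (ea a).length)) ∧ ∀ a, (eb (f a)).length ≤ t.eval (ea a).length := by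
  obtain ⟨P, t, hP⟩ := h
  refine ⟨P, t + .X, fun a i s => (hP a i s).mono (by simp), fun a => ?_⟩
  obtain ⟨n, hn, he⟩ := hP a 0 fun _ => []
  have := he.length_le 0
  simp [St] at this ⊢
  omega

theorem PolyTime.exists_length_le {ea : α → List (Letter Γ)} {eb : β → List (Letter Γ)} {f : α → β}
    (h : PolyTime ea eb f) :
    ∃ t : Polynomial ℕ, ∀ a, (eb (f a)).length ≤ t.eval (ea a).length :=
  let ⟨_, t, h⟩ := h.exists_bounds
  ⟨t, h.2⟩

namespace PolyTime

variable {ea : α → List (Letter Γ)} {eb : β → List (Letter Γ)} {ec : γ → List (Letter Γ)}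

theorem id : PolyTime ea ea (fun a => a) :=
  ⟨fun _ => .skip, 1, fun a i s => (runs_skip _).mono (by simp)⟩

theorem comp {g : β → γ} {f : α → β} (hg : PolyTime eb ec g) (hf : PolyTime ea eb f) :
    PolyTime ea ec (fun a => g (f a)) := by
  obtain ⟨P, t, hP, hb⟩ := hf.exists_bounds
  obtain ⟨Q, u, hQ⟩ := hg
  refine ⟨fun i => .seq (P i) (Q i), t + u.comp t, fun a i s =>
    ((hP a i s).seq (hQ (f a) i s)).mono ?_⟩
  simpa using eval_mono u (hb a)

theorem const (b : β) : PolyTime ea eb (fun _ => b) := by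
  refine ⟨fun i => .seq (clear i) (pushes i (eb b)), 2 * .X + 2 + .C (eb b).length, fun a i s => ?_⟩
  refine ((runs_clear i _).seq (runs_pushes i (eb b) _)).of_eq (by simp) ?_
  simp
  omega

/-- The code of a pair. -/
def _root_.TensorComplexity.prodEnc (ea : α → List (Letter Γ)) (eb : β → List (Letter Γ))
    (p : α × β) : List (Letter Γ) := pairUp (ea p.1) (eb p.2)

theorem fst : PolyTime (prodEnc ea eb) ea Prod.fst := by
  refine ⟨fun i => .seq (unstuff i (i + 1) (i + 2)) (.seq (clear i) (mv (i + 1) i)),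
    10 * .X + 10, fun ⟨a, b⟩ i s => ?_⟩
  have h1 : Runs (unstuff i (i + 1) (i + 2)) (St s i (pairUp (ea a) (eb b)) [] [] [])
      (St s i (eb b) (ea a).reverse [] []) (5 * (ea a).length + 5) :=
    (runs_unstuff (by omega) (by omega) (by omega) _ _ _ (St_zero ..) (St_two ..)).of_eq (by simp) le_rfl
  have h2 := runs_clear i (St s i (eb b) (ea a).reverse [] [])
  have h3 := runs_mv (k := i + 1) (k₁ := i) (by omega) (St s i [] (ea a).reverse [] [])
  rw [update_St_zero] at h2
  refine (h1.seq (h2.seq h3)).of_eq (by simp) ?_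
  simp [prodEnc]
  omega

theorem snd : PolyTime (prodEnc ea eb) eb Prod.snd := by
  refine ⟨fun i => .seq (unstuff i (i + 1) (i + 2)) (clear (i + 1)),
    10 * .X + 10, fun ⟨a, b⟩ i s => ?_⟩
  have h1 : Runs (unstuff i (i + 1) (i + 2)) (St s i (pairUp (ea a) (eb b)) [] [] [])
      (St s i (eb b) (ea a).reverse [] []) (5 * (ea a).length + 5) :=
    (runs_unstuff (by omega) (by omega) (by omega) _ _ _ (St_zero ..) (St_two ..)).of_eq (by simp) le_rfl
  have h2 := runs_clear (i + 1) (St s i (eb b) (ea a).reverse [] [])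
  refine (h1.seq h2).of_eq (by simp) ?_
  simp [prodEnc]
  omega

/-- Concatenation of words. -/
theorem append : PolyTime (Γ := Γ) (prodEnc _root_.id _root_.id) _root_.id
    (fun p => p.1 ++ p.2) := by
  refine ⟨fun i => .seq (unstuff i (i + 1) (i + 2)) (mv (i + 1) i),
    10 * .X + 10, fun ⟨x, y⟩ i s => ?_⟩
  have h1 : Runs (unstuff i (i + 1) (i + 2)) (St s i (pairUp x y) [] [] [])
      (St s i y x.reverse [] []) (5 * x.length + 5) :=
    (runs_unstuff (by omega) (by omega) (by omega) _ _ _ (St_zero ..) (St_two ..)).of_eq (by simp) le_rfl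
  have h3 := runs_mv (k := i + 1) (k₁ := i) (by omega) (St s i y x.reverse [] [])
  refine (h1.seq h3).of_eq (by simp) ?_
  simp [prodEnc]
  omega

/-- Pair the reversed word on stack `k + 2` with the word on stack `k`. -/
def _root_.TensorComplexity.Prog.pairStacks (k : ℕ) : Prog (Letter Γ) :=
  .seq (.push k (.bit false)) (mvMap (k + 2) k fun c => [.bit true, c])

theorem runs_pairStacks (i : ℕ) (s : ℕ → List (Letter Γ)) (w x y : List (Letter Γ)) :
    Runs (pairStacks (i + 1)) (St s i w y [] x.reverse) (St s i w (pairUp x y) [] [])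
      (4 * x.length + 2) := by
  have h2 := runs_push (i + 1) (.bit false) (St s i w y [] x.reverse)
  have h3 := runs_mvMap (k := i + 3) (k₁ := i + 1) (w := fun c => [.bit true, c]) (C := 2)
    (by omega) (by simp) (St s i w (.bit false :: y) [] x.reverse)
  simp only [St_one, St_three, update_St_one, update_St_three, List.reverse_reverse,
    List.length_reverse] at h2 h3
  exact (h2.seq h3).mono (by omega)

/-- The input is duplicated and `g` runs on the upper copy. The lower copy is then lifted above the
result of `g`, and `f` runs there. Finally the value of `f` is stuffed in front of the value of `g`.
-/
theorem pair {f : α → β} {g : α → γ} (hf : PolyTime ea eb f) (hg : PolyTime ea ec g) :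
    PolyTime ea (prodEnc eb ec) (fun a => (f a, g a)) := by
  obtain ⟨P, t, hP, hPb⟩ := hf.exists_bounds
  obtain ⟨Q, u, hQ, hQb⟩ := hg.exists_bounds
  refine ⟨fun i => .seq (mvTwo i (i + 1) (i + 2)) (.seq (mv (i + 1) i) (.seq (mv (i + 2) (i + 1))
    (.seq (Q (i + 1)) (.seq (mv i (i + 3)) (.seq (mv (i + 3) (i + 2))
    (.seq (P (i + 2)) (.seq (mv (i + 2) (i + 3)) (.seq (pairStacks (i + 1))
    (.seq (mv (i + 1) (i + 2)) (mv (i + 2) i)))))))))),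
    15 * .X + 20 * t + 7 * u + 20, fun a i s => ?_⟩
  set x := ea a
  set y := eb (f a)
  set z := ec (g a)
  have h1 := runs_mvTwo (k := i) (k₁ := i + 1) (k₂ := i + 2) (by omega) (by omega) (by omega)
    (St s i x [] [] [])
  have h2 := runs_mv (k := i + 1) (k₁ := i) (by omega) (St s i [] x.reverse x.reverse [])
  have h3 := runs_mv (k := i + 2) (k₁ := i + 1) (by omega) (St s i x [] x.reverse [])
  have h4 : Runs _ _ _ (u.eval x.length) := Runs.shift_one s i x fun s => hQ a (i + 1) s
  have h5 := runs_mv (k := i) (k₁ := i + 3) (by omega) (St s i x z [] [])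
  have h6 := runs_mv (k := i + 3) (k₁ := i + 2) (by omega) (St s i [] z [] x.reverse)
  have h7 : Runs _ _ _ (t.eval x.length) := Runs.shift_two s i [] z fun s => hP a (i + 2) s
  have h8 := runs_mv (k := i + 2) (k₁ := i + 3) (by omega) (St s i [] z y [])
  have h9 := runs_pairStacks i s [] y z
  have h10 := runs_mv (k := i + 1) (k₁ := i + 2) (by omega) (St s i [] (pairUp y z) [] [])
  have h11 := runs_mv (k := i + 2) (k₁ := i) (by omega) (St s i [] [] (pairUp y z).reverse [])
  simp only [St_zero, St_one, St_two, St_three, update_St_zero, update_St_one, update_St_two,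
    update_St_three, List.append_nil, List.reverse_reverse, List.length_reverse, length_pairUp]
    at h1 h2 h3 h5 h6 h8 h10 h11
  refine (h1.seq (h2.seq (h3.seq (h4.seq (h5.seq (h6.seq (h7.seq (h8.seq (h9.seq
    (h10.seq h11)))))))))).mono ?_
  have h12 : y.length ≤ t.eval x.length := hPb a
  have h13 : z.length ≤ u.eval x.length := hQb a
  simp only [Polynomial.eval_add, Polynomial.eval_mul, Polynomial.eval_X, Polynomial.eval_ofNat]
  omega

/-- The code of a Boolean. -/
def _root_.TensorComplexity.boolEnc : Bool → List (Letter Γ)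
  | true => [.bit true]
  | false => []

theorem cond {f g : α → β} (hf : PolyTime ea eb f) (hg : PolyTime ea eb g) :
    PolyTime (prodEnc boolEnc ea) eb (fun p => bif p.1 then f p.2 else g p.2) := by
  obtain ⟨P, t, hP⟩ := hf
  obtain ⟨Q, u, hQ⟩ := hg
  refine ⟨fun i => .case i fun o => match o with
    -- The code of a pair with first component `true` starts with the marker, the letter of `true`
    -- and the separator, so three letters are popped; with `false` it starts with the separator
    -- alone.
    | some (.bit true) => .case i fun _ => .case i fun _ => P i
    | _ => Q i, t + u + 3, fun ⟨b, a⟩ i s => ?_⟩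
  have ht := eval_mono t (m := (ea a).length) (n := (prodEnc boolEnc ea (b, a)).length)
    (by simp [prodEnc]; omega)
  have hu := eval_mono u (m := (ea a).length) (n := (prodEnc boolEnc ea (b, a)).length)
    (by simp [prodEnc]; omega)
  cases b with
  | true =>
    refine Runs.mono (t := t.eval (ea a).length + 1 + 1 + 1)
      (.case ?_) (by simp; omega)
    simp only [St_zero, update_St_zero]
    refine Runs.case (Runs.case ?_)
    simp only [St_zero, update_St_zero]
    exact hP a i s
  | false =>
    refine Runs.mono (t := u.eval (ea a).length + 1) (.case ?_) (by simp; omega)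
    simp only [St_zero, update_St_zero]
    exact hQ a i s

/-- The code of a list; the code of `a :: l` is the code of the pair `(a, l)`. -/
def _root_.TensorComplexity.listEnc (ea : α → List (Letter Γ)) (l : List α) : List (Letter Γ) :=
  l.flatMap fun a => stuff (ea a) ++ [.bit false]

@[simp] theorem _root_.TensorComplexity.listEnc_nil : listEnc ea [] = [] := rfl

theorem _root_.TensorComplexity.listEnc_cons (a : α) (l : List α) :
    listEnc ea (a :: l) = pairUp (ea a) (listEnc ea l) := by
  simp [listEnc, pairUp]

theorem _root_.TensorComplexity.listEnc_append (l l' : List α) :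
    listEnc ea (l ++ l') = listEnc ea l ++ listEnc ea l' := by
  simp [listEnc]

/-- The first letter of the code is the marker exactly when the list is nonempty. In that case the
code of `(a :: l, c)` coincides with the code of `((a, l), c)`, so the letter is put back and `g` is
run on the same word. -/
theorem listCases {f : γ → β} {g : (α × List α) × γ → β} (hf : PolyTime ec eb f)
    (hg : PolyTime (prodEnc (prodEnc ea (listEnc ea)) ec) eb g) :
    PolyTime (prodEnc (listEnc ea) ec) eb (fun p => match p.1 with
      | [] => f p.2
      | a :: l => g ((a, l), p.2)) := by
  obtain ⟨P, t, hP⟩ := hf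
  obtain ⟨Q, u, hQ⟩ := hg
  refine ⟨fun i => .case i fun o => match o with
    | some (.bit true) => .seq (.push i (.bit true)) (Q i)
    | _ => P i, t + u + 2, fun ⟨l, c⟩ i s => ?_⟩
  have ht := eval_mono t (m := (ec c).length) (n := (prodEnc (listEnc ea) ec (l, c)).length)
    (by simp [prodEnc]; omega)
  cases l with
  | nil =>
    refine Runs.mono (t := t.eval (ec c).length + 1) (.case ?_)
      (by simp only [Polynomial.eval_add, Polynomial.eval_ofNat]; omega)
    simp only [St_zero, update_St_zero]
    exact hP c i s
  | cons a l =>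
    have hx : prodEnc (listEnc ea) ec (a :: l, c) =
        prodEnc (prodEnc ea (listEnc ea)) ec ((a, l), c) := by
      simp [prodEnc, listEnc_cons]
    obtain ⟨w, hw⟩ : ∃ w, prodEnc (listEnc ea) ec (a :: l, c) = .bit true :: w := by
      rw [prodEnc, listEnc_cons]
      cases h : ea a <;> simp [pairUp]
    refine Runs.mono (t := 1 + u.eval (prodEnc (listEnc ea) ec (a :: l, c)).length + 1) (Runs.case ?_)
      (by simp only [Polynomial.eval_add, Polynomial.eval_ofNat]; omega)
    rw [St_zero, update_St_zero, hw]
    refine (runs_push i (Letter.bit true) _).seq ?_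
    rw [List.tail_cons, St_zero, update_St_zero, ← hw, hx]
    exact hQ _ i s

/-- Iteration over a list, provided that the intermediate states stay polynomially small. -/
theorem foldl {δ : Type*} {h : α × σ → σ} {es : σ → List (Letter Γ)}
    (hh : PolyTime (prodEnc ea es) es h) (L : δ → List α) (I : δ → σ) (b : Polynomial ℕ)
    (hb : ∀ d l₁ l₂, L d = l₁ ++ l₂ → (es (l₁.foldl (fun st a => h (a, st)) (I d))).length ≤
      b.eval (prodEnc (listEnc ea) es (L d, I d)).length) :
    PolyTime (fun d => prodEnc (listEnc ea) es (L d, I d)) es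
      (fun d => (L d).foldl (fun st a => h (a, st)) (I d)) := by
  obtain ⟨P, t, hP⟩ := hh
  let body : ℕ → Prog (Letter Γ) := fun i =>
    .seq (unstuff i (i + 3) (i + 2)) (.seq (pairStacks (i + 1)) (P (i + 1)))
  -- The list lies on stack `i`, the state on stack `i + 1`. The loop pops a letter only to detect
  -- that the list is nonempty, and returns it before the head is split off.
  refine ⟨fun i => .seq (unstuff i (i + 1) (i + 2)) (.seq (mv i (i + 2)) (.seq (mv (i + 1) i)
    (.seq (mv (i + 2) (i + 1)) (.seq (.loop i fun c => .seq (.push i c) (body i))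
    (.seq (mv (i + 1) (i + 2)) (mv (i + 2) i)))))),
    (14 * .X + 6 * b + 15) + (9 * .X + 9 + t.comp (2 * .X + b + 1)) * .X, fun d i s => ?_⟩
  have hb := hb d
  dsimp only
  generalize L d = l at hb ⊢
  generalize I d = st at hb ⊢
  set n := (prodEnc (listEnc ea) es (l, st)).length with hn
  have hn' : n = 2 * (listEnc ea l).length + (es st).length + 1 := by simp [hn, prodEnc]
  -- `D` bounds one pass: splitting off the head and pairing it with the state is linear in `n`, and
  -- `P` runs on a word of length at most `2 * n + b.eval n + 1`.
  set D := 9 * n + 9 + t.eval (2 * n + b.eval n + 1) with hD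
  have hloop : ∀ l₂ l₁, l = l₁ ++ l₂ →
      Runs (.loop i fun c => .seq (.push i c) (body i))
        (St s i (listEnc ea l₂) (es (l₁.foldl (fun st a => h (a, st)) st)) [] [])
        (St s i [] (es (l.foldl (fun st a => h (a, st)) st)) [] []) (D * l₂.length + 1) := by
    intro l₂
    induction l₂ with
    | nil =>
      rintro l₁ rfl
      exact (runs_loop_nil (by simp)).of_eq (by simp) (by simp)
    | cons a l₂ ih =>
      intro l₁ hl
      have hi := ih (l₁ ++ [a]) (by simp [hl])
      rw [List.foldl_append, List.foldl_cons, List.foldl_nil] at hi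
      set st' := l₁.foldl (fun st a => h (a, st)) st
      obtain ⟨c, w, hw⟩ : ∃ c w, listEnc ea (a :: l₂) = c :: w := by
        rw [listEnc_cons, pairUp]
        cases h : ea a <;> simp
      have hlen : (ea a).length ≤ (listEnc ea l).length := by
        rw [hl, listEnc_append, listEnc_cons]
        simp
        omega
      have hst : (es st').length ≤ b.eval n := by
        exact hb l₁ (a :: l₂) hl
      have h1 := runs_unstuff (k := i) (k₁ := i + 3) (kf := i + 2) (by omega) (by omega) (by omega)
        (St s i (listEnc ea (a :: l₂)) (es st') [] []) (ea a) (listEnc ea l₂)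
        (by rw [St_zero, listEnc_cons]) (by simp)
      have h2 := runs_pairStacks i s (listEnc ea l₂) (ea a) (es st')
      have h3 := Runs.shift_one s i (listEnc ea l₂) fun s => hP (a, st') (i + 1) s
      simp only [update_St_zero, update_St_three, St_three, List.append_nil] at h1
      have h4 : t.eval (prodEnc ea es (a, st')).length ≤ t.eval (2 * n + b.eval n + 1) :=
        eval_mono t (by simp [prodEnc]; omega)
      refine (Runs.loop_cons (s := St s i (listEnc ea (a :: l₂)) (es st') [] [])
        (a := c) (l := w) (by rw [St_zero, hw])
        ((runs_push i c _).seq ?_) hi).mono (t := 1 + (5 * (ea a).length + 5 +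
          (4 * (ea a).length + 2 + t.eval (prodEnc ea es (a, st')).length)) +
          (D * l₂.length + 1) + 1) ?_
      · rw [update_St_zero, St_zero, update_St_zero, ← hw]
        exact h1.seq (h2.seq h3)
      · rw [List.length_cons, Nat.mul_succ]
        omega
  have h1 := runs_unstuff (k := i) (k₁ := i + 1) (kf := i + 2) (by omega) (by omega) (by omega)
    (St s i (prodEnc (listEnc ea) es (l, st)) [] [] []) (listEnc ea l) (es st)
    (by rw [St_zero, prodEnc]) (by simp)
  have h2 := runs_mv (k := i) (k₁ := i + 2) (by omega) (St s i (es st) (listEnc ea l).reverse [] [])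
  have h3 := runs_mv (k := i + 1) (k₁ := i) (by omega)
    (St s i [] (listEnc ea l).reverse (es st).reverse [])
  have h4 := runs_mv (k := i + 2) (k₁ := i + 1) (by omega)
    (St s i (listEnc ea l) [] (es st).reverse [])
  have h5 := hloop l [] rfl
  set st' := l.foldl (fun st a => h (a, st)) st with hst
  have h6 := runs_mv (k := i + 1) (k₁ := i + 2) (by omega) (St s i [] (es st') [] [])
  have h7 := runs_mv (k := i + 2) (k₁ := i) (by omega) (St s i [] [] (es st').reverse [])
  simp only [St_zero, St_one, St_two, update_St_zero, update_St_one, update_St_two,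
    List.append_nil, List.reverse_reverse, List.length_reverse]
    at h1 h2 h3 h4 h6 h7
  refine (h1.seq (h2.seq (h3.seq (h4.seq (h5.seq (h6.seq h7)))))).mono ?_
  have hst' : (es st').length ≤ b.eval n := by
    exact hb l [] (by simp)
  have hl : l.length ≤ n := by
    have : l.length ≤ (listEnc ea l).length := by
      clear * -
      induction l with
      | nil => simp
      | cons a l ih => rw [listEnc_cons]; simp; omega
    omega
  have hDl : D * l.length ≤ D * n := Nat.mul_le_mul_left _ hl
  simp only [Polynomial.eval_add, Polynomial.eval_mul, Polynomial.eval_X, Polynomial.eval_ofNat,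
    Polynomial.eval_comp, Polynomial.eval_one]
  rw [← hD]
  omega

/-- Concatenation of a list of words. -/
theorem flatten : PolyTime (Γ := Γ) (listEnc _root_.id) _root_.id List.flatten := by
  refine ⟨fun i => .seq (joinAll i (i + 1)) (mv (i + 1) i), 12 * .X + 12, fun l i s => ?_⟩
  have h1 := runs_joinAll (k := i) (k₁ := i + 1) (by omega)
    (St s i (listEnc _root_.id l) [] [] []) l (by simp [listEnc])
  have h2 := runs_mv (k := i + 1) (k₁ := i) (by omega) (St s i [] l.flatten.reverse [] [])
  simp only [St_zero, St_one, update_St_zero, update_St_one,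
    List.append_nil, List.reverse_reverse, List.length_reverse] at h1 h2
  refine (h1.seq h2).mono ?_
  have : l.flatten.length ≤ (listEnc _root_.id l).length := by
    clear * -
    induction l with
    | nil => simp
    | cons a l ih => rw [listEnc_cons]; simp at ih ⊢; omega
  simp only [Polynomial.eval_add, Polynomial.eval_mul, Polynomial.eval_X, Polynomial.eval_ofNat]
  omega

/-- The words consisting of the single letters of a word. -/
theorem letters : PolyTime (Γ := Γ) _root_.id (listEnc fun c => [c]) _root_.id := by
  refine ⟨fun i => .seq (mv i (i + 1)) (mvMap (i + 1) i fun c => [.bit true, c, .bit false]),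
    8 * .X + 2, fun l i s => ?_⟩
  have h1 := runs_mv (k := i) (k₁ := i + 1) (by omega) (St s i l [] [] [])
  have h2 := runs_mvMap (k := i + 1) (k₁ := i) (w := fun c => [.bit true, c, .bit false]) (C := 3)
    (by omega) (by simp) (St s i [] l.reverse [] [])
  simp only [St_zero, St_one, update_St_zero, update_St_one,
    List.append_nil, List.reverse_reverse, List.length_reverse] at h1 h2
  refine (h1.seq h2).mono ?_
  simp
  omega

/-- Case distinction on a letter. -/
theorem letterCases [Finite Γ] {g : Letter Γ → γ → β} (hg : ∀ c, PolyTime ec eb (g c)) :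
    PolyTime (prodEnc (fun c => [c]) ec) eb (fun p => g p.1 p.2) := by
  choose P t hP using hg
  have := Fintype.ofFinite (Letter Γ)
  refine ⟨fun i => .case i fun _ => .case i fun o => match o with
    | some c => .case i fun _ => P c i
    | none => .skip, (∑ c, t c) + 3, fun ⟨c, x⟩ i s => ?_⟩
  refine Runs.mono (t := (t c).eval (ec x).length + 1 + 1 + 1) (.case ?_) ?_
  · simp only [St_zero, update_St_zero]
    refine Runs.case ?_
    simp only [St_zero, update_St_zero]
    refine Runs.case ?_
    simp only [St_zero, update_St_zero]
    exact hP c x i s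
  · have h1 : (t c).eval (ec x).length ≤
        (t c).eval (prodEnc (fun c => [c]) ec (c, x)).length := eval_mono _ (by simp [prodEnc]; omega)
    have h2 := Finset.single_le_sum (f := fun d =>
      (t d).eval (prodEnc (fun c => [c]) ec (c, x)).length) (fun _ _ => Nat.zero_le _)
      (Finset.mem_univ c)
    simp only [Polynomial.eval_add, Polynomial.eval_ofNat, Polynomial.eval_finsetSum]
    omega

end PolyTime

end TensorComplexity


namespace TensorComplexity

open Function

/-! ### Polynomial-time functions on structured data -/

/-- Types whose elements are written as words. -/
class Code (Γ : Type) (α : Type*) where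
  /-- the word of an element -/
  enc : α → List (Letter Γ)

/-- Words, written as they are. -/
def Str (Γ : Type) : Type := List (Letter Γ)

namespace Code

variable {Γ : Type} {α β : Type*}

instance : Code Γ (Str Γ) := ⟨fun x => x⟩
instance : Code Γ (Letter Γ) := ⟨fun c => [c]⟩
instance : Code Γ Bool := ⟨boolEnc⟩
instance : Code Γ Unit := ⟨fun _ => []⟩
instance : Code Γ ℕ := ⟨fun n => List.replicate n (.bit false)⟩
instance [Code Γ α] [Code Γ β] : Code Γ (α × β) := ⟨prodEnc enc enc⟩
instance [Code Γ α] : Code Γ (List α) := ⟨listEnc enc⟩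

end Code

open Code

/-- Polynomial-time computability with respect to the standard codes. -/
@[fun_prop]
def PT (Γ : Type) {α β : Type*} [Code Γ α] [Code Γ β] (f : α → β) : Prop :=
  PolyTime (enc (Γ := Γ)) (enc (Γ := Γ)) f

namespace PT

variable {Γ : Type} {α β γ δ σ : Type*} [Code Γ α] [Code Γ β] [Code Γ γ] [Code Γ δ] [Code Γ σ]

@[fun_prop] theorem id' : PT Γ (fun a : α => a) := PolyTime.id

@[fun_prop] theorem const' (b : β) : PT Γ (fun _ : α => b) := PolyTime.const b

@[fun_prop] theorem comp' {g : β → γ} {f : α → β} (hg : PT Γ g) (hf : PT Γ f) :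
    PT Γ (fun a => g (f a)) := PolyTime.comp hg hf

@[fun_prop] theorem mk {f : α → β} {g : α → γ} (hf : PT Γ f) (hg : PT Γ g) :
    PT Γ (fun a => (f a, g a)) := PolyTime.pair hf hg

@[fun_prop] theorem fst {f : α → β × γ} (hf : PT Γ f) : PT Γ (fun a => (f a).1) :=
  PolyTime.comp PolyTime.fst hf

@[fun_prop] theorem snd {f : α → β × γ} (hf : PT Γ f) : PT Γ (fun a => (f a).2) :=
  PolyTime.comp PolyTime.snd hf

/-- A program sees only words, so `f` may be replaced by any function whose values have the same
codes, even if they are of another type. -/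
theorem of_enc {f : α → β} {f' : α → γ} (h : PT Γ f')
    (hf : ∀ a, enc (Γ := Γ) (f a) = enc (Γ := Γ) (f' a)) : PT Γ f := by
  obtain ⟨P, t, hP⟩ := h
  exact ⟨P, t, fun a i s => by rw [hf]; exact hP a i s⟩

@[fun_prop] theorem cond {p : α → Bool} {f g : α → β} (hp : PT Γ p) (hf : PT Γ f) (hg : PT Γ g) :
    PT Γ (fun a => bif p a then f a else g a) :=
  PolyTime.comp (PolyTime.cond hf hg) (PolyTime.pair hp PolyTime.id)

@[fun_prop] theorem ite {p : α → Prop} [DecidablePred p] {f g : α → β}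
    (hp : PT Γ fun a => decide (p a)) (hf : PT Γ f) (hg : PT Γ g) :
    PT Γ (fun a => if p a then f a else g a) := by
  refine of_enc (hp.cond hf hg) fun a => ?_
  by_cases h : p a <;> simp [h]

@[fun_prop] theorem and {p q : α → Bool} (hp : PT Γ p) (hq : PT Γ q) :
    PT Γ (fun a => p a && q a) :=
  of_enc (hp.cond hq (const' false)) fun a => by cases p a <;> rfl

@[fun_prop] theorem or {p q : α → Bool} (hp : PT Γ p) (hq : PT Γ q) :
    PT Γ (fun a => p a || q a) :=
  of_enc (hp.cond (const' true) hq) fun a => by cases p a <;> rfl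

@[fun_prop] theorem not {p : α → Bool} (hp : PT Γ p) : PT Γ (fun a => !p a) :=
  of_enc (hp.cond (const' false) (const' true)) fun a => by cases p a <;> rfl

@[fun_prop] theorem cons {f : α → β} {l : α → List β} (hf : PT Γ f) (hl : PT Γ l) :
    PT Γ (fun a => f a :: l a) :=
  of_enc (hf.mk hl) fun _ => listEnc_cons _ _

@[fun_prop] theorem append {f g : α → List β} (hf : PT Γ f) (hg : PT Γ g) :
    PT Γ (fun a => f a ++ g a) := by
  have h := PolyTime.comp (PolyTime.append (Γ := Γ)) (PolyTime.pair (ea := enc (α := α))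
    (eb := id) (ec := id) (f := fun a => enc (f a)) (g := fun a => enc (g a)) hf hg)
  obtain ⟨P, t, hP⟩ := h
  refine ⟨P, t, fun a i s => ?_⟩
  have := hP a i s
  rwa [show enc (f a ++ g a) = enc (f a) ++ enc (g a) from listEnc_append _ _]

/-- Concatenation of words. -/
@[fun_prop] theorem strAppend {f g : α → Str Γ} (hf : PT Γ f) (hg : PT Γ g) :
    PT Γ (β := Str Γ) (fun a => List.append (f a) (g a)) :=
  PolyTime.comp (PolyTime.append (Γ := Γ)) (PolyTime.pair hf hg)

theorem listCases {l : α → List β} {n : α → γ} {g : α → β → List β → γ} (hl : PT Γ l)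
    (hn : PT Γ n) (hg : PT Γ fun q : (β × List β) × α => g q.2 q.1.1 q.1.2) :
    PT Γ (fun a => match l a with
      | [] => n a
      | b :: t => g a b t) := by
  have h := PolyTime.listCases (ea := enc (Γ := Γ)) (ec := enc (Γ := Γ)) (eb := enc (Γ := Γ)) hn hg
  exact PolyTime.comp h (PT.mk hl id')

/-- The step function of `PolyTime.foldl` sees only the list element and the state; the parameter
`a` is therefore carried along in the state. -/
theorem foldl {l : α → List β} {init : α → σ} {h : α → σ → β → σ} (hl : PT Γ l)
    (hi : PT Γ init) (hh : PT Γ fun q : β × α × σ => h q.2.1 q.2.2 q.1) (b : Polynomial ℕ)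
    (hb : ∀ a l₁ l₂, l a = l₁ ++ l₂ → (enc (Γ := Γ) (l₁.foldl (h a) (init a))).length ≤
      b.eval (enc (Γ := Γ) a).length) :
    PT Γ (fun a => (l a).foldl (h a) (init a)) := by
  have key : ∀ a (l₁ : List β) st, l₁.foldl (fun (st : α × σ) x => (st.1, h st.1 st.2 x)) (a, st) =
      (a, l₁.foldl (h a) st) := by
    intro a l₁
    induction l₁ with
    | nil => intro st; rfl
    | cons x l₁ ih => intro st; exact ih _
  have hh' : PolyTime (prodEnc (enc (Γ := Γ)) (enc (Γ := Γ))) enc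
      (fun q : β × (α × σ) => (q.2.1, h q.2.1 q.2.2 q.1)) := PT.mk (by fun_prop) hh
  have hf := PolyTime.foldl hh' l (fun a => (a, init a)) (2 * .X + 1 + b.comp .X) (by
    intro a l₁ l₂ hal
    have hlen : (enc (Γ := Γ) a).length ≤
        (prodEnc (listEnc (enc (Γ := Γ))) enc (l a, (a, init a))).length := by
      simp [prodEnc, enc]; omega
    have h1 := hb a l₁ l₂ hal
    have h2 := eval_mono b hlen
    rw [key a l₁ (init a)]
    simp only [Polynomial.comp_X, Polynomial.eval_add, Polynomial.eval_mul, Polynomial.eval_X,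
      Polynomial.eval_ofNat, Polynomial.eval_one]
    rw [show enc (Γ := Γ) (a, l₁.foldl (h a) (init a)) =
      pairUp (enc a) (enc (l₁.foldl (h a) (init a))) from rfl, length_pairUp]
    omega)
  have hc : PT Γ (fun a => (l a).foldl (fun (st : α × σ) x => (st.1, h st.1 st.2 x)) (a, init a)) :=
    PolyTime.comp hf (ea := enc (Γ := Γ)) (f := fun a : α => a) (PT.mk hl (PT.mk id' hi))
  have hs := PT.snd (Γ := Γ) hc
  exact of_enc hs fun a => by rw [key]

end PT

end TensorComplexity


/-! ### Size bounds and list operations in polynomial time -/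

namespace TensorComplexity

open Function Code

/-- The length of the word of an element. -/
def size (Γ : Type) {α : Type*} [Code Γ α] (a : α) : ℕ := (enc (Γ := Γ) a).length

section size

variable {Γ : Type} {α β : Type*} [Code Γ α] [Code Γ β]

@[simp] theorem size_nil : size Γ ([] : List α) = 0 := rfl

@[simp] theorem size_cons (a : α) (l : List α) : size Γ (a :: l) = 2 * size Γ a + size Γ l + 1 := by
  rw [size, show enc (Γ := Γ) (a :: l) = pairUp (enc a) (enc l) from listEnc_cons _ _,
    length_pairUp]
  rfl

@[simp] theorem size_append (l l' : List α) : size Γ (l ++ l') = size Γ l + size Γ l' := by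
  rw [size, show enc (Γ := Γ) (l ++ l') = enc l ++ enc l' from listEnc_append _ _,
    List.length_append]
  rfl

@[simp] theorem size_prod (p : α × β) : size Γ p = 2 * size Γ p.1 + size Γ p.2 + 1 :=
  length_pairUp _ _

@[simp] theorem size_nat (n : ℕ) : size Γ n = n := by simp [size, enc]

theorem size_bool_le (b : Bool) : size Γ b ≤ 1 := by
  cases b <;> simp [size, enc, boolEnc]

theorem size_le_of_mem {a : α} {l : List α} (h : a ∈ l) : size Γ a ≤ size Γ l := by
  induction l with
  | nil => simp at h
  | cons b l ih =>
    rcases List.mem_cons.1 h with rfl | h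
    · simp; omega
    · have := ih h
      simp; omega

theorem length_le_size (l : List α) : l.length ≤ size Γ l := by
  induction l with
  | nil => simp
  | cons b l ih => simp; omega

theorem size_le_of_forall {l : List α} {B : ℕ} (h : ∀ a ∈ l, size Γ a ≤ B) :
    size Γ l ≤ l.length * (2 * B + 1) := by
  induction l with
  | nil => simp
  | cons b l ih =>
    have h1 := h b (by simp)
    have h2 := ih fun a ha => h a (by simp [ha])
    simp only [size_cons, List.length_cons, add_one_mul]
    linarith

end size

namespace PT

variable {Γ : Type} {α β γ δ σ : Type*} [Code Γ α] [Code Γ β] [Code Γ γ] [Code Γ δ] [Code Γ σ]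

theorem exists_size_le {f : α → β} (h : PT Γ f) :
    ∃ t : Polynomial ℕ, ∀ a, size Γ (f a) ≤ t.eval (size Γ a) := h.exists_length_le

theorem foldl_of_size {l : α → List β} {init : α → σ} {h : α → σ → β → σ} (hl : PT Γ l)
    (hi : PT Γ init) (hh : PT Γ fun q : β × α × σ => h q.2.1 q.2.2 q.1) (b : Polynomial ℕ)
    (hb : ∀ a l₁ l₂, l a = l₁ ++ l₂ → size Γ (l₁.foldl (h a) (init a)) ≤ b.eval (size Γ a)) :
    PT Γ (fun a => (l a).foldl (h a) (init a)) := foldl hl hi hh b hb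

@[fun_prop] theorem flatMap {l : α → List β} {f : α → β → List γ} (hl : PT Γ l)
    (hf : PT Γ fun q : α × β => f q.1 q.2) : PT Γ (fun a => (l a).flatMap (f a)) := by
  have key : ∀ a (l₁ : List β) acc, l₁.foldl (fun acc b => acc ++ f a b) acc =
      acc ++ l₁.flatMap (f a) := by
    intro a l₁
    induction l₁ with
    | nil => simp
    | cons b l₁ ih => intro acc; simp [ih]
  obtain ⟨s, hs⟩ := hl.exists_size_le
  obtain ⟨t, ht⟩ := hf.exists_size_le
  -- There are at most `s` pieces, and each has size at most `t` evaluated at a bound for the size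
  -- of a pair `(a, b)`.
  refine of_enc (foldl_of_size (h := fun a acc b => acc ++ f a b) (init := fun _ => []) hl
    (const' []) ?_ (s * t.comp (2 * .X + s + 1)) ?_) (fun a => by rw [key]; simp)
  · exact (show PT Γ fun q : β × α × List γ => q.2.2 by fun_prop).append
      (hf.comp' (f := fun q : β × α × List γ => (q.2.1, q.1)) (by fun_prop))
  · intro a l₁ l₂ hal
    rw [key, List.nil_append]
    have h1 : ∀ l₁ : List β, (∀ b ∈ l₁, b ∈ l a) → size Γ (l₁.flatMap (f a)) ≤
        l₁.length * t.eval (2 * size Γ a + s.eval (size Γ a) + 1) := by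
      intro l₁
      induction l₁ with
      | nil => simp
      | cons b l₁ ih =>
        intro hl₁
        have h2 := ih fun b hb => hl₁ b (by simp [hb])
        have h3 := (ht (a, b)).trans (eval_mono t
          (n := 2 * size Γ a + s.eval (size Γ a) + 1) (by
            have := size_le_of_mem (Γ := Γ) (hl₁ b (by simp))
            have := hs a
            simp only [size_prod]
            omega))
        simp only [List.flatMap_cons, size_append, List.length_cons, add_one_mul]
        exact (add_le_add h3 h2).trans (add_comm _ _).le
    have h2 := h1 l₁ (by simp +contextual [hal])
    have h3 : l₁.length ≤ s.eval (size Γ a) := by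
      have h4 := (length_le_size (Γ := Γ) (l a)).trans (hs a)
      rw [hal, List.length_append] at h4
      omega
    refine h2.trans ?_
    simp only [Polynomial.eval_mul, Polynomial.eval_comp, Polynomial.eval_add, Polynomial.eval_X,
      Polynomial.eval_ofNat, Polynomial.eval_one]
    gcongr

@[fun_prop] theorem map {l : α → List β} {f : α → β → γ} (hl : PT Γ l)
    (hf : PT Γ fun q : α × β => f q.1 q.2) : PT Γ (fun a => (l a).map (f a)) := by
  refine of_enc (flatMap (f := fun a b => [f a b]) hl (hf.cons (const' []))) fun a => ?_
  rw [← List.map_eq_flatMap]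

@[fun_prop] theorem filter {l : α → List β} {p : α → β → Bool} (hl : PT Γ l)
    (hp : PT Γ fun q : α × β => p q.1 q.2) : PT Γ (fun a => (l a).filter (p a)) := by
  refine of_enc (flatMap (f := fun a b => bif p a b then [b] else []) hl (by fun_prop))
    fun a => ?_
  congr 1
  induction l a with
  | nil => rfl
  | cons b l ih => cases h : p a b <;> simp [h, ih]

@[fun_prop] theorem any {l : α → List β} {p : α → β → Bool} (hl : PT Γ l)
    (hp : PT Γ fun q : α × β => p q.1 q.2) : PT Γ (fun a => (l a).any (p a)) := by
  refine of_enc (listCases (l := fun a => (l a).filter (p a)) (n := fun _ => false)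
    (g := fun _ _ _ => true) (by fun_prop) (by fun_prop) (by fun_prop)) fun a => ?_
  congr 1
  induction l a with
  | nil => rfl
  | cons b l ih => cases h : p a b <;> simp [h, ih]

@[fun_prop] theorem headD {l : α → List β} {d : α → β} (hl : PT Γ l) (hd : PT Γ d) :
    PT Γ (fun a => (l a).headD (d a)) :=
  of_enc (listCases (n := d) (g := fun _ b _ => b) hl hd (by fun_prop)) fun a => by
    cases l a <;> rfl

@[fun_prop] theorem tail {l : α → List β} (hl : PT Γ l) : PT Γ (fun a => (l a).tail) :=
  of_enc (listCases (n := fun _ => []) (g := fun _ _ t => t) hl (const' []) (by fun_prop))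
    fun a => by cases l a <;> rfl

/-- A unit has the empty code, so a list of units consists of terminators only. This is the unary
code of its length, and arithmetic becomes list processing. -/
theorem enc_unit_list (l : List Unit) : enc (Γ := Γ) l = enc (Γ := Γ) l.length := by
  induction l with
  | nil => rfl
  | cons u l ih =>
    rw [show enc (Γ := Γ) (u :: l) = pairUp (enc u) (enc l) from listEnc_cons _ _, ih]
    rfl

@[fun_prop] theorem length {l : α → List β} (hl : PT Γ l) : PT Γ (fun a => (l a).length) := by
  refine of_enc (f' := fun a => (l a).map fun _ => ()) (by fun_prop) fun a => ?_
  rw [enc_unit_list, List.length_map]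

theorem units {f : α → ℕ} (hf : PT Γ f) : PT Γ (fun a => List.replicate (f a) ()) :=
  of_enc hf fun a => by rw [enc_unit_list, List.length_replicate]

@[fun_prop] theorem add {f g : α → ℕ} (hf : PT Γ f) (hg : PT Γ g) : PT Γ (fun a => f a + g a) :=
  of_enc (hf.units.append hg.units) fun a => by
    rw [enc_unit_list, List.length_append, List.length_replicate, List.length_replicate]

@[fun_prop] theorem mul {f g : α → ℕ} (hf : PT Γ f) (hg : PT Γ g) : PT Γ (fun a => f a * g a) :=
  of_enc (flatMap (f := fun a _ => List.replicate (g a) ()) hf.units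
    (hg.comp' (by fun_prop)).units) fun a => by
    rw [enc_unit_list]
    simp

@[fun_prop] theorem range {f : α → ℕ} (hf : PT Γ f) : PT Γ (fun a => List.range (f a)) := by
  have key : ∀ l : List Unit, l.foldl (fun acc _ => acc ++ [acc.length]) [] =
      List.range l.length := by
    intro l
    induction l using List.reverseRecOn with
    | nil => rfl
    | append_singleton l u ih => simp [ih, List.range_succ]
  obtain ⟨s, hs⟩ := hf.exists_size_le
  refine of_enc (foldl_of_size (h := fun _ acc _ => acc ++ [acc.length]) (init := fun _ => [])
    hf.units (const' []) (by fun_prop) (s * (2 * s + 1)) ?_) (fun a => by rw [key]; simp)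
  intro a l₁ l₂ hal
  have h1 : l₁.length ≤ s.eval (size Γ a) := by
    have := hs a
    have h2 := congrArg List.length hal
    simp at this h2
    omega
  rw [key]
  have h3 := size_le_of_forall (Γ := Γ) (l := List.range l₁.length) (B := l₁.length)
    (by simp only [List.mem_range, size_nat]; omega)
  rw [List.length_range] at h3
  refine h3.trans ?_
  simp only [Polynomial.eval_mul, Polynomial.eval_add, Polynomial.eval_ofNat, Polynomial.eval_one]
  gcongr

theorem _root_.TensorComplexity.size_le_append_left {l l₁ l₂ : List α} (h : l = l₁ ++ l₂) :
    size Γ l₁ ≤ size Γ l := by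
  rw [h, size_append]
  omega

-- A fold over the first list whose state holds the unread part of the second list and the pairs
-- found so far.
@[fun_prop] theorem zip {l : α → List β} {m : α → List γ} (hl : PT Γ l) (hm : PT Γ m) :
    PT Γ (fun a => (l a).zip (m a)) := by
  let h : List γ × List (β × γ) → β → List γ × List (β × γ) := fun st b => match st.1 with
    | [] => ([], st.2)
    | c :: t => (t, st.2 ++ [(b, c)])
  have key : ∀ (l₁ : List β) st, l₁.foldl h st = (st.1.drop l₁.length, st.2 ++ l₁.zip st.1) := by
    intro l₁
    induction l₁ with
    | nil => intro st; simp
    | cons b l₁ ih =>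
      rintro ⟨m, acc⟩
      rw [List.foldl_cons, ih]
      cases m <;> simp [h]
  have hh : PT Γ fun q : β × α × (List γ × List (β × γ)) => h q.2.2 q.1 :=
    listCases (l := fun q : β × α × (List γ × List (β × γ)) => q.2.2.1)
      (n := fun q => ([], q.2.2.2)) (g := fun q c t => (t, q.2.2.2 ++ [(q.1, c)]))
      (by fun_prop) (by fun_prop) (by fun_prop)
  obtain ⟨s, hs⟩ := hl.exists_size_le
  obtain ⟨t, ht⟩ := hm.exists_size_le
  refine of_enc (PT.snd (foldl_of_size (h := fun _ => h) (init := fun a => (m a, [])) hl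
    (by fun_prop) hh (2 * t + s * (4 * s + 2 * t + 3) + 1) ?_)) fun a => by rw [key]; simp
  intro a l₁ l₂ hal
  rw [key]
  have h1 : size Γ ((m a).drop l₁.length) ≤ size Γ (m a) := by
    conv_rhs => rw [← List.take_append_drop l₁.length (m a), size_append]
    omega
  have h2 := size_le_of_forall (Γ := Γ) (l := l₁.zip (m a))
    (B := 2 * size Γ (l a) + size Γ (m a) + 1) (by
      rintro ⟨b, c⟩ hbc
      have hb := List.of_mem_zip hbc
      have h3 := size_le_of_mem (Γ := Γ) (show b ∈ l a by rw [hal]; simp [hb.1])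
      have h4 := size_le_of_mem (Γ := Γ) hb.2
      simp only [size_prod]
      omega)
  have h3 : (l₁.zip (m a)).length ≤ size Γ (l a) := by
    rw [List.length_zip]
    have := length_le_size (Γ := Γ) l₁
    have := size_le_append_left (Γ := Γ) hal
    omega
  have h4 := hs a
  have h5 := ht a
  simp only [size_prod, List.nil_append, Polynomial.eval_mul, Polynomial.eval_add,
    Polynomial.eval_ofNat, Polynomial.eval_one]
  have h6 : (l₁.zip (m a)).length * (2 * (2 * size Γ (l a) + size Γ (m a) + 1) + 1) ≤
      s.eval (size Γ a) * (4 * s.eval (size Γ a) + 2 * t.eval (size Γ a) + 3) := by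
    apply Nat.mul_le_mul <;> omega
  omega

@[fun_prop] theorem zipIdx {l : α → List β} (hl : PT Γ l) : PT Γ (fun a => (l a).zipIdx) := by
  refine of_enc (f' := fun a => (l a).zip (List.range (l a).length)) (by fun_prop) fun a => ?_
  rw [List.zipIdx_eq_zip_range', List.range_eq_range']

end PT

end TensorComplexity


/-! ### Equality tests, lists without repetitions, binary digits -/

namespace TensorComplexity

open Function Code

/-- Types whose elements are determined by their words. -/
class InjCode (Γ : Type) (α : Type*) [Code Γ α] : Prop where
  inj : Injective (enc (Γ := Γ) (α := α))

section InjCode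

variable {Γ : Type} {α β : Type*} [Code Γ α] [Code Γ β]

instance : InjCode Γ (Letter Γ) := ⟨fun _ _ h => List.singleton_injective h⟩
instance : InjCode Γ ℕ := ⟨fun a b h => by simpa [enc] using congrArg List.length h⟩
instance [InjCode Γ α] [InjCode Γ β] : InjCode Γ (α × β) := ⟨fun a b h => by
  obtain ⟨h1, h2⟩ := stuff_injective_aux _ _ _ _ h
  exact Prod.ext (InjCode.inj h1) (InjCode.inj h2)⟩
instance [InjCode Γ α] : InjCode Γ (List α) := ⟨fun l => by
  induction l with
  | nil =>
    intro l' h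
    cases l' with
    | nil => rfl
    | cons a l' =>
      have := congrArg List.length h
      rw [← size, ← size] at this
      simp at this
  | cons a l ih =>
    intro l' h
    cases l' with
    | nil =>
      have := congrArg List.length h
      rw [← size, ← size] at this
      simp at this
    | cons a' l' =>
      change listEnc _ _ = listEnc _ _ at h
      rw [listEnc_cons, listEnc_cons] at h
      obtain ⟨h1, h2⟩ := stuff_injective_aux _ _ _ _ h
      rw [InjCode.inj h1, ih h2]⟩

end InjCode

namespace PT

variable {Γ : Type} {α β γ δ σ : Type*} [Code Γ α] [Code Γ β] [Code Γ γ] [Code Γ δ] [Code Γ σ]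

@[fun_prop] theorem isEmpty {l : α → List β} (hl : PT Γ l) : PT Γ (fun a => (l a).isEmpty) :=
  of_enc (listCases (n := fun _ => true) (g := fun _ _ _ => false) hl (const' _) (const' _))
    fun a => by cases l a <;> rfl

theorem ofLetter [Finite Γ] (f : Letter Γ → β) : PT Γ f := by
  have h : PT Γ (fun p : Letter Γ × Unit => f p.1) :=
    PolyTime.letterCases (g := fun c _ => f c) fun c => PolyTime.const (f c)
  exact h.comp' (f := fun c => (c, ())) (by fun_prop)

theorem eqLetter [Finite Γ] [DecidableEq (Letter Γ)] :
    PT Γ (fun q : Letter Γ × Letter Γ => decide (q.1 = q.2)) :=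
  PolyTime.letterCases (ec := enc (Γ := Γ)) (eb := enc (Γ := Γ))
    (g := fun c d => decide (c = d)) fun c => ofLetter fun d => decide (c = d)

/-- A fold over the first word consumes the second one. The words agree if the flag survives and
nothing of the second word is left. -/
theorem eqLetters [Finite Γ] [DecidableEq (Letter Γ)] {f g : α → List (Letter Γ)} (hf : PT Γ f)
    (hg : PT Γ g) : PT Γ (fun a => decide (f a = g a)) := by
  let h : Bool × List (Letter Γ) → Letter Γ → Bool × List (Letter Γ) := fun st c => match st.2 with
    | [] => (false, [])
    | d :: t => (st.1 && decide (c = d), t)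
  have key : ∀ (l : List (Letter Γ)) st, ((l.foldl h st).1 && (l.foldl h st).2.isEmpty) =
      (st.1 && decide (l = st.2)) := by
    intro l
    induction l with
    | nil => rintro ⟨b, _ | ⟨d, t⟩⟩ <;> simp
    | cons c l ih =>
      intro st
      rw [List.foldl_cons, ih]
      obtain ⟨b, _ | ⟨d, t⟩⟩ := st
      · simp [h]
      · by_cases hcd : c = d <;> simp [h, hcd]
  have hsize : ∀ (l : List (Letter Γ)) st, size Γ (l.foldl h st).2 ≤ size Γ st.2 := by
    intro l
    induction l with
    | nil => intro st; rfl
    | cons c l ih =>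
      rintro ⟨b, _ | ⟨d, t⟩⟩
      · exact (ih _).trans (by simp [h])
      · exact (ih _).trans (by simp [h]; omega)
  have hh : PT Γ fun q : Letter Γ × α × (Bool × List (Letter Γ)) => h q.2.2 q.1 := by
    have hc : PT Γ fun q : (Letter Γ × List (Letter Γ)) × (Letter Γ × α ×
        (Bool × List (Letter Γ))) => (q.2.2.2.1 && decide (q.2.1 = q.1.1), q.1.2) :=
      mk (and (by fun_prop) (eqLetter.comp' (f := fun q : (Letter Γ × List (Letter Γ)) ×
        (Letter Γ × α × (Bool × List (Letter Γ))) => (q.2.1, q.1.1)) (by fun_prop))) (by fun_prop)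
    refine of_enc (listCases (Γ := Γ) (l := fun q : Letter Γ × α × (Bool × List (Letter Γ)) =>
      q.2.2.2) (n := fun q => (false, [])) (g := fun q d t => (q.2.2.1 && decide (q.1 = d), t))
      (by fun_prop) (by fun_prop) hc) fun q => ?_
    obtain ⟨c, a, b, _ | ⟨d, t⟩⟩ := q <;> rfl
  obtain ⟨s, hs⟩ := hg.exists_size_le
  have hfold := foldl_of_size (h := fun _ => h) (init := fun a => (true, g a)) hf
    (by fun_prop) hh (s + 3) (by
      intro a l₁ l₂ _
      have h1 := hsize l₁ (true, g a)
      have h2 := hs a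
      have h3 := size_bool_le (Γ := Γ) (l₁.foldl h (true, g a)).1
      simp only [size_prod, Polynomial.eval_add, Polynomial.eval_ofNat] at h1 ⊢
      omega)
  refine of_enc (hfold.fst.and hfold.snd.isEmpty) fun a => ?_
  rw [key]
  simp

/-- The letters of the word of an element. -/
theorem lettersOf {f : α → β} (hf : PT Γ f) :
    PT Γ (β := List (Letter Γ)) (fun a => enc (Γ := Γ) (f a)) :=
  PolyTime.comp (g := _root_.id) (PolyTime.letters (Γ := Γ))
    (show PolyTime (enc (Γ := Γ)) _root_.id (fun a => enc (Γ := Γ) (f a)) from hf)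

@[fun_prop] theorem decideEq [Finite Γ] [InjCode Γ β] [DecidableEq β] {f g : α → β} (hf : PT Γ f)
    (hg : PT Γ g) : PT Γ (fun a => decide (f a = g a)) := by
  classical
  refine of_enc (eqLetters (lettersOf hf) (lettersOf hg)) fun a => ?_
  congr 2
  exact propext (InjCode.inj (Γ := Γ)).eq_iff.symm

@[fun_prop] theorem decideMem [Finite Γ] [InjCode Γ β] [DecidableEq β] {f : α → β} {l : α → List β}
    (hf : PT Γ f) (hl : PT Γ l) : PT Γ (fun a => decide (f a ∈ l a)) := by
  refine of_enc (f' := fun a => (l a).any fun b => decide (f a = b)) (by fun_prop) fun a => ?_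
  congr 1
  rw [Bool.eq_iff_iff]
  simp

@[fun_prop] theorem decideLt [Finite Γ] {f g : α → ℕ} (hf : PT Γ f) (hg : PT Γ g) :
    PT Γ (fun a => decide (f a < g a)) := by
  refine of_enc (f' := fun a => decide (f a ∈ List.range (g a))) (by fun_prop) fun a => ?_
  simp

@[fun_prop] theorem decideNot {p : α → Prop} [DecidablePred p] (hp : PT Γ fun a => decide (p a)) :
    PT Γ (fun a => decide (¬ p a)) :=
  of_enc hp.not fun a => by simp

@[fun_prop] theorem decideAnd {p q : α → Prop} [DecidablePred p] [DecidablePred q]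
    (hp : PT Γ fun a => decide (p a)) (hq : PT Γ fun a => decide (q a)) :
    PT Γ (fun a => decide (p a ∧ q a)) :=
  of_enc (hp.and hq) fun a => by simp

@[fun_prop] theorem decideOr {p q : α → Prop} [DecidablePred p] [DecidablePred q]
    (hp : PT Γ fun a => decide (p a)) (hq : PT Γ fun a => decide (q a)) :
    PT Γ (fun a => decide (p a ∨ q a)) :=
  of_enc (hp.or hq) fun a => by simp

end PT

/-- The elements of a list without repetitions. -/
def distinct {β : Type*} [DecidableEq β] (l : List β) : List β :=
  l.foldl (fun acc b => if b ∈ acc then acc else b :: acc) []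

section distinct

variable {β : Type*} [DecidableEq β]

theorem distinct_append_singleton (l : List β) (b : β) :
    distinct (l ++ [b]) = if b ∈ distinct l then distinct l else b :: distinct l := by
  rw [distinct, List.foldl_append]
  rfl

theorem mem_distinct {l : List β} {b : β} : b ∈ distinct l ↔ b ∈ l := by
  induction l using List.reverseRecOn with
  | nil => simp [distinct]
  | append_singleton l c ih =>
    rw [distinct_append_singleton]
    split_ifs with h
    · rw [ih, List.mem_append, List.mem_singleton]
      constructor
      · exact Or.inl
      · rintro (h' | rfl)
        · exact h'
        · exact ih.1 h
    · simp [ih, or_comm]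

theorem nodup_distinct (l : List β) : (distinct l).Nodup := by
  induction l using List.reverseRecOn with
  | nil => simp [distinct]
  | append_singleton l c ih =>
    rw [distinct_append_singleton]
    split_ifs with h
    · exact ih
    · exact List.nodup_cons.2 ⟨h, ih⟩

end distinct

/-- The binary digits of the successor. -/
def succBits (l : List Bool) : List Bool :=
  let r := l.foldl (fun st b => (st.1 && b, st.2 ++ [xor st.1 b])) (true, [])
  bif r.1 then r.2 ++ [true] else r.2

theorem bits_succ (n : ℕ) : (n + 1).bits = succBits n.bits := by
  -- Once the carry is `false`, the remaining digits are copied.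
  have key : ∀ (l acc : List Bool), l.foldl (fun st b => (st.1 && b, st.2 ++ [xor st.1 b]))
      (false, acc) = (false, acc ++ l) := by
    intro l
    induction l with
    | nil => simp
    | cons b l ih => intro acc; simp [ih]
  -- The digits already produced do not influence the rest of the addition.
  have key2 : ∀ (l acc : List Bool) (c : Bool),
      l.foldl (fun st b => (st.1 && b, st.2 ++ [xor st.1 b])) (c, acc) =
      ((l.foldl (fun st b => (st.1 && b, st.2 ++ [xor st.1 b])) (c, [])).1,
        acc ++ (l.foldl (fun st b => (st.1 && b, st.2 ++ [xor st.1 b])) (c, [])).2) := by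
    intro l
    induction l with
    | nil => simp
    | cons b l ih =>
      intro acc c
      rw [List.foldl_cons, List.foldl_cons, ih (acc ++ [xor c b]), ih ([] ++ [xor c b])]
      simp
  have hcons : ∀ (b : Bool) (l : List Bool), succBits (b :: l) =
      if b then false :: succBits l else true :: l := by
    intro b l
    cases b
    · simp [succBits, key]
    · simp only [succBits, List.foldl_cons]
      rw [key2]
      simp only [Bool.and_self, Bool.xor_self, List.nil_append, if_true]
      cases (l.foldl (fun st b => (st.1 && b, st.2 ++ [xor st.1 b])) (true, [])).1 <;> rfl
  induction n using Nat.binaryRec' with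
  | zero => simp [succBits]
  | bit b n h ih =>
    rw [Nat.bits_append_bit n b h, hcons]
    cases b
    · rw [show Nat.bit false n + 1 = Nat.bit true n by simp [Nat.bit], Nat.bits_append_bit n true (by simp)]
      rfl
    · rw [show Nat.bit true n + 1 = Nat.bit false (n + 1) by simp [Nat.bit]; ring,
        Nat.bits_append_bit (n + 1) false (by simp), ih]
      rfl

namespace PT

variable {Γ : Type} {α β γ δ σ : Type*} [Code Γ α] [Code Γ β] [Code Γ γ] [Code Γ δ] [Code Γ σ]

@[fun_prop] theorem distinct [Finite Γ] [InjCode Γ β] [DecidableEq β] {l : α → List β}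
    (hl : PT Γ l) : PT Γ (fun a => distinct (l a)) := by
  obtain ⟨s, hs⟩ := hl.exists_size_le
  refine foldl_of_size (h := fun _ acc b => if b ∈ acc then acc else b :: acc)
    (init := fun _ => []) hl (const' []) (by fun_prop) s ?_
  intro a l₁ l₂ hal
  refine le_trans ?_ ((size_le_append_left hal).trans (hs a))
  clear hal
  induction l₁ using List.reverseRecOn with
  | nil => simp
  | append_singleton l c ih =>
    rw [List.foldl_append, List.foldl_cons, List.foldl_nil]
    split_ifs
    · rw [size_append]; omega
    · simp only [size_append, size_cons, size_nil]; omega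

@[fun_prop] theorem xor {f g : α → Bool} (hf : PT Γ f) (hg : PT Γ g) :
    PT Γ (fun a => xor (f a) (g a)) :=
  of_enc (hf.cond hg.not hg) fun a => by cases f a <;> simp

@[fun_prop] theorem succBits {l : α → List Bool} (hl : PT Γ l) : PT Γ (fun a => succBits (l a)) := by
  have h : PT Γ (fun a => (l a).foldl (fun st b => (st.1 && b, st.2 ++ [Bool.xor st.1 b]))
      (true, [])) := by
    obtain ⟨s, hs⟩ := hl.exists_size_le
    refine foldl_of_size (h := fun _ st b => (st.1 && b, st.2 ++ [Bool.xor st.1 b]))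
      (init := fun _ => (true, [])) hl (const' _) (by fun_prop) (3 + 3 * s) ?_
    intro a l₁ l₂ hal
    have h1 := (length_le_size (Γ := Γ) l₁).trans ((size_le_append_left hal).trans (hs a))
    have h2 : ∀ l₁ : List Bool, (l₁.foldl (fun st b => (st.1 && b, st.2 ++ [Bool.xor st.1 b]))
        (true, [])).2.length = l₁.length := by
      intro l₁
      induction l₁ using List.reverseRecOn with
      | nil => rfl
      | append_singleton l c ih => simp [ih]
    have h3 := size_le_of_forall (Γ := Γ) (B := 1) (fun b _ => size_bool_le b)
      (l := (l₁.foldl (fun st b => (st.1 && b, st.2 ++ [Bool.xor st.1 b])) (true, [])).2)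
    rw [h2] at h3
    have h4 := size_bool_le (Γ := Γ)
      (l₁.foldl (fun st b => (st.1 && b, st.2 ++ [Bool.xor st.1 b])) (true, [])).1
    simp only [size_prod, Polynomial.eval_add, Polynomial.eval_mul, Polynomial.eval_ofNat]
    omega
  refine of_enc ((h.fst).cond (h.snd.append (const' [true])) h.snd) fun a => rfl

-- The number is coded in unary, so the time allows for counting up to it with `succBits`.
@[fun_prop] theorem bits {f : α → ℕ} (hf : PT Γ f) : PT Γ (fun a => (f a).bits) := by
  have key : ∀ l : List Unit, l.foldl (fun acc _ => TensorComplexity.succBits acc) [] =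
      l.length.bits := by
    intro l
    induction l using List.reverseRecOn with
    | nil => rfl
    | append_singleton l c ih => simp [ih, bits_succ]
  obtain ⟨s, hs⟩ := hf.exists_size_le
  refine of_enc (foldl_of_size (h := fun _ acc _ => TensorComplexity.succBits acc)
    (init := fun _ => []) hf.units (const' []) (by fun_prop) (3 * s) ?_) fun a => by
      rw [key, List.length_replicate]
  intro a l₁ l₂ hal
  rw [key]
  have h1 : l₁.length ≤ s.eval (size Γ a) := by
    have := hs a
    have h2 := congrArg List.length hal
    simp at this h2
    omega
  have h2 := size_le_of_forall (Γ := Γ) (B := 1) (fun b _ => size_bool_le b) (l := l₁.length.bits)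
  have h3 : l₁.length.bits.length ≤ l₁.length := by
    rw [Nat.size_eq_bits_len]
    exact Nat.size_le.2 Nat.lt_two_pow_self
  simp only [Polynomial.eval_mul, Polynomial.eval_ofNat]
  omega

end PT

end TensorComplexity


namespace TensorComplexity

open Module

/-! ### Rank-one completions and tensor rank -/

section Completion

variable {U V I K : Type*}

/-- The rank-two minors of a matrix vanish. -/
def MinorsVanish [CommRing K] (X : U → V → K) : Prop :=
  ∀ p p' v v', X p v * X p' v' = X p v' * X p' v

/-- The affine family of matrices `A + ∑ xᵢ uᵢ ⊗ vᵢ`. -/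
def completion [CommRing K] [Fintype I] (A : U → V → K) (u : I → U → K) (v : I → V → K)
    (x : I → K) (p : U) (q : V) : K :=
  A p q + ∑ i, x i * (u i p * v i q)

/-- The tensor whose rank decides whether the family has a member of rank one. -/
def completionTensor [CommRing K] [DecidableEq I] (A : U → V → K) (u : I → U → K) (v : I → V → K) :
    U ⊕ I → V ⊕ I → Option I → K
  | .inl p, .inl q, none => A p q
  | .inr i, .inr j, none => if i = j then 1 else 0
  | .inl p, .inl q, some i => u i p * v i q
  | .inl p, .inr j, some i => if i = j then u i p else 0
  | _, _, _ => 0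

/-- The term `(a, 0) ⊗ (b, 0) ⊗ e_none` puts the completed matrix into the slice `none`. For each
`i`, the term `(uᵢ, 0) ⊗ (vᵢ, eᵢ) ⊗ (eᵢ - xᵢ e_none)` creates the `i`th slice and removes `xᵢ` times
it from the slice `none`. The term `(xᵢ uᵢ, eᵢ) ⊗ (0, eᵢ) ⊗ e_none` repairs the block `U × I` spoilt
thereby and supplies the identity block. -/
theorem completionTensor_eq_sum [CommRing K] [DecidableEq I] [Fintype I] {A : U → V → K}
    {u : I → U → K} {v : I → V → K} (x : I → K) (a : U → K) (b : V → K)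
    (h : ∀ p q, completion A u v x p q = a p * b q) :
    ∃ (α : Option (I ⊕ I) → U ⊕ I → K) (β : Option (I ⊕ I) → V ⊕ I → K)
      (γ : Option (I ⊕ I) → Option I → K),
      ∀ r s t, completionTensor A u v r s t = ∑ q, α q r * β q s * γ q t := by
  refine ⟨fun q => match q with
      | none => Sum.elim a 0
      | some (.inl i) => Sum.elim (u i) 0
      | some (.inr i) => Sum.elim (fun p => x i * u i p) (Pi.single i 1),
    fun q => match q with
      | none => Sum.elim b 0
      | some (.inl i) => Sum.elim (v i) (Pi.single i 1)
      | some (.inr i) => Sum.elim 0 (Pi.single i 1),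
    fun q => match q with
      | none => fun t => if t = none then 1 else 0
      | some (.inl i) => fun t => match t with
        | none => - x i
        | some j => if j = i then 1 else 0
      | some (.inr i) => fun t => if t = none then 1 else 0, ?_⟩
  rintro (p | i) (q | j) (_ | t) <;>
    simp only [completionTensor, Fintype.sum_option, Fintype.sum_sum_type, Sum.elim_inl,
      Sum.elim_inr, Pi.single_apply, Pi.zero_apply, reduceCtorEq, if_false, if_true, mul_zero,
      zero_mul, mul_one, add_zero, zero_add, Finset.sum_const_zero]
  · rw [← h, completion]
    simp [add_assoc, mul_comm, mul_left_comm]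
  · simp
  · simp [mul_comm]
  · simp [eq_comm]
  · simp

section Field

variable [Field K] [Fintype I] [DecidableEq I] {Q : Type*} [Fintype Q] [DecidableEq Q]
  {A : U → V → K} {u : I → U → K} {v : I → V → K}
  {a : Q → U ⊕ I → K} {b : Q → V ⊕ I → K} {c : Q → Option I → K}

/-- The affine functional `c₀ + ∑ xᵢ cᵢ`. -/
def affineValue (x : I → K) (c : Option I → K) : K := c none + ∑ i, x i * c (some i)

/-- The combination is a block triangular matrix with the completion and the identity on the
diagonal and the columns `xⱼ uⱼ` in the corner. In terms of the decomposition, each summand is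
weighted by the affine value of its third factor. -/
theorem combine_slices
    (hT : ∀ r s t, completionTensor A u v r s t = ∑ q, a q r * b q s * c q t)
    (x : I → K) (r : U ⊕ I) (s : V ⊕ I) :
    completionTensor A u v r s none + ∑ i, x i * completionTensor A u v r s (some i) =
      ∑ q, affineValue x (c q) * b q s * a q r := by
  simp only [hT, affineValue, Finset.mul_sum]
  rw [Finset.sum_comm, ← Finset.sum_add_distrib]
  refine Finset.sum_congr rfl fun q _ => ?_
  rw [add_mul, add_mul, Finset.sum_mul, Finset.sum_mul]
  congr 1
  · ring
  · exact Finset.sum_congr rfl fun i _ => by ring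

/-- Summands whose affine value vanishes drop out of the combination, and each of its columns is a
combination of the remaining `a q`. -/
theorem slices_mem_span
    (hT : ∀ r s t, completionTensor A u v r s t = ∑ q, a q r * b q s * c q t)
    (x : I → K) (Z : Finset Q) (hZ : ∀ q ∈ Z, affineValue x (c q) = 0) (s : V ⊕ I) :
    (fun r => completionTensor A u v r s none +
      ∑ i, x i * completionTensor A u v r s (some i)) ∈
      Submodule.span K (a '' (Zᶜ : Finset Q)) := by
  have : (fun r => completionTensor A u v r s none +
      ∑ i, x i * completionTensor A u v r s (some i)) =
      ∑ q, (affineValue x (c q) * b q s) • a q := by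
    ext r
    rw [combine_slices hT]
    simp [Finset.sum_apply]
  rw [this]
  refine Submodule.sum_mem _ fun q _ => ?_
  by_cases hq : q ∈ Z
  · simp [hZ q hq]
  · exact Submodule.smul_mem _ _ (Submodule.subset_span ⟨q, by simpa using hq, rfl⟩)

theorem column_inl_mem
    (hT : ∀ r s t, completionTensor A u v r s t = ∑ q, a q r * b q s * c q t)
    (x : I → K) (Z : Finset Q) (hZ : ∀ q ∈ Z, affineValue x (c q) = 0) (s : V) :
    (Sum.elim (fun p => completion A u v x p s) 0 : U ⊕ I → K) ∈
      Submodule.span K (a '' (Zᶜ : Finset Q)) := by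
  convert slices_mem_span hT x Z hZ (.inl s) using 1
  ext (p | i) <;> simp [completionTensor, completion]

theorem column_inr_mem
    (hT : ∀ r s t, completionTensor A u v r s t = ∑ q, a q r * b q s * c q t)
    (x : I → K) (Z : Finset Q) (hZ : ∀ q ∈ Z, affineValue x (c q) = 0) (j : I) :
    (Sum.elim (x j • u j) (Pi.single j 1) : U ⊕ I → K) ∈
      Submodule.span K (a '' (Zᶜ : Finset Q)) := by
  convert slices_mem_span hT x Z hZ (.inr j) using 1
  ext (p | i) <;> simp [completionTensor, Pi.single_apply]

/-- A space of functions on `U ⊕ I` that surjects onto the functions on `I`. -/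
theorem card_add_finrank_le [Finite U] (Z : Finset Q) (E : Submodule K (U → K))
    (hE : ∀ g ∈ E, (Sum.elim g 0 : U ⊕ I → K) ∈ Submodule.span K (a '' (Z : Set Q)))
    (hI : ∀ i, ∃ g : U → K, (Sum.elim g (Pi.single i 1) : U ⊕ I → K) ∈
      Submodule.span K (a '' (Z : Set Q))) :
    Fintype.card I + finrank K E ≤ Z.card := by
  classical
  have := Fintype.ofFinite U
  set W := Submodule.span K (a '' (Z : Set Q)) with hW
  have hle : finrank K W ≤ Z.card := by
    have := finrank_span_finset_le_card (R := K) (Z.image a)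
    rw [Finset.coe_image] at this
    exact this.trans Finset.card_image_le
  -- The projection of `W` to the coordinates in `I` is onto, and its kernel contains a copy of `E`,
  -- so rank and nullity give the bound.
  let π : W →ₗ[K] (I → K) := (LinearMap.funLeft K K Sum.inr).comp W.subtype
  have hsurj : LinearMap.range π = ⊤ := by
    rw [eq_top_iff, ← (Pi.basisFun K I).span_eq, Submodule.span_le]
    rintro _ ⟨i, rfl⟩
    obtain ⟨g, hg⟩ := hI i
    refine ⟨⟨_, hg⟩, ?_⟩
    ext j
    simp [π, LinearMap.funLeft_apply]
  have hrn := LinearMap.finrank_range_add_finrank_ker π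
  rw [hsurj, finrank_top, Module.finrank_fintype_fun_eq_card] at hrn
  let ι : E →ₗ[K] LinearMap.ker π :=
    { toFun := fun g => ⟨⟨Sum.elim g.1 0, hE _ g.2⟩, by
        ext j; simp [π, LinearMap.funLeft_apply]⟩
      map_add' := fun g g' => by
        ext (j | j) <;> simp
      map_smul' := fun s g => by
        ext (j | j) <;> simp }
  have hι : Function.Injective ι := fun g g' h => by
    ext p
    have := congrArg (fun w : LinearMap.ker π => (w : W).1 (Sum.inl p)) h
    simpa [ι] using this
  have := LinearMap.finrank_le_finrank_of_injective hι
  omega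

/-- The span of the columns of a member of the family. -/
def columnSpan (A : U → V → K) (u : I → U → K) (v : I → V → K) (x : I → K) :
    Submodule K (U → K) :=
  Submodule.span K (Set.range fun s => fun p => completion A u v x p s)

/-- The combined slice has rank `card I` plus the rank of the completion, by its triangular shape,
and only the summands outside `Z` contribute to it. -/
theorem card_add_finrank_columnSpan_le [Finite U]
    (hT : ∀ r s t, completionTensor A u v r s t = ∑ q, a q r * b q s * c q t)
    (x : I → K) (Z : Finset Q) (hZ : ∀ q ∈ Z, affineValue x (c q) = 0) :
    Fintype.card I + finrank K (columnSpan A u v x) ≤ Zᶜ.card := by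
  refine card_add_finrank_le (a := a) Zᶜ _ (fun g hg => ?_) fun i => ⟨_, column_inr_mem hT x Z hZ i⟩
  induction hg using Submodule.span_induction with
  | mem g hg =>
    obtain ⟨s, rfl⟩ := hg
    exact column_inl_mem hT x Z hZ s
  | zero =>
    convert Submodule.zero_mem _
    ext (p | i) <;> rfl
  | add g g' _ _ h h' =>
    convert Submodule.add_mem _ h h'
    ext (p | i) <;> simp
  | smul r g _ h =>
    convert Submodule.smul_mem _ r h
    ext (p | i) <;> simp

theorem minorsVanish_of_finrank_le_one [Finite U] {x : I → K}
    (h : finrank K (columnSpan A u v x) ≤ 1) : MinorsVanish (completion A u v x) := by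
  obtain ⟨g, hg⟩ := finrank_le_one_iff.mp h
  have key : ∀ s, ∃ μ : K, ∀ p, completion A u v x p s = μ * (g : U → K) p := fun s => by
    obtain ⟨μ, hμ⟩ := hg ⟨fun p => completion A u v x p s, Submodule.subset_span ⟨s, rfl⟩⟩
    exact ⟨μ, fun p => (congrFun (congrArg Subtype.val hμ) p).symm⟩
  choose μ hμ using key
  intro p p' s s'
  rw [hμ, hμ, hμ, hμ]
  ring

theorem finrank_columnSpan_pos [Finite U] {x : I → K}
    (h : ∃ p s, completion A u v x p s ≠ 0) : 0 < finrank K (columnSpan A u v x) := by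
  obtain ⟨p, s, h⟩ := h
  rw [Module.finrank_pos_iff_exists_ne_zero]
  refine ⟨⟨_, Submodule.subset_span ⟨s, rfl⟩⟩, fun h0 => h ?_⟩
  exact congrFun (congrArg Subtype.val h0) p

/-- The linear part of a vector on `Option I`. -/
def linearPart (c : Option I → K) : I → K := fun i => c (some i)

/-- Otherwise a nonzero functional `f` kills all linear parts, and hence the combination of the
slices `some i` with weights `f eᵢ`. At a position `(p, inr j)` with `u j p = 1` this combination is
`f eⱼ`, so `f = 0`. -/
theorem linearPart_eq_top
    (hT : ∀ r s t, completionTensor A u v r s t = ∑ q, a q r * b q s * c q t)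
    (hu : ∀ i, ∃ p, u i p = 1) :
    Submodule.span K (Set.range fun q => linearPart (c q)) = ⊤ := by
  by_contra h
  obtain ⟨f, hf, hle⟩ := Submodule.exists_le_ker_of_lt_top _ (lt_top_iff_ne_top.mpr h)
  refine hf (LinearMap.pi_ext' fun j => LinearMap.ext_ring ?_)
  obtain ⟨p, hp⟩ := hu j
  have hc : ∀ q, ∑ i, c q (some i) * f (Pi.single i 1) = 0 := fun q => by
    have h1 : f (linearPart (c q)) = 0 := hle (Submodule.subset_span ⟨q, rfl⟩)
    rw [← h1, LinearMap.pi_apply_eq_sum_univ f]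
    simp [linearPart, ← Pi.single_apply]
    refine Finset.sum_congr rfl fun i _ => ?_
    congr 2
    ext k
    simp [Pi.single_apply, eq_comm]
  have : ∑ i, completionTensor A u v (.inl p) (.inr j) (some i) * f (Pi.single i 1) = 0 := by
    simp only [hT, Finset.sum_mul]
    rw [Finset.sum_comm]
    refine Finset.sum_eq_zero fun q _ => ?_
    simp only [mul_assoc, ← Finset.mul_sum, hc, mul_zero]
  simpa [completionTensor, hp] using this

/-- The linear parts over `B` form a basis, so the affine equations form an invertible square
system; its solution is a functional prescribed on this basis. -/
theorem exists_affineValue_eq_zero (B : Finset Q)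
    (hB : LinearIndepOn K (fun q => linearPart (c q)) (B : Set Q))
    (hs : Submodule.span K ((fun q => linearPart (c q)) '' (B : Set Q)) = ⊤) :
    B.card = Fintype.card I ∧ ∃ x : I → K, ∀ q ∈ B, affineValue x (c q) = 0 := by
  have hs' : ⊤ ≤ Submodule.span K (Set.range fun q : B => linearPart (c q)) := by
    rw [← hs, Set.image_eq_range]
    rfl
  let e : Basis B K (I → K) := Basis.mk (v := fun q : B => linearPart (c q)) hB hs'
  refine ⟨?_, ?_⟩
  · rw [← Module.finrank_fintype_fun_eq_card K, finrank_eq_card_basis e, Fintype.card_coe]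
  · let f := e.constr K (fun q : B => - c q none)
    refine ⟨fun i => f (Pi.single i 1), fun q hq => ?_⟩
    have h1 : f (e ⟨q, hq⟩) = - c q none := e.constr_basis K _ _
    rw [show e ⟨q, hq⟩ = linearPart (c q) from Basis.mk_apply _ _ _, LinearMap.pi_apply_eq_sum_univ f] at h1
    rw [affineValue, add_eq_zero_iff_neg_eq, ← h1]
    refine Finset.sum_congr rfl fun i _ => ?_
    rw [smul_eq_mul, mul_comm]
    congr 2
    ext k
    simp [Pi.single_apply, eq_comm]

/-- A decomposition into `2k + 1` simple tensors, `k` being the number of parameters, yields a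
member of rank at most one whose parameters are polynomials in the entries of the decomposition. -/
theorem exists_minorsVanish [Finite U]
    (hT : ∀ r s t, completionTensor A u v r s t = ∑ q, a q r * b q s * c q t)
    (hQ : Fintype.card Q = 2 * Fintype.card I + 1)
    (hu : ∀ i, ∃ p, u i p = 1)
    (hne : ∀ x, ∃ p s, completion A u v x p s ≠ 0)
    (huniq : ∀ x x' : I → K, MinorsVanish (completion A u v x) →
      MinorsVanish (completion A u v x') →
      finrank K (Submodule.span K (Set.range fun i => (x i - x' i) • u i)) ≤ 2 → x = x')
    (S : Subring K) (ha : ∀ q r, a q r ∈ S) (hb : ∀ q r, b q r ∈ S) (hc : ∀ q r, c q r ∈ S) :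
    ∃ x : I → K, (∀ i, x i ∈ S) ∧ MinorsVanish (completion A u v x) := by
  classical
  have hspan := linearPart_eq_top hT hu
  -- A basis `B` of linear parts has `k` elements, `k` being the number of parameters. The common
  -- zero `x` leaves `k + 1` of the `2k + 1` summands, hence rank at most one for the completion.
  have extend : ∀ s t : Set Q, LinearIndepOn K (fun q => linearPart (c q)) s → s ⊆ t →
      Submodule.span K ((fun q => linearPart (c q)) '' t) = ⊤ →
      ∃ B : Finset Q, s ⊆ B ∧ (B : Set Q) ⊆ t ∧
        Submodule.span K ((fun q => linearPart (c q)) '' (B : Set Q)) = ⊤ ∧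
        B.card = Fintype.card I ∧ ∃ x : I → K, (∀ q ∈ B, affineValue x (c q) = 0) ∧
          MinorsVanish (completion A u v x) := by
    intro s t hs hst ht
    obtain ⟨B, hBt, hsB, hBs, hB⟩ := exists_linearIndepOn_extension hs hst
    lift B to Finset Q using Set.toFinite B
    have hBtop := top_le_iff.mp (ht ▸ Submodule.span_le.mpr hBs)
    obtain ⟨hcard, x, hx⟩ := exists_affineValue_eq_zero B hB hBtop
    refine ⟨B, hsB, hBt, hBtop, hcard, x, hx, minorsVanish_of_finrank_le_one ?_⟩
    have := card_add_finrank_columnSpan_le hT x B hx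
    rw [Finset.card_compl] at this
    omega
  obtain ⟨B, -, -, hBtop, hcard, x, hx, hm⟩ := extend ∅ Set.univ (linearIndepOn_empty _ _)
    (Set.empty_subset _) (by rw [Set.image_univ, hspan])
  -- Integrality rests on this claim. A nonzero linear part outside `B` could be exchanged into a
  -- second basis `B'` that shares at least `k - 1` indices with `B`.
  have hzero : ∀ q ∉ B, linearPart (c q) = 0 := by
    intro q₁ hq₁
    by_contra hne₁
    obtain ⟨B', hqB', hB', -, hcard', x', hx', hm'⟩ := extend {q₁} (insert q₁ (B : Set Q))
      (by simpa using hne₁) (by simp) (top_le_iff.mp (hBtop ▸ Submodule.span_mono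
        (Set.image_mono (Set.subset_insert _ _))))
    have hq₁' : q₁ ∈ B' := hqB' rfl
    have hinter : B'.card ≤ (B ∩ B').card + 1 := by
      have : B' ⊆ insert q₁ (B ∩ B') := fun q hq => by
        rcases hB' hq with h | h
        · simp [h]
        · exact Finset.mem_insert_of_mem (Finset.mem_inter.mpr ⟨h, hq⟩)
      exact (Finset.card_le_card this).trans (Finset.card_insert_le _ _)
    -- Subtracting the columns that belong to `x` and `x'` leaves the vectors `((xᵢ - x'ᵢ) uᵢ, 0)`.
    -- Everything lies in the span of at most `k + 2` vectors, so at most two dimensions remain for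
    -- these differences.
    have hdim : Fintype.card I +
        finrank K (Submodule.span K (Set.range fun i => (x i - x' i) • u i)) ≤ (B ∩ B')ᶜ.card := by
      have hmem := column_inr_mem hT x (B ∩ B') fun q hq => hx q (Finset.mem_inter.mp hq).1
      have hmem' := column_inr_mem hT x' (B ∩ B') fun q hq => hx' q (Finset.mem_inter.mp hq).2
      refine card_add_finrank_le (a := a) _ _ (fun g hg => ?_) fun i => ⟨_, hmem i⟩
      induction hg using Submodule.span_induction with
      | mem g hg =>
        obtain ⟨i, rfl⟩ := hg
        convert Submodule.sub_mem _ (hmem i) (hmem' i) using 1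
        ext (p | i) <;> simp [sub_mul]
      | zero =>
        convert Submodule.zero_mem _
        ext (p | i) <;> rfl
      | add g g' _ _ h h' =>
        convert Submodule.add_mem _ h h'
        ext (p | i) <;> simp
      | smul r g _ h =>
        convert Submodule.smul_mem _ r h
        ext (p | i) <;> simp
    rw [Finset.card_compl] at hdim
    have hxx := huniq x x' hm hm' (by omega)
    subst hxx
    -- Now `x` annihilates `k + 1` summands. The other `k` are used up by the identity block,
    -- leaving no room for a nonzero completion.
    have hpos := finrank_columnSpan_pos (hne x)
    have h := card_add_finrank_columnSpan_le hT x (insert q₁ B) fun q hq => by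
      rcases Finset.mem_insert.mp hq with rfl | hq
      · exact hx' _ hq₁'
      · exact hx _ hq
    rw [Finset.card_compl, Finset.card_insert_of_notMem hq₁] at h
    omega
  refine ⟨x, fun i => ?_, hm⟩
  obtain ⟨p, hp⟩ := hu i
  -- By `hzero` only `B` contributes to the slices `some j`, whose entries at `(inl p, inr i)` are 1
  -- for `j = i` and 0 otherwise. Inserting `c q none = -∑ⱼ xⱼ c q (some j)` isolates `x i` without
  -- any division.
  have hx' : x i = - ∑ q ∈ B, a q (.inl p) * b q (.inr i) * c q none := by
    have h1 : ∀ j, ∑ q ∈ B, a q (.inl p) * b q (.inr i) * c q (some j) =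
        if j = i then 1 else 0 := fun j => by
      rw [Finset.sum_subset (Finset.subset_univ B), ← hT]
      · by_cases h : j = i
        · subst h; simp [completionTensor, hp]
        · simp [completionTensor, h]
      · intro q _ hq
        have : c q (some j) = 0 := congrFun (hzero q hq) j
        rw [this, mul_zero]
    have h2 : ∀ q ∈ B, c q none = - ∑ j, x j * c q (some j) := fun q hq =>
      eq_neg_of_add_eq_zero_left (hx q hq)
    rw [Finset.sum_congr rfl fun q hq => by rw [h2 q hq]]
    simp only [mul_neg, Finset.sum_neg_distrib, neg_neg, Finset.mul_sum]
    rw [Finset.sum_comm]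
    have h3 : ∀ j, ∑ q ∈ B, a q (.inl p) * b q (.inr i) * (x j * c q (some j)) =
        if j = i then x j else 0 := fun j => by
      rw [show (if j = i then x j else 0) = x j * if j = i then 1 else 0 by simp, ← h1 j,
        Finset.mul_sum]
      exact Finset.sum_congr rfl fun q _ => by ring
    simp [h3]
  rw [hx']
  exact S.neg_mem (S.sum_mem fun q _ => S.mul_mem (S.mul_mem (ha _ _) (hb _ _)) (hc _ _))

end Field

end Completion

end TensorComplexity


namespace TensorComplexity

/-! ### The matrix completion problem of a polynomial system -/

/-- A monomial, tagged with the number of its polynomial and its position therein. -/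
abbrev Mono (R ω : Type*) := (ℕ × ℕ) × R × List ω

/-- An initial segment of the list of variables of a monomial. -/
abbrev Node (R ω : Type*) := Mono R ω × ℕ

/-- An occurrence of a variable in a monomial, and its position. -/
abbrev Step (R ω : Type*) := Mono R ω × ω × ℕ

/-- Columns of the completion problem. -/
inductive Col (R ω : Type*)
  | one
  | zero
  | node (n : Node R ω)
  deriving DecidableEq

/-- Rows of the completion problem. Each comes in several copies. -/
inductive Row (R ω : Type*)
  | unit (c : ℕ)
  | sum (c f : ℕ)
  | pre (c : ℕ) (s : Step R ω)
  | var (c : ℕ) (s : Step R ω)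
  deriving DecidableEq

/-- Parameters of the completion problem. -/
inductive Param (R ω : Type*)
  | unitNode (c : ℕ) (n : Node R ω)
  | sumNode (c f : ℕ) (n : Node R ω)
  | preNode (c : ℕ) (s : Step R ω) (n : Node R ω)
  | varNode (c : ℕ) (s : Step R ω) (n : Node R ω)
  | link (c : ℕ) (s : Step R ω)
  | var (x : ω)
  deriving DecidableEq

namespace Completion

variable {R ω : Type*}

/-- The node before a step. -/
def inNode (s : Step R ω) : Node R ω := (s.1, s.2.2)

/-- The node after a step. -/
def outNode (s : Step R ω) : Node R ω := (s.1, s.2.2 + 1)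

theorem inNode_ne_outNode (s : Step R ω) : inNode s ≠ outNode s := by
  simp [inNode, outNode]

/-- The occurrences of variables. -/
def steps (E : List (Mono R ω)) : List (Step R ω) :=
  E.flatMap fun m => m.2.2.zipIdx.map fun x => (m, x)

/-- The initial segments of the monomials. -/
def nodes (E : List (Mono R ω)) : List (Node R ω) :=
  E.flatMap fun m => (List.range (m.2.2.length + 1)).map fun j => (m, j)

/-- The columns in use. -/
def cols (E : List (Mono R ω)) : List (Col R ω) :=
  .one :: .zero :: (nodes E).map .node

/-- The rows in use. -/
def rows (E : List (Mono R ω)) (t : ℕ) : List (Row R ω) :=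
  (List.range 3).flatMap fun c => .unit c :: ((List.range t).map (.sum c) ++
    ((steps E).map (.pre c) ++ (steps E).map (.var c)))

section

variable [DecidableEq R] [DecidableEq ω]

/-- The parameters in use. -/
def params (E : List (Mono R ω)) (t : ℕ) : List (Param R ω) :=
  ((List.range 3).flatMap fun c =>
    ((nodes E).filter (fun n => n.2 ≠ 0)).map (.unitNode c) ++
    (((List.range t).flatMap fun f => (nodes E).map (.sumNode c f)) ++
    (((steps E).flatMap fun s =>
      ((nodes E).filter (fun n => n ≠ outNode s)).map (.preNode c s)) ++
    (((steps E).flatMap fun s =>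
      ((nodes E).filter (fun n => n ≠ inNode s)).map (.varNode c s)) ++
    (steps E).map (.link c))))) ++
  (distinct ((steps E).map fun s => s.2.1)).map .var

/-- The rows in which a parameter occurs. -/
def rowsOf (E : List (Mono R ω)) : Param R ω → List (Row R ω)
  | .unitNode c _ => [.unit c]
  | .sumNode c f _ => [.sum c f]
  | .preNode c s _ => [.pre c s]
  | .varNode c s _ => [.var c s]
  | .link c s => [.pre c s, .var c s]
  | .var x => ((steps E).filter fun s => s.2.1 = x).flatMap fun s => (List.range 3).map fun c =>
      .var c s

/-- The columns in which a parameter occurs with coefficient one. -/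
def colsOf : Param R ω → List (Col R ω)
  | .unitNode _ n | .sumNode _ _ n | .preNode _ _ n | .varNode _ _ n => [.node n]
  | .link _ s => [.node (inNode s), .node (outNode s)]
  | .var _ => [.one]

/-- The coefficient of a parameter in the column `zero`. -/
def zeroEntry [Zero R] : Param R ω → R
  | .sumNode _ f n => if n.1.1.1 = f ∧ n.2 = n.1.2.2.length then n.1.2.1 else 0
  | _ => 0

variable {K : Type*} [CommRing R] [CommRing K] (φ : R →+* K)

/-- The constant part of the completion problem. -/
def base : Row R ω → Col R ω → K
  | .unit _, .one | .sum _ _, .one | .pre _ _, .one => 1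
  | .unit _, .node n => if n.2 = 0 then 1 else 0
  | .sum _ _, .node _ | .pre _ _, .node _ | .var _ _, .node _ => 0
  | .unit _, .zero | .sum _ _, .zero | .pre _ _, .zero | .var _ _, .zero | .var _ _, .one => 0

/-- The row factor of a parameter. -/
def rowFactor (K : Type*) [CommRing K] (E : List (Mono R ω)) (i : Param R ω) (p : Row R ω) : K :=
  if p ∈ rowsOf E i then 1 else 0

/-- The column factor of a parameter. -/
def colFactor (i : Param R ω) (q : Col R ω) : K :=
  if q ∈ colsOf i then 1 else if q = .zero then φ (zeroEntry i) else 0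

/-- The completed matrix. -/
def value (E : List (Mono R ω)) (t : ℕ) (x : Param R ω → K) (p : Row R ω) (q : Col R ω) : K :=
  base p q + ((params E t).map fun i => x i * (rowFactor K E i p * colFactor φ i q)).sum

end

theorem mem_steps {E : List (Mono R ω)} {s : Step R ω} :
    s ∈ steps E ↔ s.1 ∈ E ∧ s.2 ∈ s.1.2.2.zipIdx := by
  obtain ⟨m, x⟩ := s
  simp only [steps, List.mem_flatMap, List.mem_map, Prod.mk.injEq]
  exact ⟨by rintro ⟨m, hm, y, hy, rfl, rfl⟩; exact ⟨hm, hy⟩, fun h => ⟨m, h.1, x, h.2, rfl, rfl⟩⟩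

theorem mem_nodes {E : List (Mono R ω)} {n : Node R ω} :
    n ∈ nodes E ↔ n.1 ∈ E ∧ n.2 ≤ n.1.2.2.length := by
  obtain ⟨m, x⟩ := n
  simp only [nodes, List.mem_flatMap, List.mem_map, Prod.mk.injEq, List.mem_range,
    Nat.lt_succ_iff]
  exact ⟨by rintro ⟨m, hm, y, hy, rfl, rfl⟩; exact ⟨hm, hy⟩, fun h => ⟨m, h.1, x, h.2, rfl, rfl⟩⟩

theorem inNode_mem {E : List (Mono R ω)} {s : Step R ω} (h : s ∈ steps E) :
    inNode s ∈ nodes E := by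
  rw [mem_steps] at h
  have := List.snd_lt_of_mem_zipIdx h.2
  exact mem_nodes.mpr ⟨h.1, by simp only [inNode]; omega⟩

theorem outNode_mem {E : List (Mono R ω)} {s : Step R ω} (h : s ∈ steps E) :
    outNode s ∈ nodes E := by
  rw [mem_steps] at h
  have := List.snd_lt_of_mem_zipIdx h.2
  exact mem_nodes.mpr ⟨h.1, by simp only [outNode]; omega⟩

theorem nodup_flatMap_of_disjoint {α β : Type*} {l : List α} {f : α → List β} (hl : l.Nodup)
    (hf : ∀ a, (f a).Nodup) (hg : ∀ a a' b, b ∈ f a → b ∈ f a' → a = a') :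
    (l.flatMap f).Nodup := by
  rw [List.nodup_flatMap]
  exact ⟨fun a _ => hf a, hl.imp fun {a b} hab c hc hc' => hab (hg _ _ c hc hc')⟩

theorem nodup_steps {E : List (Mono R ω)} (hE : E.Nodup) : (steps E).Nodup := by
  refine nodup_flatMap_of_disjoint hE
    (fun m => (List.Nodup.of_map Prod.snd (by simpa using List.nodup_range')).map
      fun _ _ h => congrArg Prod.snd h) fun m m' b hb hb' => ?_
  obtain ⟨x, -, rfl⟩ := List.mem_map.mp hb
  obtain ⟨y, -, h⟩ := List.mem_map.mp hb'
  cases h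
  rfl

theorem nodup_nodes {E : List (Mono R ω)} (hE : E.Nodup) : (nodes E).Nodup := by
  refine nodup_flatMap_of_disjoint hE
    (fun m => List.nodup_range.map fun _ _ h => congrArg Prod.snd h) fun m m' b hb hb' => ?_
  obtain ⟨x, -, rfl⟩ := List.mem_map.mp hb
  obtain ⟨y, -, h⟩ := List.mem_map.mp hb'
  cases h
  rfl

section

variable [DecidableEq R] [DecidableEq ω] {E : List (Mono R ω)} {t : ℕ}

theorem mem_params {i : Param R ω} : i ∈ params E t ↔ match i with
    | .unitNode c n => c < 3 ∧ n ∈ nodes E ∧ n.2 ≠ 0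
    | .sumNode c f n => c < 3 ∧ f < t ∧ n ∈ nodes E
    | .preNode c s n => c < 3 ∧ s ∈ steps E ∧ n ∈ nodes E ∧ n ≠ outNode s
    | .varNode c s n => c < 3 ∧ s ∈ steps E ∧ n ∈ nodes E ∧ n ≠ inNode s
    | .link c s => c < 3 ∧ s ∈ steps E
    | .var x => ∃ s ∈ steps E, s.2.1 = x := by
  cases i <;>
    simp only [params, mem_distinct, List.mem_append, List.mem_flatMap, List.mem_map,
      List.mem_range, List.mem_filter, reduceCtorEq, and_false, exists_false, or_false, false_or,
      Param.unitNode.injEq, Param.sumNode.injEq, Param.preNode.injEq, Param.varNode.injEq,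
      Param.link.injEq, Param.var.injEq, decide_eq_true_eq] <;> grind

theorem nodup_params (hE : E.Nodup) : (params E t).Nodup := by
  have hn := nodup_nodes hE
  have hs := nodup_steps hE
  -- Reading off the number of the copy separates the blocks of different `c`; the value at `var` is
  -- arbitrary.
  have copy : ∃ f : Param R ω → ℕ, ∀ c, (∀ n, f (.unitNode c n) = c) ∧
      (∀ k n, f (.sumNode c k n) = c) ∧ (∀ s n, f (.preNode c s n) = c) ∧
      (∀ s n, f (.varNode c s n) = c) ∧ ∀ s, f (.link c s) = c :=
    ⟨fun i => match i with
      | .unitNode c _ | .sumNode c _ _ | .preNode c _ _ | .varNode c _ _ | .link c _ => c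
      | .var _ => 0, by simp⟩
  obtain ⟨f, hf⟩ := copy
  refine List.Nodup.append (nodup_flatMap_of_disjoint List.nodup_range (fun c => ?_) ?_)
    ((nodup_distinct _).map fun _ _ h => Param.var.inj h) ?_
  · refine List.Nodup.append ?_ (List.Nodup.append ?_ (List.Nodup.append ?_
      (List.Nodup.append ?_ ?_ ?_) ?_) ?_) ?_
    · exact (hn.filter _).map fun _ _ h => (Param.unitNode.inj h).2
    · refine nodup_flatMap_of_disjoint List.nodup_range
        (fun f => hn.map fun _ _ h => (Param.sumNode.inj h).2.2) fun a a' b hb hb' => ?_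
      obtain ⟨x, -, rfl⟩ := List.mem_map.mp hb
      obtain ⟨y, -, h⟩ := List.mem_map.mp hb'
      exact (Param.sumNode.inj h).2.1.symm
    · refine nodup_flatMap_of_disjoint hs
        (fun f => (hn.filter _).map fun _ _ h => (Param.preNode.inj h).2.2) fun a a' b hb hb' => ?_
      obtain ⟨x, -, rfl⟩ := List.mem_map.mp hb
      obtain ⟨y, -, h⟩ := List.mem_map.mp hb'
      exact (Param.preNode.inj h).2.1.symm
    · refine nodup_flatMap_of_disjoint hs
        (fun f => (hn.filter _).map fun _ _ h => (Param.varNode.inj h).2.2) fun a a' b hb hb' => ?_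
      obtain ⟨x, -, rfl⟩ := List.mem_map.mp hb
      obtain ⟨y, -, h⟩ := List.mem_map.mp hb'
      exact (Param.varNode.inj h).2.1.symm
    · exact hs.map fun _ _ h => (Param.link.inj h).2
    all_goals
      simp only [List.disjoint_left, List.mem_append, List.mem_flatMap, List.mem_map]
    · rintro _ ⟨s, _, n, _, rfl⟩ ⟨s', _, h⟩
      cases h
    · rintro _ ⟨s, _, n, _, rfl⟩ (⟨s', _, n', _, h⟩ | ⟨s', _, h⟩) <;> cases h
    · rintro _ ⟨s, _, n, _, rfl⟩ (⟨s', _, n', _, h⟩ | ⟨s', _, n', _, h⟩ | ⟨s', _, h⟩) <;> cases h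
    · rintro _ ⟨n, _, rfl⟩
        (⟨s', _, n', _, h⟩ | ⟨s', _, n', _, h⟩ | ⟨s', _, n', _, h⟩ | ⟨s', _, h⟩) <;> cases h
  · have key : ∀ (c : ℕ) (b : Param R ω), b ∈
        ((nodes E).filter (fun n => n.2 ≠ 0)).map (Param.unitNode c) ++
        (((List.range t).flatMap fun f => (nodes E).map (Param.sumNode c f)) ++
        (((steps E).flatMap fun s =>
          ((nodes E).filter (fun n => n ≠ outNode s)).map (Param.preNode c s)) ++
        (((steps E).flatMap fun s =>
          ((nodes E).filter (fun n => n ≠ inNode s)).map (Param.varNode c s)) ++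
        (steps E).map (Param.link c)))) → f b = c := by
      intro c b hb
      simp only [List.mem_append, List.mem_flatMap, List.mem_map] at hb
      rcases hb with ⟨n, _, rfl⟩ | ⟨s', _, n', _, rfl⟩ | ⟨s', _, n', _, rfl⟩ | ⟨s', _, n', _, rfl⟩ |
        ⟨s', _, rfl⟩ <;> simp [hf]
    exact fun a a' b hb hb' => (key a b hb).symm.trans (key a' b hb')
  · simp only [List.disjoint_left, List.mem_append, List.mem_flatMap, List.mem_map]
    rintro _ ⟨c, _, ⟨n, _, rfl⟩ | ⟨s', _, n', _, rfl⟩ | ⟨s', _, n', _, rfl⟩ |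
      ⟨s', _, n', _, rfl⟩ | ⟨s', _, rfl⟩⟩ ⟨x, _, h⟩ <;> cases h

variable {K : Type*} [CommRing R] [CommRing K] {φ : R →+* K} {x : Param R ω → K}

/-- Without repetitions the sum over the list is a sum over a finite set. Each entry is then found
by determining which parameters have both factors nonzero there. -/
theorem value_eq_sum (hE : E.Nodup) (p : Row R ω) (q : Col R ω) :
    value φ E t x p q = base p q +
      ∑ i ∈ (params E t).toFinset, x i * (rowFactor K E i p * colFactor φ i q) := by
  rw [value, List.sum_toFinset _ (nodup_params hE)]

theorem value_unit_one (hE : E.Nodup) (c : ℕ) : value φ E t x (.unit c) .one = 1 := by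
  rw [value_eq_sum hE, Finset.sum_eq_zero, base, add_zero]
  rintro (_ | _ | _ | _ | _ | _) - <;> simp [rowFactor, rowsOf, colFactor, colsOf]

theorem value_unit_zero (hE : E.Nodup) (c : ℕ) : value φ E t x (.unit c) .zero = 0 := by
  rw [value_eq_sum hE, Finset.sum_eq_zero, base, add_zero]
  rintro (_ | _ | _ | _ | _ | _) - <;> simp [rowFactor, rowsOf, colFactor, colsOf, zeroEntry]

theorem value_unit_node (hE : E.Nodup) {c : ℕ} (hc : c < 3) {n : Node R ω} (hn : n ∈ nodes E) :
    value φ E t x (.unit c) (.node n) = if n.2 = 0 then 1 else x (.unitNode c n) := by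
  rw [value_eq_sum hE, base]
  split_ifs with h0
  · rw [Finset.sum_eq_zero, add_zero]
    rintro (_ | _ | _ | _ | _ | _) hi <;>
      simp [rowFactor, rowsOf, colFactor, colsOf, mem_params] at hi ⊢
    grind
  · rw [Finset.sum_eq_single (.unitNode c n), zero_add]
    · simp [rowFactor, rowsOf, colFactor, colsOf]
    · rintro (_ | _ | _ | _ | _ | _) hi hne <;>
        simp [rowFactor, rowsOf, colFactor, colsOf, mem_params] at hi hne ⊢
      grind
    · simp [mem_params]; grind

theorem value_sum_one (hE : E.Nodup) (c f : ℕ) : value φ E t x (.sum c f) .one = 1 := by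
  rw [value_eq_sum hE, Finset.sum_eq_zero, base, add_zero]
  rintro (_ | _ | _ | _ | _ | _) - <;> simp [rowFactor, rowsOf, colFactor, colsOf]

theorem value_sum_node (hE : E.Nodup) {c f : ℕ} (hc : c < 3) (hf : f < t) {n : Node R ω}
    (hn : n ∈ nodes E) :
    value φ E t x (.sum c f) (.node n) = x (.sumNode c f n) := by
  rw [value_eq_sum hE, base, zero_add, Finset.sum_eq_single (.sumNode c f n)]
  · simp [rowFactor, rowsOf, colFactor, colsOf]
  · rintro (_ | _ | _ | _ | _ | _) hi hne <;>
      simp [rowFactor, rowsOf, colFactor, colsOf, mem_params] at hi hne ⊢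
    grind
  · simp [mem_params]; grind

theorem value_sum_zero (hE : E.Nodup) {c f : ℕ} (hc : c < 3) (hf : f < t) :
    value φ E t x (.sum c f) .zero = ∑ m ∈ E.toFinset,
      if m.1.1 = f then x (.sumNode c f (m, m.2.2.length)) * φ m.2.1 else 0 := by
  rw [value_eq_sum hE, base, zero_add]
  symm
  -- In the column `zero`, only the parameters at the final nodes of the monomials of the polynomial
  -- `f` can contribute.
  refine Finset.sum_of_injOn (fun m => Param.sumNode c f (m, m.2.2.length)) ?_ ?_ ?_ ?_
  · exact fun m _ m' _ h => congrArg Prod.fst (Param.sumNode.inj h).2.2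
  · intro m hm
    simp [mem_params, mem_nodes] at hm ⊢; grind
  · rintro (_ | _ | _ | _ | _ | _) hi hne <;>
      simp [rowFactor, rowsOf, colFactor, colsOf, mem_params, zeroEntry, mem_nodes] at hi hne ⊢
    grind
  · intro m hm
    simp [rowFactor, rowsOf, colFactor, colsOf, zeroEntry]
    grind

theorem value_pre_one (hE : E.Nodup) (c : ℕ) (s : Step R ω) :
    value φ E t x (.pre c s) .one = 1 := by
  rw [value_eq_sum hE, Finset.sum_eq_zero, base, add_zero]
  rintro (_ | _ | _ | _ | _ | _) - <;> simp [rowFactor, rowsOf, colFactor, colsOf]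

theorem value_pre_zero (hE : E.Nodup) (c : ℕ) (s : Step R ω) :
    value φ E t x (.pre c s) .zero = 0 := by
  rw [value_eq_sum hE, Finset.sum_eq_zero, base, add_zero]
  rintro (_ | _ | _ | _ | _ | _) - <;> simp [rowFactor, rowsOf, colFactor, colsOf, zeroEntry]

/-- A `link` occupies the four crossings of two rows with two columns. It stands alone at `(pre,
outNode)` and `(var, inNode)`, which are thereby identified. At the other two crossings a free
parameter is added, so that no condition arises there. -/
theorem value_pre_node (hE : E.Nodup) {c : ℕ} (hc : c < 3) {s : Step R ω} (hs : s ∈ steps E)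
    {n : Node R ω} (hn : n ∈ nodes E) :
    value φ E t x (.pre c s) (.node n) = if n = outNode s then x (.link c s) else
      x (.preNode c s n) + if n = inNode s then x (.link c s) else 0 := by
  have hio := inNode_ne_outNode s
  rw [value_eq_sum hE, base, zero_add]
  split_ifs with h h'
  · rw [Finset.sum_eq_single (.link c s)]
    · simp [rowFactor, rowsOf, colFactor, colsOf, h]
    · rintro (_ | _ | _ | _ | _ | _) hi hne <;>
        simp [rowFactor, rowsOf, colFactor, colsOf, mem_params] at hi hne ⊢ <;> grind
    · simp [mem_params]; grind
  · rw [Finset.sum_eq_add_of_mem (.preNode c s n) (.link c s)]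
    · simp [rowFactor, rowsOf, colFactor, colsOf, h']
    · simp [mem_params]; grind
    · simp [mem_params]; grind
    · simp
    · rintro (_ | _ | _ | _ | _ | _) hi hne <;>
        simp [rowFactor, rowsOf, colFactor, colsOf, mem_params] at hi hne ⊢ <;> grind
  · rw [Finset.sum_eq_single (.preNode c s n)]
    · simp [rowFactor, rowsOf, colFactor, colsOf]
    · rintro (_ | _ | _ | _ | _ | _) hi hne <;>
        simp [rowFactor, rowsOf, colFactor, colsOf, mem_params] at hi hne ⊢ <;> grind
    · simp [mem_params]; grind

theorem value_var_one (hE : E.Nodup) {c : ℕ} (hc : c < 3) {s : Step R ω} (hs : s ∈ steps E) :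
    value φ E t x (.var c s) .one = x (.var s.2.1) := by
  rw [value_eq_sum hE, base, zero_add, Finset.sum_eq_single (.var s.2.1)]
  · simp [rowFactor, rowsOf, colFactor, colsOf]; grind
  · rintro (_ | _ | _ | _ | _ | _) hi hne <;>
      simp [rowFactor, rowsOf, colFactor, colsOf, mem_params] at hi hne ⊢
    grind
  · simp [mem_params]; grind

theorem value_var_zero (hE : E.Nodup) (c : ℕ) (s : Step R ω) :
    value φ E t x (.var c s) .zero = 0 := by
  rw [value_eq_sum hE, Finset.sum_eq_zero, base, add_zero]
  rintro (_ | _ | _ | _ | _ | _) - <;> simp [rowFactor, rowsOf, colFactor, colsOf, zeroEntry]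

theorem value_var_node (hE : E.Nodup) {c : ℕ} (hc : c < 3) {s : Step R ω} (hs : s ∈ steps E)
    {n : Node R ω} (hn : n ∈ nodes E) :
    value φ E t x (.var c s) (.node n) = if n = inNode s then x (.link c s) else
      x (.varNode c s n) + if n = outNode s then x (.link c s) else 0 := by
  have hio := inNode_ne_outNode s
  rw [value_eq_sum hE, base, zero_add]
  split_ifs with h h'
  · rw [Finset.sum_eq_single (.link c s)]
    · simp [rowFactor, rowsOf, colFactor, colsOf, h]
    · rintro (_ | _ | _ | _ | _ | _) hi hne <;>
        simp [rowFactor, rowsOf, colFactor, colsOf, mem_params] at hi hne ⊢ <;> grind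
    · simp [mem_params]; grind
  · rw [Finset.sum_eq_add_of_mem (.varNode c s n) (.link c s)]
    · simp [rowFactor, rowsOf, colFactor, colsOf, h']
    · simp [mem_params]; grind
    · simp [mem_params]; grind
    · simp
    · rintro (_ | _ | _ | _ | _ | _) hi hne <;>
        simp [rowFactor, rowsOf, colFactor, colsOf, mem_params] at hi hne ⊢ <;> grind
  · rw [Finset.sum_eq_single (.varNode c s n)]
    · simp [rowFactor, rowsOf, colFactor, colsOf]
    · rintro (_ | _ | _ | _ | _ | _) hi hne <;>
        simp [rowFactor, rowsOf, colFactor, colsOf, mem_params] at hi hne ⊢ <;> grind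
    · simp [mem_params]; grind

end

end Completion

end TensorComplexity


namespace TensorComplexity

namespace Completion

/-! ### Completions of rank one and solutions of the system -/

variable {R ω K : Type*} [DecidableEq R] [DecidableEq ω] [CommRing R] [CommRing K]
  {φ : R →+* K} {E : List (Mono R ω)} {t : ℕ}

theorem mem_cols {q : Col R ω} : q ∈ cols E ↔ match q with
    | .one | .zero => True
    | .node n => n ∈ nodes E := by
  cases q <;> simp [cols]

theorem mem_rows {p : Row R ω} : p ∈ rows E t ↔ match p with
    | .unit c => c < 3
    | .sum c f => c < 3 ∧ f < t
    | .pre c s | .var c s => c < 3 ∧ s ∈ steps E := by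
  cases p <;>
    simp only [rows, List.mem_append, List.mem_flatMap, List.mem_map, List.mem_cons,
      List.mem_range, reduceCtorEq, and_false, exists_false, or_false, false_or,
      Row.unit.injEq, Row.sum.injEq, Row.pre.injEq, Row.var.injEq] <;> grind

/-- The value of an initial segment of a monomial. -/
def prefixValue (y : ω → K) (n : Node R ω) : K := ((n.1.2.2.take n.2).map y).prod

omit [DecidableEq R] [DecidableEq ω] [CommRing R] in
theorem prefixValue_zero (y : ω → K) (m : Mono R ω) : prefixValue y (m, 0) = 1 := by
  simp [prefixValue]

omit [DecidableEq R] [DecidableEq ω] [CommRing R] in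
theorem prefixValue_outNode (y : ω → K) {s : Step R ω} (hs : s ∈ steps E) :
    prefixValue y (outNode s) = y s.2.1 * prefixValue y (inNode s) := by
  obtain ⟨m, w, j⟩ := s
  obtain ⟨hlt, hw⟩ := List.mem_zipIdx' (mem_steps.mp hs).2
  simp only at hlt hw
  rw [mul_comm]
  simp [prefixValue, outNode, inNode, List.take_add_one, List.getElem?_eq_getElem hlt, ← hw]

/-- The equations of the system. -/
def Solves (φ : R →+* K) (E : List (Mono R ω)) (t : ℕ) (y : ω → K) : Prop :=
  ∀ f < t, ∑ m ∈ E.toFinset,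
    (if m.1.1 = f then prefixValue y (m, m.2.2.length) * φ m.2.1 else 0) = 0

/-- The parameters of the completion that belongs to given values of the variables. -/
def assignment (y : ω → K) : Param R ω → K
  | .unitNode _ n => prefixValue y n
  | .sumNode _ _ n => prefixValue y n
  | .preNode _ s n => prefixValue y n - if n = inNode s then prefixValue y (outNode s) else 0
  | .varNode _ s n =>
    y s.2.1 * prefixValue y n - if n = outNode s then prefixValue y (outNode s) else 0
  | .link _ s => prefixValue y (outNode s)
  | .var x => y x

/-- The column vector of the completion of rank one. -/
def rowValue (y : ω → K) : Row R ω → K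
  | .var _ s => y s.2.1
  | _ => 1

/-- The row vector of the completion of rank one. -/
def colValue (y : ω → K) : Col R ω → K
  | .one => 1
  | .zero => 0
  | .node n => prefixValue y n

/-- The terms subtracted in `assignment` cancel `link` at its two superfluous crossings. The
equations of the system are needed only for the rows `sum` in the column `zero`. -/
theorem value_assignment (hE : E.Nodup) {y : ω → K} (hy : Solves φ E t y) {p : Row R ω}
    (hp : p ∈ rows E t) {q : Col R ω} (hq : q ∈ cols E) :
    value φ E t (assignment y) p q = rowValue y p * colValue y q := by
  rw [mem_rows] at hp
  rw [mem_cols] at hq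
  rcases p with c | ⟨c, f⟩ | ⟨c, s⟩ | ⟨c, s⟩ <;> rcases q with _ | _ | n <;>
    simp only [rowValue, colValue, one_mul, mul_one, mul_zero] at *
  · exact value_unit_one hE c
  · exact value_unit_zero hE c
  · rw [value_unit_node hE hp hq]
    split_ifs with h
    · obtain ⟨m, j⟩ := n
      simp only at h
      rw [h, prefixValue_zero]
    · rfl
  · exact value_sum_one hE c f
  · rw [value_sum_zero hE hp.1 hp.2]
    exact hy f hp.2
  · exact value_sum_node hE hp.1 hp.2 hq
  · exact value_pre_one hE c s
  · exact value_pre_zero hE c s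
  · rw [value_pre_node hE hp.1 hp.2 hq]
    simp only [assignment]
    split_ifs with h h' <;> simp [h]
  · rw [value_var_one hE hp.1 hp.2]
    rfl
  · exact value_var_zero hE c s
  · rw [value_var_node hE hp.1 hp.2 hq]
    simp only [assignment]
    split_ifs with h h' <;> simp [h, prefixValue_outNode y hp.2]

/-- The rank-two minors vanish on the rows and columns in use. -/
def MinorsVanishOn (φ : R →+* K) (E : List (Mono R ω)) (t : ℕ) (x : Param R ω → K) : Prop :=
  ∀ p ∈ rows E t, ∀ p' ∈ rows E t, ∀ q ∈ cols E, ∀ q' ∈ cols E,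
    value φ E t x p q * value φ E t x p' q' = value φ E t x p q' * value φ E t x p' q

theorem assignment_of_minorsVanishOn (hE : E.Nodup) {x : Param R ω → K}
    (hx : MinorsVanishOn φ E t x) :
    (∀ i ∈ params E t, x i = assignment (fun w => x (.var w)) i) ∧
      Solves φ E t fun w => x (.var w) := by
  set y : ω → K := fun w => x (.var w) with hy
  -- The entry at `unit 0`, `one` is 1, so the minors through it write the matrix as the product of
  -- a column and a row.
  have key : ∀ p ∈ rows E t, ∀ q ∈ cols E,
      value φ E t x p q = value φ E t x p .one * value φ E t x (.unit 0) q := fun p hp q hq => by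
    have := hx p hp (.unit 0) (mem_rows.mpr (by simp)) q hq .one (mem_cols.mpr trivial)
    rwa [value_unit_one hE, mul_one] at this
  -- Induction along the monomial: the common parameter `link` of the rows `pre` and `var` equates
  -- the value after the step with the variable times the value before it.
  have hunit : ∀ n ∈ nodes E, value φ E t x (.unit 0) (.node n) = prefixValue y n := by
    rintro ⟨m, j⟩ hn
    induction j with
    | zero => rw [value_unit_node hE (by simp) hn, prefixValue_zero, if_pos rfl]
    | succ j ih =>
      obtain ⟨hm, hj⟩ := mem_nodes.mp hn
      simp only at hm hj
      let s : Step R ω := (m, m.2.2[j], j)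
      have hs : s ∈ steps E := mem_steps.mpr ⟨hm, by
        simp only [s]
        rw [List.mem_zipIdx_iff_getElem?]
        simp only
        exact List.getElem?_eq_getElem hj⟩
      have hin := inNode_mem hs
      have h1 := key (.pre 0 s) (mem_rows.mpr ⟨by simp, hs⟩) (.node (outNode s))
        (mem_cols.mpr hn)
      have h2 := key (.var 0 s) (mem_rows.mpr ⟨by simp, hs⟩) (.node (inNode s)) (mem_cols.mpr hin)
      rw [value_pre_node hE (by simp) hs (outNode_mem hs), if_pos rfl, value_pre_one hE, one_mul] at h1
      rw [value_var_node hE (by simp) hs hin, if_pos rfl, h1, value_var_one hE (by simp) hs]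
        at h2
      have h3 : value φ E t x (.unit 0) (.node (inNode s)) = prefixValue y (inNode s) := ih hin
      rw [h3] at h2
      exact h2.trans (prefixValue_outNode y hs).symm
  have hrow : ∀ p ∈ rows E t, ∀ n ∈ nodes E,
      value φ E t x p (.node n) = value φ E t x p .one * prefixValue y n := fun p hp n hn => by
    rw [key p hp _ (mem_cols.mpr hn), hunit n hn]
  have hlink : ∀ c < 3, ∀ s ∈ steps E, x (.link c s) = prefixValue y (outNode s) := by
    intro c hc s hs
    have h := hrow (.pre c s) (mem_rows.mpr ⟨hc, hs⟩) _ (outNode_mem hs)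
    rwa [value_pre_one hE, one_mul, value_pre_node hE hc hs (outNode_mem hs), if_pos rfl] at h
  have hsum : ∀ c < 3, ∀ f < t, ∀ n ∈ nodes E, x (.sumNode c f n) = prefixValue y n := by
    intro c hc f hf n hn
    have h := hrow (.sum c f) (mem_rows.mpr ⟨hc, hf⟩) n hn
    rwa [value_sum_one hE, one_mul, value_sum_node hE hc hf hn] at h
  refine ⟨fun i hi => ?_, fun f hf => ?_⟩
  · rw [mem_params] at hi
    rcases i with ⟨c, n⟩ | ⟨c, f, n⟩ | ⟨c, s, n⟩ | ⟨c, s, n⟩ | ⟨c, s⟩ | w <;>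
      simp only [assignment] at *
    · have h := hrow (.unit c) (mem_rows.mpr hi.1) n hi.2.1
      rwa [value_unit_one hE, one_mul, value_unit_node hE hi.1 hi.2.1, if_neg hi.2.2] at h
    · exact hsum c hi.1 f hi.2.1 n hi.2.2
    · obtain ⟨hc, hs, hn, hne⟩ := hi
      have h := hrow (.pre c s) (mem_rows.mpr ⟨hc, hs⟩) n hn
      rw [value_pre_one hE, one_mul, value_pre_node hE hc hs hn, if_neg hne, hlink c hc s hs] at h
      exact eq_sub_of_add_eq h
    · obtain ⟨hc, hs, hn, hne⟩ := hi
      have h := hrow (.var c s) (mem_rows.mpr ⟨hc, hs⟩) n hn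
      rw [value_var_one hE hc hs, value_var_node hE hc hs hn, if_neg hne, hlink c hc s hs] at h
      exact eq_sub_of_add_eq h
    · exact hlink c hi.1 s hi.2
    · rfl
  -- The row `unit 0` vanishes in the column `zero`, hence so does the row `sum`, whose entry there
  -- is the value of the polynomial.
  · have h := key (.sum 0 f) (mem_rows.mpr ⟨by simp, hf⟩) .zero (mem_cols.mpr trivial)
    rw [value_unit_zero hE, mul_zero, value_sum_zero hE (by simp) hf] at h
    refine Eq.trans (Finset.sum_congr rfl fun m hm => ?_) h
    rw [hsum 0 (by simp) f hf _ (mem_nodes.mpr ⟨List.mem_toFinset.mp hm, le_rfl⟩)]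

/-- Different completions of rank at most one differ in three parameters whose row factors are
independent. -/
theorem exists_three_params (hE : E.Nodup) {x x' : Param R ω → K}
    (hx : MinorsVanishOn φ E t x) (hx' : MinorsVanishOn φ E t x')
    (hne : ∃ i ∈ params E t, x i ≠ x' i) :
    ∃ (i : ℕ → Param R ω) (r : ℕ → Row R ω), ∀ c < 3, i c ∈ params E t ∧ r c ∈ rows E t ∧
      x (i c) ≠ x' (i c) ∧ ∀ d, rowFactor K E (i c) (r d) = if d = c then 1 else 0 := by
  obtain ⟨ha, -⟩ := assignment_of_minorsVanishOn hE hx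
  obtain ⟨ha', -⟩ := assignment_of_minorsVanishOn hE hx'
  set y : ω → K := fun w => x (.var w)
  set y' : ω → K := fun w => x' (.var w)
  by_cases hnode : ∃ n ∈ nodes E, prefixValue y n ≠ prefixValue y' n
  -- A segment with two different values is nonempty, so each of the three `unit` rows has a
  -- parameter of its own for it.
  · obtain ⟨⟨m, j⟩, hn, hne⟩ := hnode
    have hj : j ≠ 0 := by
      rintro rfl
      simp [prefixValue_zero] at hne
    refine ⟨fun c => .unitNode c (m, j), fun c => .unit c, fun c hc => ?_⟩
    have hi : Param.unitNode c (m, j) ∈ params E t := mem_params.mpr ⟨hc, hn, hj⟩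
    refine ⟨hi, mem_rows.mpr hc, ?_, fun d => ?_⟩
    · rw [ha _ hi, ha' _ hi]
      exact hne
    · simp [rowFactor, rowsOf]
  push Not at hnode
  by_cases hvar : ∃ s ∈ steps E, y s.2.1 ≠ y' s.2.1
  · obtain ⟨s, hs, hne⟩ := hvar
    -- The node behind a first occurrence has the value of the variable itself, and all node values
    -- agree here.
    have h0 : s.2.2 ≠ 0 := by
      intro h0
      have h1 := hnode _ (outNode_mem hs)
      rw [prefixValue_outNode y hs, prefixValue_outNode y' hs, inNode, h0, prefixValue_zero,
        prefixValue_zero, mul_one, mul_one] at h1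
      exact hne h1
    -- A parameter `var` is shared by the three copies and thus yields only one direction. The
    -- column of the empty segment shows the value of the variable in each copy separately; it is
    -- neither `inNode s` nor `outNode s`, so `varNode` there equals this value.
    have hn : ((s.1, 0) : Node R ω) ∈ nodes E :=
      mem_nodes.mpr ⟨(mem_steps.mp hs).1, Nat.zero_le _⟩
    refine ⟨fun c => .varNode c s (s.1, 0), fun c => .var c s, fun c hc => ?_⟩
    have hi : Param.varNode c s (s.1, 0) ∈ params E t :=
      mem_params.mpr ⟨hc, hs, hn, by simpa [inNode] using h0.symm⟩
    refine ⟨hi, mem_rows.mpr ⟨hc, hs⟩, ?_, fun d => ?_⟩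
    · rw [ha _ hi, ha' _ hi]
      simpa [assignment, outNode, prefixValue_zero] using hne
    · simp [rowFactor, rowsOf]
  push Not at hvar
  obtain ⟨i, hi, hne⟩ := hne
  refine absurd ?_ hne
  rw [ha i hi, ha' i hi]
  rw [mem_params] at hi
  rcases i with ⟨c, n⟩ | ⟨c, f, n⟩ | ⟨c, s, n⟩ | ⟨c, s, n⟩ | ⟨c, s⟩ | w <;>
    simp only [assignment] at *
  · exact hnode n hi.2.1
  · exact hnode n hi.2.2
  · rw [hnode n hi.2.2.1, hnode _ (outNode_mem hi.2.1)]
  · rw [hnode n hi.2.2.1, hnode _ (outNode_mem hi.2.1), hvar s hi.2.1]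
  · exact hnode _ (outNode_mem hi.2)
  · obtain ⟨s, hs, rfl⟩ := hi
    exact hvar s hs

theorem exists_rowFactor_eq_one {i : Param R ω} (hi : i ∈ params E t) :
    ∃ p ∈ rows E t, rowFactor K E i p = 1 := by
  rw [mem_params] at hi
  rcases i with ⟨c, n⟩ | ⟨c, f, n⟩ | ⟨c, s, n⟩ | ⟨c, s, n⟩ | ⟨c, s⟩ | w
  · exact ⟨.unit c, mem_rows.mpr hi.1, by simp [rowFactor, rowsOf]⟩
  · exact ⟨.sum c f, mem_rows.mpr ⟨hi.1, hi.2.1⟩, by simp [rowFactor, rowsOf]⟩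
  · exact ⟨.pre c s, mem_rows.mpr ⟨hi.1, hi.2.1⟩, by simp [rowFactor, rowsOf]⟩
  · exact ⟨.var c s, mem_rows.mpr ⟨hi.1, hi.2.1⟩, by simp [rowFactor, rowsOf]⟩
  · exact ⟨.pre c s, mem_rows.mpr hi, by simp [rowFactor, rowsOf]⟩
  · obtain ⟨s, hs, rfl⟩ := hi
    exact ⟨.var 0 s, mem_rows.mpr ⟨by simp, hs⟩, by simp [rowFactor, rowsOf]; grind⟩

end Completion

end TensorComplexity


namespace TensorComplexity

/-! ### Rank bounds as equations -/

theorem Tensor.IsSumOfSimple.mono {S : Type*} [CommRing S] {l m n r s : ℕ} {T : Tensor S l m n}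
    (h : T.IsSumOfSimple r) (hrs : r ≤ s) : T.IsSumOfSimple s := by
  induction s, hrs using Nat.le_induction with
  | base => exact h
  | succ s _ ih =>
    obtain ⟨V, hV, hT⟩ := ih
    refine ⟨Fin.snoc V 0, fun q => ?_, ?_⟩
    · refine Fin.lastCases ?_ (fun q => ?_) q
      · rw [Fin.snoc_last]
        exact ⟨0, 0, 0, by ext; simp⟩
      · rw [Fin.snoc_castSucc]
        exact hV q
    · simp [Fin.sum_univ_castSucc, hT]

theorem Tensor.rank_le_iff {S : Type*} [CommRing S] {l m n r : ℕ} {T : Tensor S l m n} :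
    T.rank ≤ r ↔ ∃ (a : Fin r → Fin l → S) (b : Fin r → Fin m → S) (c : Fin r → Fin n → S),
      ∀ i j k, T i j k = ∑ q, a q i * b q j * c q k := by
  constructor
  · intro h
    obtain ⟨V, hV, hT⟩ := Tensor.IsSumOfSimple.mono (Nat.sInf_mem T.exists_isSumOfSimple) h
    choose a b c hV using hV
    refine ⟨a, b, c, fun i j k => ?_⟩
    rw [hT]
    simp [Finset.sum_apply, hV]
  · rintro ⟨a, b, c, h⟩
    refine Nat.sInf_le ⟨fun q i j k => a q i * b q j * c q k, fun q => ⟨a q, b q, c q, rfl⟩, ?_⟩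
    ext i j k
    simp [Finset.sum_apply, h]

/-! ### The tensor of a polynomial system -/

namespace Completion

open Module

variable {R ω : Type*} [DecidableEq R] [DecidableEq ω] [CommRing R]

section

variable {K : Type*} [CommRing K] (φ : R →+* K) (E : List (Mono R ω)) (t : ℕ)

/-- The constant part, as a matrix. -/
def baseMatrix (p : Fin (rows E t).length) (q : Fin (cols E).length) : K :=
  base ((rows E t).get p) ((cols E).get q)

/-- The row factors, as vectors. -/
def rowMatrix (i : Fin (params E t).length) (p : Fin (rows E t).length) : K :=
  rowFactor K E ((params E t).get i) ((rows E t).get p)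

/-- The column factors, as vectors. -/
def colMatrix (i : Fin (params E t).length) (q : Fin (cols E).length) : K :=
  colFactor φ ((params E t).get i) ((cols E).get q)

theorem map_completionTensor {L : Type*} [CommRing L] (ψ : K →+* L)
    (r : Fin (rows E t).length ⊕ Fin (params E t).length)
    (s : Fin (cols E).length ⊕ Fin (params E t).length) (l : Option (Fin (params E t).length)) :
    ψ (completionTensor (baseMatrix E t) (rowMatrix E t) (colMatrix φ E t) r s l) =
      completionTensor (baseMatrix E t) (rowMatrix E t) (colMatrix (ψ.comp φ) E t) r s l := by
  have hb : ∀ p q, ψ (baseMatrix E t p q) = baseMatrix E t p q := fun p q => by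
    simp only [baseMatrix]
    rcases (rows E t).get p with c | ⟨c, f⟩ | ⟨c, s⟩ | ⟨c, s⟩ <;>
      rcases (cols E).get q with _ | _ | n <;> simp [base, apply_ite ψ]
  have hr : ∀ i p, ψ (rowMatrix E t i p) = rowMatrix E t i p := fun i p => by
    simp [rowMatrix, rowFactor, apply_ite ψ]
  have hc : ∀ i p, ψ (colMatrix φ E t i p) = colMatrix (ψ.comp φ) E t i p := fun i p => by
    simp [colMatrix, colFactor, apply_ite ψ]
  rcases r with r | r <;> rcases s with s | s <;> rcases l with _ | l <;>
    simp [completionTensor, hb, hr, hc, apply_ite ψ]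

theorem completion_eq_value (x : Param R ω → K) (p : Fin (rows E t).length)
    (q : Fin (cols E).length) :
    completion (baseMatrix E t) (rowMatrix E t) (colMatrix φ E t)
      (fun i => x ((params E t).get i)) p q =
      value φ E t x ((rows E t).get p) ((cols E).get q) := by
  rw [completion, value]
  congr 1
  exact Fin.sum_univ_fun_getElem (params E t)
    fun i => x i * (rowFactor K E i ((rows E t).get p) * colFactor φ i ((cols E).get q))

end

section

variable {K : Type*} [Field K] {φ : R →+* K} {E : List (Mono R ω)} {t : ℕ}

theorem minorsVanishOn_of_minorsVanish {x : Param R ω → K}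
    (h : MinorsVanish (completion (baseMatrix E t) (rowMatrix E t) (colMatrix φ E t)
      (fun i => x ((params E t).get i)))) : MinorsVanishOn φ E t x := by
  intro p hp p' hp' q hq q' hq'
  obtain ⟨p, rfl⟩ := List.get_of_mem hp
  obtain ⟨p', rfl⟩ := List.get_of_mem hp'
  obtain ⟨q, rfl⟩ := List.get_of_mem hq
  obtain ⟨q', rfl⟩ := List.get_of_mem hq'
  simpa only [completion_eq_value] using h p p' q q'

theorem exists_extension (hE : E.Nodup) {S : Type*} [Zero S] (x : Fin (params E t).length → S) :
    ∃ x' : Param R ω → S, x = fun i => x' ((params E t).get i) :=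
  ⟨Function.extend (params E t).get x 0, funext fun i =>
    ((List.nodup_iff_injective_get.mp (nodup_params hE)).extend_apply x 0 i).symm⟩

/-- If `x ≠ x'`, the three parameters of `exists_three_params` yield three vectors that are diagonal
with nonzero diagonal at the rows `r 0`, `r 1`, `r 2`, too many for two dimensions. -/
theorem eq_of_finrank_le_two (hE : E.Nodup) (x x' : Fin (params E t).length → K)
    (hx : MinorsVanish (completion (baseMatrix E t) (rowMatrix E t) (colMatrix φ E t) x))
    (hx' : MinorsVanish (completion (baseMatrix E t) (rowMatrix E t) (colMatrix φ E t) x'))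
    (h : finrank K (Submodule.span K (Set.range fun i => (x i - x' i) •
      (rowMatrix E t i : Fin (rows E t).length → K))) ≤ 2) : x = x' := by
  obtain ⟨x, rfl⟩ := exists_extension hE x
  obtain ⟨x', rfl⟩ := exists_extension hE x'
  by_contra hne
  obtain ⟨i₀, hi₀⟩ := Function.ne_iff.mp hne
  obtain ⟨i, r, hir⟩ := exists_three_params hE (minorsVanishOn_of_minorsVanish hx)
    (minorsVanishOn_of_minorsVanish hx') ⟨_, List.get_mem _ i₀, hi₀⟩
  have h1 : ∀ c : Fin 3, ∃ j, (params E t).get j = i c := fun c =>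
    List.get_of_mem (hir c c.2).1
  have h2 : ∀ c : Fin 3, ∃ p, (rows E t).get p = r c := fun c =>
    List.get_of_mem (hir c c.2).2.1
  choose j hj using h1
  choose p hp using h2
  let w : Fin 3 → Fin (rows E t).length → K := fun c =>
    (x ((params E t).get (j c)) - x' ((params E t).get (j c))) • rowMatrix E t (j c)
  have hw : ∀ c d, w c (p d) = if d = c then x (i c) - x' (i c) else 0 := fun c d => by
    simp only [w, Pi.smul_apply, rowMatrix, hj, hp, (hir c c.2).2.2.2, smul_eq_mul, Fin.val_inj,
      mul_ite, mul_one, mul_zero]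
  have hli : LinearIndependent K w := by
    rw [Fintype.linearIndependent_iff]
    intro g hg d
    have := congrFun hg (p d)
    simp only [Finset.sum_apply, Pi.smul_apply, hw, smul_eq_mul, mul_ite, mul_zero,
      Finset.sum_ite_eq, Finset.mem_univ, if_true, Pi.zero_apply, mul_eq_zero] at this
    exact this.resolve_right (sub_ne_zero.mpr (hir d d.2).2.2.1)
  have h3 := finrank_span_eq_card hli
  have h4 : Submodule.span K (Set.range w) ≤ Submodule.span K (Set.range fun i =>
      (x ((params E t).get i) - x' ((params E t).get i)) •
        (rowMatrix E t i : Fin (rows E t).length → K)) :=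
    Submodule.span_mono (by rintro _ ⟨c, rfl⟩; exact ⟨j c, rfl⟩)
  have := Submodule.finrank_mono h4
  rw [h3, Fintype.card_fin] at this
  exact absurd (this.trans h) (by norm_num)

end

/-- The tensor whose rank decides whether the system is solvable. -/
def tensor (E : List (Mono R ω)) (t : ℕ) :
    Tensor R ((rows E t).length + (params E t).length) ((cols E).length + (params E t).length)
      ((params E t).length + 1) := fun i j l =>
  completionTensor (baseMatrix E t) (rowMatrix E t) (colMatrix (RingHom.id R) E t)
    (finSumFinEquiv.symm i) (finSumFinEquiv.symm j) (finSuccEquiv _ l)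

theorem solves_map {S K : Type*} [CommRing S] [CommRing K] {φ : R →+* S} {ψ : S →+* K}
    (hψ : Function.Injective ψ) {E : List (Mono R ω)} {t : ℕ} {y : ω → S}
    (h : Solves (ψ.comp φ) E t fun w => ψ (y w)) : Solves φ E t y := by
  intro f hf
  refine hψ ?_
  rw [map_zero, map_sum, ← h f hf]
  refine Finset.sum_congr rfl fun m _ => ?_
  have : ∀ n : Node R ω, ψ (prefixValue y n) = prefixValue (fun w => ψ (y w)) n := fun n => by
    simp [prefixValue, map_list_prod, Function.comp_def]
  simp [apply_ite ψ, this]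

/-- Given a decomposition over `S`, the linear algebra takes place in the fraction field. Given a
solution, its rank-one completion is written down over `S` directly. -/
theorem rankOver_tensor_le_iff (S : Type*) [CommRing S] [IsDomain S] [Algebra R S]
    {E : List (Mono R ω)} (hE : E.Nodup) (t : ℕ) :
    (tensor E t).rankOver S ≤ 2 * (params E t).length + 1 ↔
      ∃ y : ω → S, Solves (algebraMap R S) E t y := by
  rw [Tensor.rankOver, Tensor.rank_le_iff]
  constructor
  · rintro ⟨a, b, c, hT⟩
    let K := FractionRing S
    let ψ : S →+* K := algebraMap S K
    have hψ : Function.Injective ψ := IsFractionRing.injective S K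
    have hT' : ∀ r s l, completionTensor (baseMatrix E t) (rowMatrix E t)
        (colMatrix (ψ.comp (algebraMap R S)) E t) r s l =
        ∑ q, ψ (a q (finSumFinEquiv r)) * ψ (b q (finSumFinEquiv s)) *
          ψ (c q ((finSuccEquiv _).symm l)) := fun r s l => by
      have := congrArg ψ (hT (finSumFinEquiv r) (finSumFinEquiv s) ((finSuccEquiv _).symm l))
      rw [tensor, Equiv.symm_apply_apply, Equiv.symm_apply_apply, Equiv.apply_symm_apply,
        map_completionTensor, map_completionTensor, RingHom.comp_id] at this
      rw [this]
      simp
    have hrow : ∀ i, ∃ p, (rowMatrix E t i p : K) = 1 := fun i => by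
      obtain ⟨p, hp, h⟩ := exists_rowFactor_eq_one (K := K) (List.get_mem (params E t) i)
      obtain ⟨p, rfl⟩ := List.get_of_mem hp
      exact ⟨p, h⟩
    have hne : ∀ x, ∃ p q, completion (baseMatrix E t) (rowMatrix E t)
        (colMatrix (ψ.comp (algebraMap R S)) E t) x p q ≠ 0 := fun x => by
      obtain ⟨x, rfl⟩ := exists_extension hE x
      obtain ⟨p, hp⟩ := List.get_of_mem (mem_rows.mpr (by simp) : Row.unit 0 ∈ rows E t)
      obtain ⟨q, hq⟩ := List.get_of_mem (mem_cols.mpr trivial : Col.one ∈ cols E)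
      refine ⟨p, q, ?_⟩
      rw [completion_eq_value, hp, hq, value_unit_one hE]
      exact one_ne_zero
    -- The decomposition has its entries in the subring `ψ.range`, so the parameters lie there as
    -- well and come from `S`.
    obtain ⟨x, hxS, hx⟩ := exists_minorsVanish hT' (by simp) hrow hne
      (eq_of_finrank_le_two hE) ψ.range
      (fun q r => ⟨_, rfl⟩) (fun q r => ⟨_, rfl⟩) (fun q r => ⟨_, rfl⟩)
    choose x' hx' using hxS
    obtain ⟨z, rfl⟩ := exists_extension hE x'
    obtain rfl : (fun i => ψ (z ((params E t).get i))) = x := funext hx'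
    exact ⟨fun w => z (.var w), solves_map hψ (assignment_of_minorsVanishOn hE
      (minorsVanishOn_of_minorsVanish (x := fun i => ψ (z i)) hx)).2⟩
  · rintro ⟨y, hy⟩
    obtain ⟨α, β, γ, h⟩ := completionTensor_eq_sum (A := baseMatrix E t) (u := rowMatrix E t)
      (v := colMatrix (algebraMap R S) E t) (fun i => assignment y ((params E t).get i))
      (fun p => rowValue y ((rows E t).get p)) (fun q => colValue y ((cols E).get q))
      (fun p q => by
        rw [completion_eq_value, value_assignment hE hy (List.get_mem _ _) (List.get_mem _ _)])
    let e : Fin (2 * (params E t).length + 1) ≃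
        Option (Fin (params E t).length ⊕ Fin (params E t).length) :=
      (Fintype.equivFinOfCardEq (by simp [two_mul])).symm
    refine ⟨fun q i => α (e q) (finSumFinEquiv.symm i), fun q i => β (e q) (finSumFinEquiv.symm i),
      fun q i => γ (e q) (finSuccEquiv _ i), fun i j k => ?_⟩
    rw [tensor, map_completionTensor, RingHom.comp_id, h,
      e.sum_comp fun q => α q (finSumFinEquiv.symm i) * β q (finSumFinEquiv.symm j) *
        γ q (finSuccEquiv _ k)]

end Completion

end TensorComplexity


namespace TensorComplexity

open Code

/-! ### Printing -/

/-- A list of letters as a word. -/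
def toStr {Γ : Type} (l : List (Letter Γ)) : Str Γ := l

/-- A number, printed in binary. -/
def numStr {Γ : Type} (n : ℕ) : Str Γ := encodeNum n

/-- A ring element, printed with its terminator. -/
def eltStr {Γ : Type} {R : Type*} [Code Γ R] (a : R) : Str Γ :=
  List.append (enc a) [.endElt]

/-- Concatenation of words. -/
def joinStr {Γ : Type} (l : List (Str Γ)) : Str Γ := List.flatten l

namespace PT

variable {Γ : Type} {α β : Type*} [Code Γ α] [Code Γ β]

@[fun_prop] theorem joinStr {f : α → List (Str Γ)} (hf : PT Γ f) :
    PT Γ (fun a => joinStr (f a)) :=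
  PolyTime.comp (PolyTime.flatten (Γ := Γ)) hf

theorem singletons {f : α → List (Letter Γ)} (hf : PT Γ f) :
    PT (β := List (Str Γ)) Γ (fun a => (f a).map fun c => TensorComplexity.toStr [c]) :=
  of_enc hf fun a => by
    show listEnc _ _ = listEnc _ _
    induction f a with
    | nil => rfl
    | cons c l ih => rw [List.map_cons, listEnc_cons, listEnc_cons, ih]; rfl

@[fun_prop] theorem toStr {f : α → List (Letter Γ)} (hf : PT Γ f) : PT Γ (fun a => toStr (f a)) :=
  of_enc (singletons hf).joinStr fun a => by
    show f a = List.flatten ((f a).map fun c => ([c] : List (Letter Γ)))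
    induction f a with
    | nil => rfl
    | cons c l ih => rw [List.map_cons, List.flatten_cons, ← ih]; rfl

theorem encStr {f : α → β} (hf : PT Γ f) :
    PT (β := Str Γ) Γ (fun a => (enc (Γ := Γ) (f a) : List (Letter Γ))) :=
  of_enc hf fun _ => rfl

@[fun_prop] theorem bit {f : α → Bool} (hf : PT Γ f) : PT Γ (fun a => (Letter.bit (f a) : Letter Γ)) :=
  of_enc (f' := fun a => bif f a then (Letter.bit true : Letter Γ) else Letter.bit false)
    (by fun_prop) fun a => by cases f a <;> rfl

@[fun_prop] theorem numStr {f : α → ℕ} (hf : PT Γ f) :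
    PT Γ (fun a => (numStr (f a) : Str Γ)) :=
  strAppend (f := fun a => TensorComplexity.toStr ((f a).bits.map
    fun b => (Letter.bit b : Letter Γ))) (by fun_prop) (const' (β := Str Γ) [Letter.endNum])

@[fun_prop] theorem eltStr {f : α → β} (hf : PT Γ f) :
    PT Γ (fun a => (eltStr (f a) : Str Γ)) :=
  strAppend hf.encStr (const' _)

end PT

/-! ### Codes of the labels of the completion problem -/

section Labels

variable {Γ : Type} {R ω : Type*}

/-- Rows as tuples. -/
def Row.toTuple : Row R ω → (ℕ × ℕ × ℕ) × List (Step R ω)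
  | .unit c => ((0, c, 0), [])
  | .sum c f => ((1, c, f), [])
  | .pre c s => ((2, c, 0), [s])
  | .var c s => ((3, c, 0), [s])

/-- Columns as tuples. -/
def Col.toTuple : Col R ω → ℕ × List (Node R ω)
  | .one => (0, [])
  | .zero => (1, [])
  | .node n => (2, [n])

theorem Row.toTuple_injective : Function.Injective (Row.toTuple (R := R) (ω := ω)) := by
  rintro (_ | _ | _ | _) (_ | _ | _ | _) h <;> simp_all [Row.toTuple]

theorem Col.toTuple_injective : Function.Injective (Col.toTuple (R := R) (ω := ω)) := by
  rintro (_ | _ | _) (_ | _ | _) h <;> simp_all [Col.toTuple]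

variable [Code Γ R] [Code Γ ω]

instance : Code Γ (Row R ω) := ⟨fun p => enc p.toTuple⟩
instance : Code Γ (Col R ω) := ⟨fun p => enc p.toTuple⟩
instance [InjCode Γ R] [InjCode Γ ω] : InjCode Γ (Row R ω) :=
  ⟨fun _ _ h => Row.toTuple_injective (InjCode.inj (Γ := Γ) h)⟩
instance [InjCode Γ R] [InjCode Γ ω] : InjCode Γ (Col R ω) :=
  ⟨fun _ _ h => Col.toTuple_injective (InjCode.inj (Γ := Γ) h)⟩

end Labels

namespace PT

variable {Γ : Type} {α R ω : Type*} [Code Γ α] [Code Γ R] [Code Γ ω]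

@[fun_prop] theorem rowTuple {f : α → Row R ω} (hf : PT Γ f) : PT Γ (fun a => (f a).toTuple) :=
  of_enc hf fun _ => rfl

@[fun_prop] theorem colTuple {f : α → Col R ω} (hf : PT Γ f) : PT Γ (fun a => (f a).toTuple) :=
  of_enc hf fun _ => rfl

@[fun_prop] theorem rowUnit {f : α → ℕ} (hf : PT Γ f) : PT Γ (fun a => (.unit (f a) : Row R ω)) :=
  of_enc (f' := fun a => ((0, f a, 0), ([] : List (Step R ω)))) (by fun_prop) fun _ => rfl

@[fun_prop] theorem rowSum {f g : α → ℕ} (hf : PT Γ f) (hg : PT Γ g) :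
    PT Γ (fun a => (.sum (f a) (g a) : Row R ω)) :=
  of_enc (f' := fun a => ((1, f a, g a), ([] : List (Step R ω)))) (by fun_prop) fun _ => rfl

@[fun_prop] theorem rowPre {f : α → ℕ} {g : α → Step R ω} (hf : PT Γ f) (hg : PT Γ g) :
    PT Γ (fun a => (.pre (f a) (g a) : Row R ω)) :=
  of_enc (f' := fun a => ((2, f a, 0), [g a])) (by fun_prop) fun _ => rfl

@[fun_prop] theorem rowVar {f : α → ℕ} {g : α → Step R ω} (hf : PT Γ f) (hg : PT Γ g) :
    PT Γ (fun a => (.var (f a) (g a) : Row R ω)) :=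
  of_enc (f' := fun a => ((3, f a, 0), [g a])) (by fun_prop) fun _ => rfl

@[fun_prop] theorem colNode {g : α → Node R ω} (hg : PT Γ g) :
    PT Γ (fun a => (.node (g a) : Col R ω)) :=
  of_enc (f' := fun a => (2, [g a])) (by fun_prop) fun _ => rfl

end PT

namespace Completion

/-! ### Printing the tensor -/

variable {R ω : Type*}

/-- The monomials of a system, tagged. -/
def monos (F : List (List (R × List ω))) : List (Mono R ω) :=
  F.zipIdx.flatMap fun P => P.1.zipIdx.map fun M => ((P.2, M.2), M.1)

variable [DecidableEq R] [DecidableEq ω] [CommRing R]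

/-- The factors of the parameters, written out. -/
def paramData (E : List (Mono R ω)) (t : ℕ) : List (List (Row R ω) × List (Col R ω) × R) :=
  (params E t).map fun i => (rowsOf E i, colsOf i, zeroEntry i)

/-- The row factor of a parameter. -/
def dataRow (M : List (Row R ω) × List (Col R ω) × R) (p : Row R ω) : R :=
  if p ∈ M.1 then 1 else 0

/-- The product of the row and column factors of a parameter. -/
def dataEntry (M : List (Row R ω) × List (Col R ω) × R) (p : Row R ω) (q : Col R ω) : R :=
  if p ∈ M.1 then (if q ∈ M.2.1 then 1 else if q = .zero then M.2.2 else 0) else 0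

/-- Expressed by tests on tuples, the constant part is visibly computable from the codes of the
labels. -/
theorem base_eq (p : Row R ω) (q : Col R ω) : (base p q : R) =
    if (¬ p.toTuple.1.1 = 3 ∧ q.toTuple.1 = 0) ∨ (p.toTuple.1.1 = 0 ∧ q.toTuple.2.map Prod.snd = [0])
    then 1 else 0 := by
  rcases p with c | ⟨c, f⟩ | ⟨c, s⟩ | ⟨c, s⟩ <;> rcases q with _ | _ | n <;>
    simp [base, Row.toTuple, Col.toTuple]

/-- Parameters themselves receive no code. The list of their row supports, column supports and zero
entries is generated directly instead. -/
theorem paramData_eq (E : List (Mono R ω)) (t : ℕ) : paramData E t =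
    ((List.range 3).flatMap fun c =>
      ((nodes E).filter (fun n => n.2 ≠ 0)).map (fun n => ([.unit c], [.node n], 0)) ++
      (((List.range t).flatMap fun f => (nodes E).map fun n => ([.sum c f], [.node n],
        if n.1.1.1 = f ∧ n.2 = n.1.2.2.length then n.1.2.1 else 0)) ++
      (((steps E).flatMap fun s => ((nodes E).filter (fun n => n ≠ outNode s)).map
        fun n => ([.pre c s], [.node n], 0)) ++
      (((steps E).flatMap fun s => ((nodes E).filter (fun n => n ≠ inNode s)).map
        fun n => ([.var c s], [.node n], 0)) ++
      (steps E).map fun s => ([.pre c s, .var c s], [.node (inNode s), .node (outNode s)], 0))))) ++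
    (distinct ((steps E).map fun s => s.2.1)).map fun x =>
      (((steps E).filter fun s => s.2.1 = x).flatMap fun s => (List.range 3).map fun c =>
        .var c s, [.one], 0) := by
  simp only [paramData, params, List.map_append, List.map_flatMap, List.map_map]
  rfl

/-- The entries in the rows of the completion problem. -/
def upperEntries (V : List (Col R ω)) (D : List (List (Row R ω) × List (Col R ω) × R))
    (p : Row R ω) : List R :=
  (V.flatMap fun q => base p q :: D.map fun M => dataEntry M p q) ++
  (List.range D.length).flatMap fun j =>
    0 :: D.zipIdx.map fun M => if M.2 = j then dataRow M.1 p else 0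

/-- The entries in the additional rows. -/
def lowerEntries (V : List (Col R ω)) (D : List (List (Row R ω) × List (Col R ω) × R))
    (i : ℕ) : List R :=
  (V.flatMap fun _ => 0 :: D.map fun _ => 0) ++
  (List.range D.length).flatMap fun j => (if i = j then 1 else 0) :: D.map fun _ => 0

/-- The entries of the tensor in lexicographic order. -/
def entries (E : List (Mono R ω)) (t : ℕ) : List R :=
  (rows E t).flatMap (upperEntries (cols E) (paramData E t)) ++
  (List.range (paramData E t).length).flatMap (lowerEntries (cols E) (paramData E t))

/-- The tensor and the rank bound, printed. -/
def print (Γ : Type) [Code Γ R] (E : List (Mono R ω)) (t : ℕ) : Str Γ :=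
  joinStr ([numStr ((rows E t).length + (paramData E t).length),
    numStr ((cols E).length + (paramData E t).length), numStr ((paramData E t).length + 1)] ++
    (entries E t).map eltStr ++ [numStr (2 * (paramData E t).length + 1)])

end Completion

namespace PT

variable {Γ : Type} [Finite Γ] {α R ω : Type*} [Code Γ α] [Code Γ R] [Code Γ ω]

open Completion

@[fun_prop] theorem monos {f : α → List (List (R × List ω))} (hf : PT Γ f) :
    PT Γ (fun a => monos (f a)) := by
  unfold Completion.monos
  fun_prop

@[fun_prop] theorem steps {f : α → List (Mono R ω)} (hf : PT Γ f) :
    PT Γ (fun a => steps (f a)) := by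
  unfold Completion.steps
  fun_prop

@[fun_prop] theorem nodes {f : α → List (Mono R ω)} (hf : PT Γ f) :
    PT Γ (fun a => nodes (f a)) := by
  unfold Completion.nodes
  fun_prop

@[fun_prop] theorem cols {f : α → List (Mono R ω)} (hf : PT Γ f) :
    PT Γ (fun a => cols (f a)) := by
  unfold Completion.cols
  fun_prop

@[fun_prop] theorem rows {f : α → List (Mono R ω)} {t : α → ℕ} (hf : PT Γ f) (ht : PT Γ t) :
    PT Γ (fun a => rows (f a) (t a)) := by
  unfold Completion.rows
  fun_prop

@[fun_prop] theorem inNode {f : α → Step R ω} (hf : PT Γ f) : PT Γ (fun a => inNode (f a)) := by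
  unfold Completion.inNode
  fun_prop

@[fun_prop] theorem outNode {f : α → Step R ω} (hf : PT Γ f) : PT Γ (fun a => outNode (f a)) := by
  unfold Completion.outNode
  fun_prop

variable [InjCode Γ R] [InjCode Γ ω] [DecidableEq R] [DecidableEq ω] [CommRing R]

@[fun_prop] theorem paramData {f : α → List (Mono R ω)} {t : α → ℕ} (hf : PT Γ f) (ht : PT Γ t) :
    PT Γ (fun a => paramData (f a) (t a)) := by
  simp only [paramData_eq]
  fun_prop

@[fun_prop] theorem base {p : α → Row R ω} {q : α → Col R ω} (hp : PT Γ p) (hq : PT Γ q) :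
    PT Γ (fun a => (base (p a) (q a) : R)) := by
  simp only [base_eq]
  fun_prop

@[fun_prop] theorem dataRow {f : α → List (Row R ω) × List (Col R ω) × R} {p : α → Row R ω}
    (hf : PT Γ f) (hp : PT Γ p) : PT Γ (fun a => (dataRow (f a) (p a) : R)) := by
  unfold Completion.dataRow
  fun_prop

@[fun_prop] theorem dataEntry {f : α → List (Row R ω) × List (Col R ω) × R} {p : α → Row R ω}
    {q : α → Col R ω} (hf : PT Γ f) (hp : PT Γ p) (hq : PT Γ q) :
    PT Γ (fun a => (dataEntry (f a) (p a) (q a) : R)) := by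
  unfold Completion.dataEntry
  fun_prop

@[fun_prop] theorem upperEntries {V : α → List (Col R ω)}
    {D : α → List (List (Row R ω) × List (Col R ω) × R)} {p : α → Row R ω}
    (hV : PT Γ V) (hD : PT Γ D) (hp : PT Γ p) :
    PT Γ (fun a => upperEntries (V a) (D a) (p a)) := by
  unfold Completion.upperEntries
  fun_prop

@[fun_prop] theorem lowerEntries {V : α → List (Col R ω)}
    {D : α → List (List (Row R ω) × List (Col R ω) × R)} {i : α → ℕ}
    (hV : PT Γ V) (hD : PT Γ D) (hi : PT Γ i) :
    PT Γ (fun a => lowerEntries (V a) (D a) (i a)) := by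
  unfold Completion.lowerEntries
  fun_prop

@[fun_prop] theorem entries {f : α → List (Mono R ω)} {t : α → ℕ} (hf : PT Γ f) (ht : PT Γ t) :
    PT Γ (fun a => entries (f a) (t a)) := by
  unfold Completion.entries
  fun_prop

@[fun_prop] theorem print {f : α → List (Mono R ω)} {t : α → ℕ} (hf : PT Γ f) (ht : PT Γ t) :
    PT Γ (fun a => print Γ (f a) (t a)) := by
  unfold Completion.print
  fun_prop

end PT

end TensorComplexity


/-! ### Agreement of the printed string with the encoded instance -/

namespace TensorComplexity

open Code

section FinRange

theorem finRange_add_flatMap {α : Type*} (a b : ℕ) (f : Fin (a + b) → List α) :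
    (List.finRange (a + b)).flatMap f = (List.finRange a).flatMap (fun i => f (Fin.castAdd b i)) ++
      (List.finRange b).flatMap fun i => f (Fin.natAdd a i) := by
  simp only [List.flatMap_def, ← List.ofFn_eq_map, List.ofFn_add, List.flatten_append]
  rfl

theorem finRange_flatMap_get {α β : Type*} (l : List α) (f : α → List β) :
    (List.finRange l.length).flatMap (fun i => f (l.get i)) = l.flatMap f := by
  conv_rhs => rw [← List.map_get_finRange l, List.flatMap_map]

theorem finRange_map_get {α β : Type*} (l : List α) (f : α → β) :
    (List.finRange l.length).map (fun i => f (l.get i)) = l.map f := by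
  conv_rhs => rw [← List.map_get_finRange l, List.map_map]
  rfl

theorem zipIdx_map_map {α β γ : Type*} (l : List α) (g : α → β) (f : β × ℕ → γ) :
    (l.map g).zipIdx.map f = (List.finRange l.length).map fun i => f (g (l.get i), i) := by
  apply List.ext_getElem <;> simp

theorem range_flatMap {α : Type*} (n : ℕ) (f : ℕ → List α) :
    (List.range n).flatMap f = (List.finRange n).flatMap fun i : Fin n => f i.val := by
  rw [← List.map_coe_finRange_eq_range, List.flatMap_map]

end FinRange

namespace Completion

variable {R ω : Type*} [DecidableEq R] [DecidableEq ω] [CommRing R]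

/-- The ranges of the row and column indices split into the labels of the completion problem and the
additional indices, and the third range into `none` and the parameters. Block by block, positions in
the lists replace labels. -/
theorem entries_eq (E : List (Mono R ω)) (t : ℕ) :
    entries E t = (List.finRange _).flatMap fun i => (List.finRange _).flatMap fun j =>
      (List.finRange _).map fun k => tensor E t i j k := by
  have hlen : (paramData E t).length = (params E t).length := by simp [paramData]
  simp only [entries, finRange_add_flatMap, List.finRange_succ, tensor,
    finSumFinEquiv_symm_apply_castAdd, finSumFinEquiv_symm_apply_natAdd, List.map_cons,
    finSuccEquiv_zero, List.map_map, Function.comp_def, finSuccEquiv_succ, completionTensor,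
    hlen]
  congr 1
  · rw [← finRange_flatMap_get (rows E t)]
    congr 1
    funext p
    simp only [upperEntries, hlen]
    congr 1
    · rw [← finRange_flatMap_get (cols E)]
      congr 1
      funext q
      congr 1
      rw [paramData, List.map_map, ← finRange_map_get (params E t)]
      congr 1
      funext i
      simp only [Function.comp_apply, dataEntry, rowMatrix, colMatrix, rowFactor, colFactor,
        RingHom.id_apply]
      split_ifs <;> simp
    · rw [range_flatMap]
      congr 1
      funext j
      congr 1
      rw [paramData, zipIdx_map_map]
      congr 1
      funext i
      simp [dataRow, rowMatrix, rowFactor, Fin.val_inj]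
  · rw [range_flatMap]
    congr 1
    funext i
    simp only [lowerEntries, hlen]
    congr 1
    · rw [← finRange_flatMap_get (cols E)]
      congr 1
      funext q
      congr 1
      rw [paramData, List.map_map, ← finRange_map_get (params E t)]
      rfl
    · rw [range_flatMap]
      congr 1
      funext j
      congr 1
      · simp [Fin.val_inj]
      · rw [paramData, List.map_map, ← finRange_map_get (params E t)]
        rfl

/-- The instance of the rank problem that belongs to a system. -/
def rankInstance (E : List (Mono R ω)) (t : ℕ) : RankInstance R :=
  ⟨_, _, _, tensor E t, 2 * (params E t).length + 1⟩

end Completion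

/-- Ring elements, coded over the alphabet of instances. -/
abbrev eltCode {R : Type*} {Γ : Type} (e : R → List Γ) : Code Γ R := ⟨fun a => (e a).map Letter.ofElt⟩

theorem flatMap_encodeElt {R : Type*} {Γ : Type} (e : R → List Γ) {l m n : ℕ}
    (T : Tensor R l m n) :
    ((List.finRange l).flatMap fun i => (List.finRange m).flatMap fun j =>
      (List.finRange n).flatMap fun k => encodeElt e (T i j k)) =
    ((List.finRange l).flatMap fun i => (List.finRange m).flatMap fun j =>
      (List.finRange n).map fun k => T i j k).flatMap (encodeElt e) := by
  simp only [List.flatMap_assoc, List.flatMap_map]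

theorem joinStr_append {Γ : Type} (l l' : List (Str Γ)) :
    joinStr (l ++ l') = List.append (joinStr l) (joinStr l') := by
  induction l with
  | nil => rfl
  | cons a l ih =>
    show List.append a (joinStr (l ++ l')) = List.append (List.append a (joinStr l)) (joinStr l')
    rw [ih]
    exact (List.append_assoc _ _ _).symm

theorem Completion.print_eq {R : Type u} {ω : Type*} [DecidableEq R] [DecidableEq ω] [CommRing R]
    {Γ : Type} (e : R → List Γ) (E : List (Mono R ω)) (t : ℕ) :
    letI := eltCode e
    print Γ E t = (encodeRankInstance e (rankInstance E t) : List (Letter Γ)) := by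
  let := eltCode e
  have hlen : (paramData E t).length = (params E t).length := by simp [paramData]
  have h : ∀ l : List R, joinStr (l.map (eltStr (Γ := Γ))) = l.flatMap (encodeElt e) :=
    fun l => List.flatMap_def.symm
  rw [print, joinStr_append, joinStr_append, h]
  simp only [encodeRankInstance, rankInstance, flatMap_encodeElt, ← entries_eq, hlen]
  refine congrArg₂ List.append (congrArg₂ List.append ?_ rfl) ?_
  · show encodeNum _ ++ (encodeNum _ ++ (encodeNum _ ++ [])) = _
    simp
  · show encodeNum _ ++ [] = _
    simp

end TensorComplexity


namespace TensorComplexity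

open Code

/-! ### Parsing -/

/-- This makes parsers usable: a function of arbitrary words becomes a function of the instances
that these words encode. -/
theorem PolyTime.comap {Γ : Type} {α β γ : Type*} {ea : α → List (Letter Γ)}
    {eb : β → List (Letter Γ)} {f : α → β} (h : PolyTime ea eb f) (g : γ → α) :
    PolyTime (fun c => ea (g c)) eb (fun c => f (g c)) := by
  obtain ⟨P, t, hP⟩ := h
  exact ⟨P, t, fun c => hP (g c)⟩

theorem PolyTime.congr_enc {Γ : Type} {α β γ : Type*} {ea : α → List (Letter Γ)}
    {eb : β → List (Letter Γ)} {ec : γ → List (Letter Γ)} {f : α → β} {g : α → γ}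
    (h : PolyTime ea eb f) (hg : ∀ a, ec (g a) = eb (f a)) : PolyTime ea ec g := by
  obtain ⟨P, t, hP⟩ := h
  exact ⟨P, t, fun a i s => by rw [hg]; exact hP a i s⟩

section Split

variable {Γ : Type} [DecidableEq (Letter Γ)]

/-- One step of `splitEnd`. -/
def splitStep (c : Letter Γ) (st : List (List (Letter Γ)) × List (Letter Γ)) (x : Letter Γ) :
    List (List (Letter Γ)) × List (Letter Γ) :=
  if x = c then (st.1 ++ [st.2], []) else (st.1, st.2 ++ [x])

/-- The pieces of a word that are terminated by the given letter. -/
def splitEnd (c : Letter Γ) (l : List (Letter Γ)) : List (List (Letter Γ)) :=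
  (l.foldl (splitStep c) ([], [])).1

theorem splitEnd_flatMap {c : Letter Γ} {α : Type*} (l : List α) (w : α → List (Letter Γ))
    (h : ∀ a ∈ l, c ∉ w a) : splitEnd c (l.flatMap fun a => w a ++ [c]) = l.map w := by
  have h1 : ∀ (v : List (Letter Γ)) d x, c ∉ v → v.foldl (splitStep c) (d, x) = (d, x ++ v) := by
    intro v
    induction v with
    | nil => simp
    | cons y v ih =>
      intro d x hc
      rw [List.mem_cons, not_or] at hc
      rw [List.foldl_cons, splitStep, if_neg (Ne.symm hc.1), ih _ _ hc.2]
      simp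
  have h2 : ∀ d, (l.flatMap fun a => w a ++ [c]).foldl (splitStep c) (d, []) =
      (d ++ l.map w, []) := by
    induction l with
    | nil => simp
    | cons a l ih =>
      intro d
      rw [List.flatMap_cons, List.foldl_append, List.foldl_append,
        h1 _ _ _ (h a List.mem_cons_self), List.foldl_cons, List.foldl_nil, splitStep, if_pos rfl,
        ih fun b hb => h b (List.mem_cons_of_mem _ hb)]
      simp
  rw [splitEnd, h2]
  rfl

/-- The weights make an induction possible. An ordinary letter increases the second size by 3 and
the sum by 15, while closing a piece of size `s` replaces `5 * s` by `4 * s + 2`. -/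
theorem size_foldl_splitStep (c : Letter Γ) (l : List (Letter Γ)) :
    2 * size Γ (l.foldl (splitStep c) ([], [])).1 + 5 * size Γ (l.foldl (splitStep c) ([], [])).2 ≤
      15 * l.length := by
  induction l using List.reverseRecOn with
  | nil => simp
  | append_singleton l x ih =>
    rw [List.foldl_append, List.foldl_cons, List.foldl_nil, splitStep]
    have h1 : size Γ x = 1 := rfl
    split_ifs <;> simp [h1] <;> omega

end Split

namespace PT

variable {Γ : Type} [Finite Γ] [DecidableEq (Letter Γ)] {α : Type*} [Code Γ α]

@[fun_prop] theorem splitEnd {l : α → List (Letter Γ)} (c : Letter Γ) (hl : PT Γ l) :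
    PT Γ (fun a => splitEnd c (l a)) := by
  obtain ⟨s, hs⟩ := hl.exists_size_le
  have h : PT Γ (fun a => (l a).foldl (splitStep c) ([], [])) := by
    refine foldl_of_size (h := fun _ st x => splitStep c st x) hl (by fun_prop)
      (by unfold splitStep; fun_prop) (15 * s + 1) fun a l₁ l₂ h => ?_
    have h1 := size_foldl_splitStep c l₁
    have h2 := length_le_size (Γ := Γ) (l a)
    have h3 := hs a
    rw [h, List.length_append] at h2
    rw [h] at h3
    rw [size_prod]
    simp only [Polynomial.eval_add, Polynomial.eval_mul, Polynomial.eval_ofNat,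
      Polynomial.eval_one]
    rw [← h] at h2 h3
    change 2 * size Γ (l₁.foldl (splitStep c) ([], [])).1 +
      size Γ (l₁.foldl (splitStep c) ([], [])).2 + 1 ≤ _
    omega
  exact fst h

end PT

/-! ### Reading a polynomial system -/

/-- Letters of ring elements. -/
def isElt {Γ : Type} : Letter Γ → Bool
  | .ofElt _ => true
  | _ => false

/-- Letters of numbers. -/
def isNum {Γ : Type} : Letter Γ → Bool
  | .bit _ | .endNum => true
  | _ => false

/-- The digits of a number, as letters. -/
def digits {Γ : Type} (n : ℕ) : List (Letter Γ) := n.bits.map Letter.bit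

section Read

variable {R : Type u} {Γ : Type}

theorem filter_isElt_encodeElt (e : R → List Γ) (a : R) :
    (encodeElt e a).filter isElt = (e a).map Letter.ofElt := by
  simp [encodeElt, List.filter_append, isElt, List.filter_map, Function.comp_def]

theorem filter_isNum_encodeElt (e : R → List Γ) (a : R) : (encodeElt e a).filter isNum = [] := by
  simp [encodeElt, isNum]

theorem filter_isElt_encodeNum (n : ℕ) : (encodeNum n : List (Letter Γ)).filter isElt = [] := by
  simp only [encodeNum, List.filter_append, List.filter_map, Function.comp_def]
  simp [isElt]

theorem filter_isNum_encodeNum (n : ℕ) :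
    (encodeNum n : List (Letter Γ)).filter isNum = encodeNum n := by
  rw [List.filter_eq_self]
  intro c hc
  simp only [encodeNum, List.mem_append, List.mem_map, List.mem_singleton] at hc
  rcases hc with ⟨b, _, rfl⟩ | rfl <;> rfl

theorem digits_injective : Function.Injective (digits (Γ := Γ)) := by
  intro m n h
  have hb : Function.Injective (Letter.bit (Γ := Γ)) := fun a b h => by simpa using h
  have := List.map_injective_iff.mpr hb h
  have key : ∀ n : ℕ, n = n.bits.foldr (fun b m => Nat.bit b m) 0 := fun n => by
    induction n using Nat.binaryRec' with
    | zero => simp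
    | bit b n hn ih => rw [Nat.bits_append_bit n b hn, List.foldr_cons, ← ih]
  rw [key m, key n, this]

variable [DecidableEq (Letter Γ)]

theorem splitEnd_encodeNum (l : List ℕ) :
    splitEnd (Γ := Γ) .endNum (l.flatMap encodeNum) = l.map digits :=
  splitEnd_flatMap (c := .endNum) l digits (by simp [digits])

/-- The coefficient and the variables of a monomial. -/
def readMonomial (M : List (Letter Γ)) : Str Γ × List (List (Letter Γ)) :=
  (toStr (M.filter isElt), splitEnd .endNum (M.filter isNum))

/-- The polynomials of a system. -/
def readSystem (w : Str Γ) : List (List (Str Γ × List (List (Letter Γ)))) :=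
  (splitEnd .endPoly (enc w)).map fun P => (splitEnd .endMonomial P).map readMonomial

/-- A system, with variables named by strings of digits. -/
def digitSystem (Γ : Type) (F : PolySystem R) : List (List (R × List (List (Letter Γ)))) :=
  F.map fun f => f.map fun p => (p.coeff, p.vars.map digits)

/-- No terminator occurs inside the pieces it closes. Within a monomial, coefficient and variables
use different letters and are separated by filters. -/
theorem readSystem_encodeSystem (e : R → List Γ) (F : PolySystem R) :
    readSystem (encodeSystem e F) = (digitSystem Γ F).map fun f => f.map fun p =>
      (toStr ((e p.1).map Letter.ofElt), p.2) := by
  have h1 : splitEnd .endPoly (encodeSystem e F) = F.map fun f => f.flatMap (encodeMonomial e) :=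
    splitEnd_flatMap F _ (by simp [encodeMonomial, encodeElt, encodeNum])
  have h2 : ∀ f : StoredPoly R, splitEnd .endMonomial (f.flatMap (encodeMonomial e)) =
      f.map fun p => encodeElt e p.coeff ++ p.vars.flatMap encodeNum := fun f =>
    splitEnd_flatMap f _ (by simp [encodeElt, encodeNum])
  have h3 : ∀ p : StoredMonomial R, readMonomial (encodeElt e p.coeff ++ p.vars.flatMap encodeNum) =
      (toStr ((e p.coeff).map Letter.ofElt), p.vars.map digits) := fun p => by
    rw [readMonomial, List.filter_append, List.filter_append, filter_isElt_encodeElt,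
      filter_isNum_encodeElt, List.filter_flatMap, List.filter_flatMap]
    simp only [filter_isElt_encodeNum, filter_isNum_encodeNum, List.nil_append, splitEnd_encodeNum]
    congr 2
    simp
  show (splitEnd .endPoly (encodeSystem e F)).map _ = _
  rw [h1]
  simp only [digitSystem, List.map_map, Function.comp_def, h2, h3]

variable [Finite Γ]

theorem polyTime_digitSystem (e : R → List Γ) :
    letI := eltCode e
    PolyTime (encodeSystem e) (enc (Γ := Γ)) (digitSystem Γ) := by
  let := eltCode e
  have h : PT Γ (readSystem (Γ := Γ)) := by
    have h0 : PT Γ fun a : Str Γ => (enc (Γ := Γ) a : List (Letter Γ)) := PT.lettersOf PT.id'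
    have h1 : PT Γ (isElt (Γ := Γ)) := PT.ofLetter _
    have h2 : PT Γ (isNum (Γ := Γ)) := PT.ofLetter _
    have h3 : PT Γ (readMonomial (Γ := Γ)) := by
      unfold readMonomial
      fun_prop
    unfold readSystem
    fun_prop
  refine PolyTime.congr_enc (PolyTime.comap h (encodeSystem e)) fun F => ?_
  rw [readSystem_encodeSystem]
  show listEnc _ _ = listEnc _ _
  rw [listEnc, listEnc, List.flatMap_map]
  congr 1
  funext f
  congr 2
  show listEnc _ _ = listEnc _ _
  rw [listEnc, listEnc, List.flatMap_map]
  rfl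

end Read

end TensorComplexity


namespace TensorComplexity

open Code Completion

/-! ### From polynomial systems to tensor rank -/

namespace Completion

variable {R ω : Type*}

/-- The tags distinguish equal monomials at different places, so that each has its own nodes and
parameters. -/
theorem nodup_monos (F : List (List (R × List ω))) : (monos F).Nodup := by
  have h : ∀ {α : Type _} (l : List α), l.zipIdx.Nodup := fun l =>
    List.Nodup.of_map Prod.snd (by simpa using List.nodup_range')
  rw [monos, List.nodup_flatMap]
  refine ⟨fun P _ => (h P.1).map ?_, ?_⟩
  · rintro ⟨a, b⟩ ⟨a', b'⟩ h
    simp only [Prod.mk.injEq, true_and] at h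
    simp [h]
  · have h1 : (F.zipIdx.map Prod.snd).Nodup := by simpa using List.nodup_range'
    refine (List.pairwise_map.mp h1).imp fun {P P'} hne => ?_
    intro m hm hm'
    obtain ⟨M, -, rfl⟩ := List.mem_map.mp hm
    obtain ⟨M', -, h⟩ := List.mem_map.mp hm'
    exact hne (congrArg (fun m => m.1.1) h).symm

theorem sum_zipIdx_ite {α K : Type*} [AddCommMonoid K] (l : List α) (k : α → K) (n i : ℕ)
    (hi : i < l.length) :
    ((l.zipIdx n).map fun x => if x.2 = n + i then k x.1 else 0).sum = k l[i] := by
  induction l generalizing n i with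
  | nil => simp at hi
  | cons a l ih =>
    rw [List.zipIdx_cons, List.map_cons, List.sum_cons]
    rcases i with _ | i
    · rw [if_pos (Nat.add_zero n).symm, List.sum_eq_zero, add_zero]
      · rfl
      · intro b hb
        obtain ⟨x, hx, rfl⟩ := List.mem_map.mp hb
        have := List.le_snd_of_mem_zipIdx hx
        rw [if_neg (by omega)]
    · rw [if_neg (by omega), zero_add, List.getElem_cons_succ, ← ih (n + 1) i (by simpa using hi)]
      simp only [Nat.add_right_comm n 1 i, Nat.add_assoc]

theorem sum_monos [DecidableEq R] [DecidableEq ω] {K : Type*} [AddCommMonoid K]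
    (F : List (List (R × List ω))) (k : R × List ω → K) (i : ℕ) (hi : i < F.length) :
    ∑ m ∈ (monos F).toFinset, (if m.1.1 = i then k m.2 else 0) = (F[i].map k).sum := by
  rw [List.sum_toFinset _ (nodup_monos F), monos, List.map_flatMap]
  have h := sum_zipIdx_ite F (fun P => (P.map k).sum) 0 i hi
  rw [← h, List.flatMap_def, List.sum_flatten, List.map_map]
  congr 1
  refine List.map_congr_left fun P _ => ?_
  simp only [Function.comp_def, zero_add, List.map_map]
  split_ifs with hP
  · rw [← Function.comp_def k Prod.fst, ← List.map_map]
    simp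
  · simp

variable [CommRing R] {Γ : Type} [DecidableEq R] [DecidableEq (Letter Γ)]

theorem solves_monos {K : Type*} [CommRing K] [DecidableEq ω] (φ : R →+* K)
    (F : List (List (R × List ω))) (y : ω → K) :
    Solves φ (monos F) F.length y ↔
      ∀ f ∈ F, (f.map fun p => (p.2.map y).prod * φ p.1).sum = 0 := by
  have h : ∀ m : Mono R ω, prefixValue y (m, m.2.2.length) = (m.2.2.map y).prod := fun m => by
    simp [prefixValue]
  rw [List.forall_mem_iff_getElem]
  refine forall₂_congr fun i hi => ?_
  simp only [h]
  rw [sum_monos F (fun p => (p.2.map y).prod * φ p.1) i hi]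

end Completion

section

variable {R : Type u} [CommRing R] {S : Type v} [CommRing S] [Algebra R S]

theorem aeval_toMvPolynomial (x : ℕ → S) (f : StoredPoly R) :
    MvPolynomial.aeval x f.toMvPolynomial =
      (f.map fun p => (p.vars.map x).prod * algebraMap R S p.coeff).sum := by
  rw [StoredPoly.toMvPolynomial, map_list_sum, List.map_map]
  congr 1
  refine List.map_congr_left fun p _ => ?_
  simp [StoredMonomial.toMvPolynomial, map_list_prod, mul_comm, Function.comp_def]

theorem hasSolution_iff_exists_solves [DecidableEq R] (Γ : Type) [DecidableEq (Letter Γ)]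
    (F : PolySystem R) :
    F.HasSolution S ↔
      ∃ y, Solves (algebraMap R S) (monos (digitSystem Γ F)) (digitSystem Γ F).length y := by
  simp only [solves_monos, PolySystem.HasSolution, aeval_toMvPolynomial]
  constructor
  · rintro ⟨x, hx⟩
    -- Variables are now named by words. Words that are not digit strings name no variable of the
    -- system and receive the value 0.
    refine ⟨Function.extend digits x 0, ?_⟩
    simp only [digitSystem, List.forall_mem_map, List.map_map, Function.comp_def,
      digits_injective.extend_apply]
    exact hx
  · rintro ⟨y, hy⟩
    refine ⟨fun n => y (digits n), ?_⟩
    simpa only [digitSystem, List.forall_mem_map, List.map_map, Function.comp_def] using hy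

/-- Injectivity of the code lets the machine compare labels, which contain coefficients. Variables
are named by their digit strings, so indices are never expanded into unary. -/
theorem polySystem_reduces_tensorRank [IsDomain S] {Γ : Type} [Finite Γ] (e : R → List Γ)
    (he : Function.Injective e) :
    PolyTimeReduces (polySystemProblem S e) (tensorRankProblem S e) := by
  classical
  let := eltCode e
  have : InjCode Γ R := ⟨fun a b h => he (List.map_injective_iff.mpr
    (fun _ _ h => by simpa using h) h)⟩
  refine ⟨fun F => rankInstance (monos (digitSystem Γ F)) (digitSystem Γ F).length,
    PolyTime.polyTimeComputable ?_, fun F => ?_⟩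
  · have h : PT Γ fun G : List (List (R × List (List (Letter Γ)))) =>
      Completion.print Γ (monos G) G.length := by fun_prop
    exact PolyTime.congr_enc (PolyTime.comp h (polyTime_digitSystem e)) fun F =>
      (Completion.print_eq e _ _).symm
  · exact (hasSolution_iff_exists_solves Γ F).trans
      (rankOver_tensor_le_iff S (nodup_monos _) _).symm

end

end TensorComplexity


namespace TensorComplexity

open Code

/-! ### From tensor rank to polynomial systems -/

theorem Tensor.isSumOfSimple_card {S : Type*} [CommRing S] {l m n : ℕ} (T : Tensor S l m n) :
    T.IsSumOfSimple (l * (m * n)) := by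
  let e : Fin (l * (m * n)) ≃ Fin l × Fin m × Fin n :=
    (Fintype.equivFinOfCardEq (by simp)).symm
  let V : Fin l × Fin m × Fin n → Tensor S l m n := fun p i j k =>
    (if i = p.1 then T p.1 p.2.1 p.2.2 else 0) * (if j = p.2.1 then 1 else 0) *
      (if k = p.2.2 then 1 else 0)
  refine ⟨fun q => V (e q), fun q => ⟨_, _, _, rfl⟩, ?_⟩
  rw [e.sum_comp V]
  funext i j k
  simp only [Finset.sum_apply, V]
  simp [Fintype.sum_prod_type]

/-- A bound given in binary may be exponentially large, and this cap keeps the number of unknowns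
polynomial. Any cap of at least `l * (m * n)` would do; this one is what `below` produces. -/
theorem Tensor.rank_le_min_iff {S : Type*} [CommRing S] {l m n r : ℕ} (T : Tensor S l m n) :
    T.rank ≤ min r (l * (m * n) + 1) ↔ T.rank ≤ r := by
  have : T.rank ≤ l * (m * n) := Nat.sInf_le T.isSumOfSimple_card
  omega

/-- The variable that stands for the `i`th coordinate of the `c`th factor of the `q`th summand. -/
def coordVar (c q i : ℕ) : ℕ := Nat.pair c (Nat.pair q i)

namespace RankInstance

variable {R : Type u} [CommRing R]

/-- The positions of the entries, in lexicographic order. -/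
def positions (l m n : ℕ) : List (Fin l × Fin m × Fin n) :=
  (List.finRange l).flatMap fun i => (List.finRange m).flatMap fun j =>
    (List.finRange n).map fun k => (i, j, k)

theorem length_positions (l m n : ℕ) : (positions l m n).length = l * (m * n) := by
  simp [positions, List.length_flatMap]

theorem mem_positions {l m n : ℕ} (p : Fin l × Fin m × Fin n) : p ∈ positions l m n := by
  obtain ⟨i, j, k⟩ := p
  simp [positions]

/-- The equation of one entry: `a` is a sum of simple tensors at position `(i, j, k)`. -/
def entryPoly (s : List ℕ) (i j k : ℕ) (a : R) : StoredPoly R :=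
  ⟨a, []⟩ :: s.map fun q => ⟨-1, [coordVar 0 q i, coordVar 1 q j, coordVar 2 q k]⟩

/-- The equations that express a rank bound. -/
def system (I : RankInstance R) : PolySystem R :=
  (positions I.l I.m I.n).map fun p =>
    entryPoly (List.range (min I.bound (I.l * (I.m * I.n) + 1))) p.1 p.2.1 p.2.2
      (I.tensor p.1 p.2.1 p.2.2)

theorem system_hasSolution_iff (S : Type v) [CommRing S] [Algebra R S] (I : RankInstance R) :
    I.tensor.rankOver S ≤ I.bound ↔ I.system.HasSolution S := by
  rw [Tensor.rankOver, ← Tensor.rank_le_min_iff, Tensor.rank_le_iff]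
  have h : ∀ (x : ℕ → S) (r i j k : ℕ) (a : R),
      MvPolynomial.aeval x (StoredPoly.toMvPolynomial (entryPoly (List.range r) i j k a)) = 0 ↔
      algebraMap R S a = ∑ q : Fin r,
        x (coordVar 0 q i) * x (coordVar 1 q j) * x (coordVar 2 q k) := fun x r i j k a => by
    rw [aeval_toMvPolynomial, entryPoly, List.map_cons, List.sum_cons, List.map_map,
      ← List.sum_toFinset _ List.nodup_range, List.toFinset_range,
      Finset.sum_range fun q => ((fun p => (p.vars.map x).prod * algebraMap R S p.coeff) ∘
        fun q => (⟨-1, [coordVar 0 q i, coordVar 1 q j, coordVar 2 q k]⟩ : StoredMonomial R)) q]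
    simp [mul_assoc, add_neg_eq_zero]
  simp only [PolySystem.HasSolution, system, List.forall_mem_map, h]
  constructor
  · rintro ⟨a, b, c, habc⟩
    -- Variables outside the ranges of the indices do not occur in the equations and are set to 0.
    let ext : ∀ {d : ℕ}, (Fin (min I.bound (I.l * (I.m * I.n) + 1)) → Fin d → S) → ℕ × ℕ → S :=
      fun {d} g p => if h : p.1 < min I.bound (I.l * (I.m * I.n) + 1) ∧ p.2 < d then
        g ⟨p.1, h.1⟩ ⟨p.2, h.2⟩ else 0
    have hext : ∀ {d : ℕ} (g : Fin (min I.bound (I.l * (I.m * I.n) + 1)) → Fin d → S) q i,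
        ext g (q.val, i.val) = g q i := fun g q i => dif_pos ⟨q.2, i.2⟩
    refine ⟨fun v => if v.unpair.1 = 0 then ext a v.unpair.2.unpair else
      if v.unpair.1 = 1 then ext b v.unpair.2.unpair else ext c v.unpair.2.unpair, fun p _ => ?_⟩
    rw [habc]
    simp [coordVar, hext]
  · rintro ⟨x, hx⟩
    exact ⟨fun q i => x (coordVar 0 q i), fun q i => x (coordVar 1 q i),
      fun q i => x (coordVar 2 q i), fun i j k => hx _ (mem_positions (i, j, k))⟩

end RankInstance

/-- The numbers `k < N + 1` below the number with the given digits. -/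
def below {Γ : Type} [DecidableEq (Letter Γ)] (N : ℕ) (d : List (Letter Γ)) : List ℕ :=
  (List.range (N + 1)).filter fun k => !(List.range (k + 1)).any fun j => decide (digits j = d)

/-- A number `k` is kept as long as no `j ≤ k` has the digits of `n`. Digit strings are compared, so
a huge `n` is never written in unary. -/
theorem below_digits {Γ : Type} [DecidableEq (Letter Γ)] (N n : ℕ) :
    below N (digits n : List (Letter Γ)) = List.range (min n (N + 1)) := by
  have h1 : below N (digits n : List (Letter Γ)) = (List.range (N + 1)).filter (· < n) := by
    refine List.filter_congr fun k _ => ?_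
    rw [Bool.eq_iff_iff]
    simp only [Bool.not_eq_true', List.any_eq_false, List.mem_range, decide_eq_true_eq,
      digits_injective.eq_iff]
    exact ⟨fun h => by by_contra hk; exact h n (by omega) rfl, fun h j hj => by omega⟩
  have h2 : ∀ M, (List.range M).filter (· < n) = List.range (min n M) := fun M => by
    induction M with
    | zero => simp
    | succ M ih =>
      rw [List.range_succ, List.filter_append, ih]
      by_cases h : M < n
      · rw [min_eq_right (by omega), min_eq_right (by omega), List.range_succ]
        simp [h]
      · rw [min_eq_left (by omega), min_eq_left (by omega)]
        simp [h]
  rw [h1, h2]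

/-- The positions of the entries, computed from the digits of the dimensions. -/
def triples {Γ : Type} [DecidableEq (Letter Γ)] (N : ℕ) (d₁ d₂ d₃ : List (Letter Γ)) :
    List (ℕ × ℕ × ℕ) :=
  (below N d₁).flatMap fun i => (below N d₂).flatMap fun j => (below N d₃).map fun k => (i, j, k)

theorem triples_zip {Γ : Type} [DecidableEq (Letter Γ)] {α : Type*} {l m n : ℕ}
    (f : Fin l × Fin m × Fin n → α) :
    (triples (l * (m * n)) (digits l : List (Letter Γ)) (digits m) (digits n)).zip
      ((RankInstance.positions l m n).map f) =
      (RankInstance.positions l m n).map fun p => ((p.1.val, p.2.1.val, p.2.2.val), f p) := by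
  -- Without entries a dimension may exceed the cap of `below`, but then the second list of the zip
  -- is empty. Otherwise every dimension is at most the number of entries and the cap has no effect.
  by_cases h0 : l * (m * n) = 0
  · rw [List.eq_nil_of_length_eq_zero ((RankInstance.length_positions l m n).trans h0)]
    simp
  have hl : l ≤ l * (m * n) := Nat.le_mul_of_pos_right _ (Nat.pos_of_ne_zero (right_ne_zero_of_mul h0))
  have hmn : m * n ≤ l * (m * n) :=
    Nat.le_mul_of_pos_left _ (Nat.pos_of_ne_zero (left_ne_zero_of_mul h0))
  have hm : m ≤ m * n := Nat.le_mul_of_pos_right _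
    (Nat.pos_of_ne_zero (right_ne_zero_of_mul (right_ne_zero_of_mul h0)))
  have hn : n ≤ m * n := Nat.le_mul_of_pos_left _
    (Nat.pos_of_ne_zero (left_ne_zero_of_mul (right_ne_zero_of_mul h0)))
  have : triples (l * (m * n)) (digits l : List (Letter Γ)) (digits m) (digits n) =
      (RankInstance.positions l m n).map fun p => (p.1.val, p.2.1.val, p.2.2.val) := by
    rw [triples, below_digits, below_digits, below_digits, min_eq_left (by omega),
      min_eq_left (by omega), min_eq_left (by omega)]
    simp only [RankInstance.positions, List.map_flatMap, List.map_map,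
      ← List.map_coe_finRange_eq_range, List.flatMap_map]
    rfl
  rw [this, List.zip_map']

/-- Letters of ring elements and their terminator. -/
def isEltPart {Γ : Type} : Letter Γ → Bool
  | .ofElt _ | .endElt => true
  | _ => false

section Read

variable {R : Type u} {Γ : Type}

theorem filter_isEltPart_encodeElt (e : R → List Γ) (a : R) :
    (encodeElt e a).filter isEltPart = encodeElt e a := by
  rw [List.filter_eq_self]
  intro c hc
  simp only [encodeElt, List.mem_append, List.mem_map, List.mem_singleton] at hc
  rcases hc with ⟨b, _, rfl⟩ | rfl <;> rfl

theorem filter_isEltPart_encodeNum (n : ℕ) :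
    (encodeNum n : List (Letter Γ)).filter isEltPart = [] := by
  simp only [encodeNum, List.filter_append, List.filter_map, Function.comp_def]
  simp [isEltPart]

/-- The entries of a tensor in lexicographic order. -/
def RankInstance.entries (I : RankInstance R) : List R :=
  (RankInstance.positions I.l I.m I.n).map fun p => I.tensor p.1 p.2.1 p.2.2

theorem encodeRankInstance_eq (e : R → List Γ) (I : RankInstance R) :
    encodeRankInstance e I = encodeNum I.l ++ encodeNum I.m ++ encodeNum I.n ++
      I.entries.flatMap (encodeElt e) ++ encodeNum I.bound := by
  rw [encodeRankInstance, flatMap_encodeElt]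
  congr 3
  simp only [RankInstance.entries, RankInstance.positions, List.map_flatMap, List.map_map]
  rfl

variable [DecidableEq (Letter Γ)]

/-- The numbers and the entries of an instance of the rank problem. -/
def readRank (w : Str Γ) : List (List (Letter Γ)) × List (Str Γ) :=
  (splitEnd .endNum ((enc w).filter isNum),
    (splitEnd .endElt ((enc w).filter isEltPart)).map toStr)

/-- The digits of the dimensions and of the bound, and the entries. -/
def rankData (Γ : Type) (I : RankInstance R) : List (List (Letter Γ)) × List R :=
  ([digits I.l, digits I.m, digits I.n, digits I.bound], I.entries)

theorem readRank_encodeRankInstance (e : R → List Γ) (I : RankInstance R) :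
    readRank (encodeRankInstance e I) =
      ((rankData Γ I).1, (rankData Γ I).2.map fun a => toStr ((e a).map Letter.ofElt)) := by
  have h1 : (encodeRankInstance e I).filter isNum =
      [I.l, I.m, I.n, I.bound].flatMap encodeNum := by
    simp [encodeRankInstance_eq, List.filter_append, filter_isNum_encodeNum, List.filter_flatMap,
      filter_isNum_encodeElt]
  have h2 : (encodeRankInstance e I).filter isEltPart = I.entries.flatMap (encodeElt e) := by
    simp [encodeRankInstance_eq, List.filter_append, filter_isEltPart_encodeNum,
      List.filter_flatMap, filter_isEltPart_encodeElt]
  show (splitEnd .endNum ((encodeRankInstance e I).filter isNum), _) = _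
  rw [h1, splitEnd_encodeNum]
  refine congrArg (Prod.mk _) ?_
  show (splitEnd .endElt ((encodeRankInstance e I).filter isEltPart)).map toStr = _
  rw [h2]
  exact (congrArg _ (splitEnd_flatMap I.entries (fun a => (e a).map Letter.ofElt) (by simp))).trans
    (List.map_map ..)

theorem polyTime_rankData [Finite Γ] (e : R → List Γ) :
    letI := eltCode e
    PolyTime (encodeRankInstance e) (enc (Γ := Γ)) (rankData Γ) := by
  let := eltCode e
  have h : PT Γ (readRank (Γ := Γ)) := by
    have h0 : PT Γ fun a : Str Γ => (enc (Γ := Γ) a : List (Letter Γ)) := PT.lettersOf PT.id'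
    have h1 : PT Γ (isEltPart (Γ := Γ)) := PT.ofLetter _
    have h2 : PT Γ (isNum (Γ := Γ)) := PT.ofLetter _
    unfold readRank
    fun_prop
  refine PolyTime.congr_enc (PolyTime.comap h (encodeRankInstance e)) fun I => ?_
  rw [readRank_encodeRankInstance]
  show prodEnc _ _ _ = prodEnc _ _ _
  rw [prodEnc, prodEnc]
  congr 1
  show listEnc _ _ = listEnc _ _
  rw [listEnc, listEnc, List.flatMap_map]
  rfl

end Read

/-- The equation of an entry, printed. -/
def polyStr {R : Type*} [CommRing R] {Γ : Type} [Code Γ R] (s : List ℕ) (p : (ℕ × ℕ × ℕ) × R) :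
    Str Γ :=
  joinStr ([eltStr p.2, toStr [.endMonomial]] ++ (s.flatMap fun q => [eltStr (-1 : R),
    numStr (coordVar 0 q p.1.1), numStr (coordVar 1 q p.1.2.1), numStr (coordVar 2 q p.1.2.2),
    toStr [.endMonomial]]) ++ [toStr [.endPoly]])

/-- The equations that express a rank bound, printed. -/
def systemStr {R : Type*} [CommRing R] {Γ : Type} [Code Γ R] [DecidableEq (Letter Γ)]
    (I : List (List (Letter Γ)) × List R) : Str Γ :=
  joinStr (((triples I.2.length (I.1.headD []) (I.1.tail.headD []) (I.1.tail.tail.headD [])).zip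
    I.2).map (polyStr (below I.2.length (I.1.tail.tail.tail.headD []))))

namespace PT

variable {Γ : Type} [Finite Γ] [DecidableEq (Letter Γ)] {α R : Type*} [Code Γ α] [Code Γ R]
  [CommRing R]

@[fun_prop] theorem pair {f g : α → ℕ} (hf : PT Γ f) (hg : PT Γ g) :
    PT Γ (fun a => Nat.pair (f a) (g a)) := by
  unfold Nat.pair
  fun_prop

@[fun_prop] theorem coordVar {f g h : α → ℕ} (hf : PT Γ f) (hg : PT Γ g) (hh : PT Γ h) :
    PT Γ (fun a => coordVar (f a) (g a) (h a)) := by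
  unfold TensorComplexity.coordVar
  fun_prop

@[fun_prop] theorem digits {f : α → ℕ} (hf : PT Γ f) :
    PT Γ (fun a => (digits (f a) : List (Letter Γ))) := by
  unfold TensorComplexity.digits
  fun_prop

@[fun_prop] theorem below {f : α → ℕ} {d : α → List (Letter Γ)} (hf : PT Γ f) (hd : PT Γ d) :
    PT Γ (fun a => below (f a) (d a)) := by
  unfold TensorComplexity.below
  fun_prop

@[fun_prop] theorem triples {f : α → ℕ} {d d' d'' : α → List (Letter Γ)} (hf : PT Γ f)
    (hd : PT Γ d) (hd' : PT Γ d') (hd'' : PT Γ d'') :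
    PT Γ (fun a => triples (f a) (d a) (d' a) (d'' a)) := by
  unfold TensorComplexity.triples
  fun_prop

@[fun_prop] theorem polyStr {s : α → List ℕ} {p : α → (ℕ × ℕ × ℕ) × R} (hs : PT Γ s)
    (hp : PT Γ p) : PT Γ (fun a => (polyStr (s a) (p a) : Str Γ)) := by
  unfold TensorComplexity.polyStr
  fun_prop

theorem systemStr : PT Γ (systemStr (R := R) (Γ := Γ)) := by
  unfold TensorComplexity.systemStr
  fun_prop

end PT

theorem systemStr_eq {R : Type u} [CommRing R] {Γ : Type} [DecidableEq (Letter Γ)]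
    (e : R → List Γ) (I : RankInstance R) :
    letI := eltCode e
    systemStr (rankData Γ I) = (encodeSystem e I.system : List (Letter Γ)) := by
  let := eltCode e
  have hlen : I.entries.length = I.l * (I.m * I.n) := by
    rw [RankInstance.entries, List.length_map, RankInstance.length_positions]
  have h : ∀ (s : List ℕ) (i j k : ℕ) (a : R), polyStr s ((i, j, k), a) =
      (encodePoly e (RankInstance.entryPoly s i j k a) : List (Letter Γ)) := fun s i j k a => by
    have hj : ∀ g : ℕ → List (Str Γ), joinStr (s.flatMap g) =
        List.flatMap (fun q => joinStr (g q)) s := fun g => by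
      induction s with
      | nil => rfl
      | cons q s ih => rw [List.flatMap_cons, joinStr_append, ih]; rfl
    rw [polyStr, joinStr_append, joinStr_append, hj, encodePoly, RankInstance.entryPoly,
      List.flatMap_cons, List.flatMap_map]
    refine congrArg₂ List.append (congrArg₂ List.append ?_ (congrArg (List.flatMap · s) ?_)) rfl
    · show encodeElt e a ++ ([.endMonomial] ++ []) = encodeElt e a ++ [] ++ [.endMonomial]
      simp
    · funext q
      show encodeElt e _ ++ (encodeNum _ ++ (encodeNum _ ++ (encodeNum _ ++ ([.endMonomial] ++ [])))) =
        encodeElt e _ ++ [_, _, _].flatMap encodeNum ++ [.endMonomial]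
      simp
  rw [systemStr]
  simp only [rankData, List.headD_cons, List.tail_cons, hlen, below_digits]
  rw [RankInstance.entries, triples_zip, List.map_map]
  simp only [Function.comp_def, h]
  rw [RankInstance.system, encodeSystem, List.flatMap_map, List.flatMap_def]
  rfl

theorem tensorRank_reduces_polySystem {R : Type u} [CommRing R] (S : Type v) [CommRing S]
    [Algebra R S] {Γ : Type} [Finite Γ] (e : R → List Γ) :
    PolyTimeReduces (tensorRankProblem S e) (polySystemProblem S e) := by
  classical
  let := eltCode e
  refine ⟨RankInstance.system, PolyTime.polyTimeComputable ?_,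
    RankInstance.system_hasSolution_iff S⟩
  exact PolyTime.congr_enc (PolyTime.comp PT.systemStr (polyTime_rankData e)) fun I =>
    (systemStr_eq e I).symm

end TensorComplexity


theorem theorem2p2 {R : Type u} [CommRing R] [IsDomain R] {S : Type v} [CommRing S] [IsDomain S]
    [Algebra R S] (hRS : Function.Injective (algebraMap R S))
    {Γ : Type} [Fintype Γ] (enc : R → List Γ) (henc : TensorComplexity.IsPolyTimeEncoding enc) :
    TensorComplexity.PolyTimeEquivalent
      (TensorComplexity.tensorRankProblem S enc) (TensorComplexity.polySystemProblem S enc) :=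
  ⟨TensorComplexity.tensorRank_reduces_polySystem S enc,
    TensorComplexity.polySystem_reduces_tensorRank enc henc.injective⟩
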